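/- **Theorem 2.** Let $(X_j)_{j\in\mathbb Z}$ be a sequence of integrable, centered real random variables on a probability space $(\Omega,\mathcal A,\mathbb P)$. *Dependence coefficients.* For a $\sigma$-algebra $\mathcal M\subset\mathcal A$ and an integrable real random variable $Y$, let $$\tau(\mathcal M,Y)=\Big\|\sup_{f\in\Lambda_1(\mathbb R)}\Big|\int f\,d\mathbb P_{Y\mid\mathcal M}-\int f\,d\mathbb P_Y\Big|\Big\|_1,$$ where $\mathbb P_{Y\mid\mathcal M}$ is a conditional distribution of $Y$ given $\mathcal M$, $\mathbb P_Y$ is the law of $Y$ and $\Lambda_1(\mathbb R)$ is the set of $1$-Lipschitz functions $\mathbb R\to\mathbb R$. For an integrable random vector $Y$ in $\mathbb R^k$, let $\tau(\mathcal M,Y)=\sup\{\tau(\mathcal M,f(Y)) : f\in\Lambda_1(\mathbb R^k)\}$, where $\Lambda_1(\mathbb R^k)$ is the set of functions $\mathbb R^k\to\mathbb R$ that are $1$-Lipschitz for the distance $\sum_i|x_i-y_i|$. With $\mathcal M_p=\sigma(X_j,\,j\le p)$, let, for each integer $i\ge 0$, $$\tau_k(i)=\max_{1\le \ell\le k}\frac1\ell\sup\big\{\tau(\mathcal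 M_p,(X_{j_1},\dots,X_{j_\ell})) : p\in\mathbb Z,\ p+i\le j_1<\dots<j_\ell\big\},\qquad \tau(i)=\sup_{k}\tau_k(i),$$ and $\tau(x)=\tau([x])$ for real $x\ge 1$, where $[x]$ is the integer part of $x$. *Assumptions.* Assume that there are constants $c,\gamma_1,\gamma_2>0$ such that $\tau(x)\le\exp(-cx^{\gamma_1})$ for every $x\ge1$, that $\sup_{k>0}\mathbb P(|X_k|>t)\le\exp(1-t^{\gamma_2})$ for every $t>0$, and that $\gamma<1$, where $\gamma$ is defined by $1/\gamma=1/\gamma_1+1/\gamma_2$. Let $S_n=X_1+\dots+X_n$ and $\sigma_n^2=\mathrm{Var}\,S_n$, and assume that $\liminf_{n\to\infty}\sigma_n^2/n>0$. *Conclusion.* For every sequence of positive numbers $a_n$ with $a_n\to0$ and $a_n n^{\gamma/(2-\gamma)}\to\infty$, the sequence $(S_n/\sigma_n)_n$ satisfies the moderate deviation principle with speed $a_n$ and the good rate function $I(t)=t^2/2$ (lower semicontinuous with compact level sets); that is, for every Borel set $A\subset\mathbb R$, $$-\inf_{t\in A^{\circ}}\frac{t^2}{2}\le\liminf_{n\to\infty}a_n\log\mathbb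 P\Big(\sqrt{a_n}\,\frac{S_n}{\sigma_n}\in A\Big)\le\limsup_{n\to\infty}a_n\log\mathbb P\Big(\sqrt{a_n}\,\frac{S_n}{\sigma_n}\in A\Big)\le-\inf_{t\in\bar A}\frac{t^2}{2},$$ where $A^\circ$ and $\bar A$ are the interior and the closure of $A$, $\inf\emptyset=+\infty$ and $\log0=-\infty$. -/

import Mathlib

open MeasureTheory ProbabilityTheory Filter Topology
open scoped NNReal ENNReal

namespace ModerateDeviations

/-- `(condLaw m μ Y) ω` is a regular conditional distribution of the real random variable `Y`
given the sub-`σ`-algebra `m`, i.e. given the identity map seen as a map into `(Ω, m)`. -/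
noncomputable def condLaw {Ω : Type*} (m : MeasurableSpace Ω) {mΩ : MeasurableSpace Ω}
    (μ : Measure Ω) [IsProbabilityMeasure μ] (Y : Ω → ℝ) (ω : Ω) : Measure ℝ :=
  @condDistrib Ω Ω ℝ _ _ _ mΩ m Y id μ _ ω

/-- The coefficient `τ(m, Y)` of an integrable real random variable `Y`: the `L¹`-norm of the
supremum over all `1`-Lipschitz `f : ℝ → ℝ` of `|∫ f dP_{Y|m} - ∫ f dP_Y|`. -/
noncomputable def tauReal {Ω : Type*} (m : MeasurableSpace Ω) {mΩ : MeasurableSpace Ω}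
    (μ : Measure Ω) [IsProbabilityMeasure μ] (Y : Ω → ℝ) : ℝ≥0∞ :=
  ∫⁻ ω, ⨆ f : {f : ℝ → ℝ // LipschitzWith 1 f},
    ‖(∫ x, f.1 x ∂(condLaw m μ Y ω)) - ∫ x, f.1 x ∂(μ.map Y)‖ₑ ∂μ

/-- `1`-Lipschitz functions on `ℝ^k`, for the distance `∑ i, |x i - y i|`. -/
def IsOneLipschitz {k : ℕ} (f : (Fin k → ℝ) → ℝ) : Prop :=
  ∀ x y : Fin k → ℝ, |f x - f y| ≤ ∑ i, |x i - y i|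

/-- The coefficient `τ(m, Y)` of an integrable random vector `Y` in `ℝ^k`. -/
noncomputable def tauVec {Ω : Type*} (m : MeasurableSpace Ω) {mΩ : MeasurableSpace Ω}
    (μ : Measure Ω) [IsProbabilityMeasure μ] {k : ℕ} (Y : Ω → Fin k → ℝ) : ℝ≥0∞ :=
  ⨆ f : {f : (Fin k → ℝ) → ℝ // IsOneLipschitz f}, tauReal m μ (fun ω => f.1 (Y ω))

/-- The past `σ`-algebra `σ(X_j, j ≤ p)`. -/
abbrev past {Ω : Type*} (X : ℤ → Ω → ℝ) (p : ℤ) : MeasurableSpace Ω :=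
  ⨆ j : {j : ℤ // j ≤ p}, MeasurableSpace.comap (X j.1) Real.measurableSpace

/-- `sup τ(σ(X_j, j ≤ p), (X_{j₁}, …, X_{j_ℓ}))` over all `p` and `p + i ≤ j₁ < ⋯ < j_ℓ`. -/
noncomputable def tauBlock {Ω : Type*} {mΩ : MeasurableSpace Ω} (μ : Measure Ω)
    [IsProbabilityMeasure μ] (X : ℤ → Ω → ℝ) (l i : ℕ) : ℝ≥0∞ :=
  ⨆ (p : ℤ) (j : {j : Fin l → ℤ // StrictMono j ∧ ∀ r, p + (i : ℤ) ≤ j r}),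
    tauVec (past X p) μ (fun ω r => X (j.1 r) ω)

/-- `τ_k(i)`: the maximum over `1 ≤ ℓ ≤ k` of `ℓ⁻¹` times the supremum above. -/
noncomputable def tauUpTo {Ω : Type*} {mΩ : MeasurableSpace Ω} (μ : Measure Ω)
    [IsProbabilityMeasure μ] (X : ℤ → Ω → ℝ) (k i : ℕ) : ℝ≥0∞ :=
  ⨆ l ∈ Finset.Icc 1 k, ((l : ℝ≥0∞))⁻¹ * tauBlock μ X l i

/-- The `τ`-mixing coefficient `τ(i)` of the sequence `X`. -/
noncomputable def tauCoeff {Ω : Type*} {mΩ : MeasurableSpace Ω} (μ : Measure Ω)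
    [IsProbabilityMeasure μ] (X : ℤ → Ω → ℝ) (i : ℕ) : ℝ≥0∞ :=
  ⨆ k : ℕ, tauUpTo μ X k i

/-- The partial sum `S_n = X_1 + ⋯ + X_n`. -/
noncomputable def partialSum {Ω : Type*} (X : ℤ → Ω → ℝ) (n : ℕ) (ω : Ω) : ℝ :=
  ∑ i ∈ Finset.Icc 1 n, X (i : ℤ) ω

/-- A good rate function: lower semicontinuous with compact level sets. -/
def IsGoodRateFunction (I : ℝ → ℝ≥0∞) : Prop :=
  LowerSemicontinuous I ∧ ∀ α : ℝ≥0, IsCompact {t : ℝ | I t ≤ α}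

/-- The moderate deviation principle for `(T n)` with speed `a n → 0` and rate function `I`. All
quantities are extended reals, with `log 0 = -∞` and the infimum over the empty set `+∞`. -/
def SatisfiesMDP {Ω : Type*} {mΩ : MeasurableSpace Ω} (μ : Measure Ω)
    (T : ℕ → Ω → ℝ) (a : ℕ → ℝ) (I : ℝ → ℝ≥0∞) : Prop :=
  Tendsto a atTop (𝓝 0) ∧
  ∀ A : Set ℝ, MeasurableSet A →
    (-(⨅ t ∈ interior A, (I t : EReal)) ≤
      liminf (fun n => (a n : EReal) *
        ENNReal.log (μ {ω | Real.sqrt (a n) * T n ω ∈ A})) atTop) ∧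
    (limsup (fun n => (a n : EReal) *
        ENNReal.log (μ {ω | Real.sqrt (a n) * T n ω ∈ A})) atTop ≤
      -(⨅ t ∈ closure A, (I t : EReal)))

end ModerateDeviations

/-!
The proof approximates the partial sum by a sum of independent block sums and controls the
log-Laplace transforms of the blocks, on scales chosen according to the speed.

The variables are truncated at a level `T` with `T ^ γ₂ = w'` and centered again, which changes the
partial sum by more than a small constant only on an event of probability at most `exp (-w)`,
eventually. The truncated sequence satisfies
`IsAdmissible`: its terms have exponential tails, and in the expectation of a function of the past
and of a later block sum which is Lipschitz in the block sum, the block sum can be replaced by an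
independent copy at the cost `A * exp (-c * d ^ γ₁)`, where `A` is the length of the block and `d`
its distance from the past. This is exactly what the coefficients `τ` give, because the supremum over
Lipschitz functions stands inside the expectation (`enorm_integral_sub_le_tauReal`,
`isAdmissible_truncated`), so no coupling has to be constructed. In particular, covariances are
summable, and the variance of a sum is almost additive over separated blocks
(`exists_abs_cov_le`, `exists_abs_variance_sub_sum_le`).

The heart of the matter is `exists_abs_cgf_sub_le`: the log-Laplace transform at `t` of a block of
length `A` is `t ^ 2 / 2` times its variance, up to `o(t ^ 2 * A)`, as long as the quantity
`P.zeta w' A t = |t| * (A ^ (γ₁ * (1 / γ - 1)) + A * w' ^ (1 / γ₂ - 1))` is small. It is proved by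
induction on the length. A short gap in the middle of the block is removed with Hölder's inequality
(`IsAdmissible.cgf_le`, `IsAdmissible.le_cgf`), and the two halves are decoupled
(`exists_abs_cgf_add_sub_le`): exponentials are clipped to become Lipschitz, and the clipping costs
little because of the exponential tails. The relative error of a step is `A ^ (-ρ) + ζ ^ ρ` with
`ζ = P.zeta w' A t`. When the length is halved, the second term decays geometrically; the first one
grows geometrically, but remains small up to a bounded length, from which on the expansion is
Taylor's formula. Hence the errors sum up to a small constant.

Finally, `{1, …, n}` is cut into blocks of length `p`, with `p ^ γ₁` of order `w'`, and gaps of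
length `q`, with `q ^ γ₁` of order `w`, where `w` and `w'` are such that `1 / a n + log n ≪ w ≪ w'` and
`P.zeta w' p t` still tends to zero for the relevant `t`, which are of order `(n * a n) ^ (-1 / 2)`;
such scales exist because `a n * n ^ (γ / (2 - γ))` tends to infinity (`exists_scales`,
`exists_block_lengths`). The sum over the blocks is then, up to an error which is negligible on the
scale `exp (-K / a n)` for every `K`, distributed as a sum of independent variables with log-Laplace
transform equivalent to `(t ^ 2 / 2) / a n` at `t / a n`, after rescaling
(`IsAdmissible.exists_decoupled_law`, `hasLaplaceModel_blocks`). Chernoff's inequality and an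
exponential change of measure give the bounds (`HasLaplaceModel.upper_bound`,
`HasLaplaceModel.lower_bound`), and the sum over the gaps is negligible, because its limiting
log-Laplace transform vanishes.
-/

set_option linter.unusedSectionVars false

namespace ModerateDeviations

/-! ### Elementary inequalities -/

lemma exists_rpow_le_exp (r b : ℝ) (hr : 0 ≤ r) (hb : 0 < b) :
    ∃ K : ℝ, 1 ≤ K ∧ ∀ x : ℝ, 0 ≤ x → x ^ r ≤ K * Real.exp (b * x) := by
  have h := (isLittleO_rpow_exp_pos_mul_atTop r hb).bound one_pos
  obtain ⟨N, hN⟩ := eventually_atTop.1 h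
  refine ⟨1 + |N| ^ r, by have := Real.rpow_nonneg (abs_nonneg N) r; linarith, fun x hx => ?_⟩
  have h0 := Real.rpow_nonneg (abs_nonneg N) r
  have h1 : 1 ≤ Real.exp (b * x) := Real.one_le_exp (by positivity)
  rcases le_total N x with h2 | h2
  · have h3 := hN x h2
    rw [Real.norm_of_nonneg (Real.rpow_nonneg hx r), Real.norm_of_nonneg (Real.exp_pos _).le] at h3
    nlinarith
  · have : x ^ r ≤ |N| ^ r := Real.rpow_le_rpow hx (h2.trans (le_abs_self N)) hr
    nlinarith

lemma exists_rpow_mul_exp_neg_le (r b g : ℝ) (hr : 0 ≤ r) (hb : 0 < b) (hg : 0 < g) :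
    ∃ K : ℝ, 1 ≤ K ∧ ∀ x : ℝ, 0 ≤ x → x ^ r * Real.exp (-(b * x ^ g)) ≤ K := by
  obtain ⟨K, hK, h⟩ := exists_rpow_le_exp (r / g) b (by positivity) hb
  refine ⟨K, hK, fun x hx => ?_⟩
  have h1 := h (x ^ g) (Real.rpow_nonneg hx g)
  rw [← Real.rpow_mul hx, mul_div_cancel₀ _ hg.ne'] at h1
  calc x ^ r * Real.exp (-(b * x ^ g))
      ≤ K * Real.exp (b * x ^ g) * Real.exp (-(b * x ^ g)) := by gcongr
    _ = K := by rw [mul_assoc, ← Real.exp_add]; simp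

/-- The logarithm is `1`-Lipschitz on `[1, ∞)`. -/
lemma abs_log_sub_log_le {x y : ℝ} (hx : 1 ≤ x) (hy : 1 ≤ y) :
    |Real.log x - Real.log y| ≤ |x - y| := by
  have key : ∀ a b : ℝ, 1 ≤ a → 1 ≤ b → Real.log a - Real.log b ≤ |a - b| := by
    intro a b ha hb
    rw [← Real.log_div (by positivity) (by positivity)]
    have h1 := Real.log_le_sub_one_of_pos (x := a / b) (by positivity)
    have h2 : a / b - 1 = (a - b) / b := by field_simp
    have h3 : (a - b) / b ≤ |a - b| := by
      rw [div_le_iff₀ (by positivity)]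
      nlinarith [le_abs_self (a - b), abs_nonneg (a - b)]
    linarith
  rw [abs_le]
  have h1 := key x y hx hy
  have h2 := key y x hy hx
  rw [abs_sub_comm] at h2
  constructor <;> linarith

lemma abs_exp_sub_one_le (x : ℝ) : |Real.exp x - 1| ≤ |x| * Real.exp |x| := by
  have h := Complex.norm_exp_sub_sum_le_norm_mul_exp (x : ℂ) 1
  simp only [Finset.range_one, Finset.sum_singleton, pow_zero, Nat.factorial_zero, Nat.cast_one,
    div_one, pow_one] at h
  rw [← Complex.ofReal_exp, ← Complex.ofReal_one, ← Complex.ofReal_sub, Complex.norm_real,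
    Complex.norm_real] at h
  exact h

lemma abs_exp_sub_quadratic_le (x : ℝ) :
    |Real.exp x - 1 - x - x ^ 2 / 2| ≤ |x| ^ 3 * Real.exp |x| := by
  have h := Complex.norm_exp_sub_sum_le_norm_mul_exp (x : ℂ) 3
  have e : Complex.exp (x : ℂ) - ∑ m ∈ Finset.range 3, (x : ℂ) ^ m / (m.factorial : ℂ)
      = ((Real.exp x - 1 - x - x ^ 2 / 2 : ℝ) : ℂ) := by
    simp [Finset.sum_range_succ]
    ring
  rw [e, Complex.norm_real, Complex.norm_real] at h
  exact h

/-- Exponentials become Lipschitz after clipping, that is after composition with the projection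
`x ↦ max (-β) (min β x)` onto the interval `[-β, β]`. -/
lemma lipschitz_exp_clip {t β : ℝ} (hβ : 0 ≤ β) (x y : ℝ) :
    |Real.exp (t * max (-β) (min β x)) - Real.exp (t * max (-β) (min β y))| ≤
      |t| * Real.exp (|t| * β) * |x - y| := by
  have hc : ∀ z : ℝ, |max (-β) (min β z)| ≤ β := fun z => by
    rw [abs_le]; exact ⟨le_max_left _ _, max_le (by linarith) (min_le_left _ _)⟩
  have hl : |max (-β) (min β x) - max (-β) (min β y)| ≤ |x - y| := by
    refine (abs_max_sub_max_le_max _ _ _ _).trans ?_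
    simp only [sub_self, abs_zero]
    refine max_le (abs_nonneg _) ((abs_min_sub_min_le_max _ _ _ _).trans ?_)
    simp
  have key : ∀ a b : ℝ, |a| ≤ β → Real.exp (t * a) - Real.exp (t * b) ≤
      |t| * Real.exp (|t| * β) * |a - b| := by
    intro a b ha
    have h1 := Real.add_one_le_exp (t * b - t * a)
    have h2 : Real.exp (t * b) = Real.exp (t * a) * Real.exp (t * b - t * a) := by
      rw [← Real.exp_add]; ring_nf
    have h3 : Real.exp (t * a) ≤ Real.exp (|t| * β) := by
      apply Real.exp_le_exp.2
      calc t * a ≤ |t * a| := le_abs_self _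
        _ = |t| * |a| := abs_mul _ _
        _ ≤ _ := by gcongr
    calc Real.exp (t * a) - Real.exp (t * b)
        = Real.exp (t * a) * (1 - Real.exp (t * b - t * a)) := by rw [h2]; ring
      _ ≤ Real.exp (t * a) * |t * (a - b)| := by
          gcongr
          have := le_abs_self (t * (a - b)); linarith
      _ ≤ Real.exp (|t| * β) * |t * (a - b)| := by gcongr
      _ = _ := by rw [abs_mul]; ring
  have e := mul_nonneg (abs_nonneg t) (Real.exp_pos (|t| * β)).le
  refine le_trans ?_ (mul_le_mul_of_nonneg_left hl e)
  rw [abs_le]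
  have h1 := key _ (max (-β) (min β y)) (hc x)
  have h2 := key _ (max (-β) (min β x)) (hc y)
  rw [abs_sub_comm (max (-β) (min β y))] at h2
  constructor <;> linarith

/-! ### Parameters -/

/-- The numerical data on which all estimates depend: the mixing rate `exp (-c d ^ γ₁)`, the tail
exponent `γ₂`, the combined exponent `γ`, and two bounds `m` and `C` which control the size of
the variables. -/
structure Params where
  c : ℝ
  γ₁ : ℝ
  γ₂ : ℝ
  γ : ℝ
  m : ℝ
  C : ℝ
  c_pos : 0 < c
  γ₁_pos : 0 < γ₁
  γ₂_pos : 0 < γ₂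
  rel : 1 / γ = 1 / γ₁ + 1 / γ₂
  γ_lt : γ < 1
  m_nonneg : 0 ≤ m
  one_le_C : 1 ≤ C

namespace Params
variable (P : Params)

/-- The exponent `κ = γ₁ (1 / γ - 1)`, which is positive because `γ < 1`. -/
noncomputable def κ : ℝ := P.γ₁ / P.γ₂ + 1 - P.γ₁

/-- The exponent `ν = γ₁ / γ`. -/
noncomputable def ν : ℝ := P.γ₁ / P.γ₂ + 1

/-- The effective size of the dual parameter `t` for sums of `A` variables, where `w` is the
truncation level of `|X| ^ γ₂`: if `P.zeta w A t` is small, then `|t|` times the trivial bound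
`A * max |X i|` for the sum is at most `|t| * A ^ ν` plus a small multiple of `max |X i| ^ γ₂`,
which has an exponential moment. -/
noncomputable def zeta (w A t : ℝ) : ℝ := |t| * (A ^ P.κ + A * w ^ (1 / P.γ₂ - 1))

lemma γ_pos : 0 < P.γ := by
  have h := P.rel
  have h1 := P.γ₁_pos
  have h2 := P.γ₂_pos
  have : 0 < 1 / P.γ := by rw [h]; positivity
  exact one_div_pos.1 this

lemma κ_eq : P.κ = P.γ₁ * (1 / P.γ - 1) := by
  have h1 := P.γ₁_pos
  rw [P.rel, κ]; field_simp; ring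

lemma κ_pos : 0 < P.κ := by
  rw [κ_eq]
  have := one_lt_one_div P.γ_pos P.γ_lt
  exact mul_pos P.γ₁_pos (by linarith)

lemma κ_add : P.κ + P.γ₁ = P.ν := by rw [κ, ν]; ring

lemma one_le_ν : 1 ≤ P.ν := by
  have := div_pos P.γ₁_pos P.γ₂_pos
  rw [ν]; linarith

lemma zeta_nonneg {w A : ℝ} (hw : 0 ≤ w) (hA : 0 ≤ A) (t : ℝ) : 0 ≤ P.zeta w A t := by
  have := Real.rpow_nonneg hA P.κ
  have := Real.rpow_nonneg hw (1 / P.γ₂ - 1)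
  rw [zeta]; positivity

lemma abs_mul_rpow_κ_le {w A : ℝ} (hw : 0 ≤ w) (hA : 0 ≤ A) (t : ℝ) :
    |t| * A ^ P.κ ≤ P.zeta w A t := by
  have := Real.rpow_nonneg hw (1 / P.γ₂ - 1)
  rw [zeta, mul_add]
  have : 0 ≤ |t| * (A * w ^ (1 / P.γ₂ - 1)) := by positivity
  linarith

lemma abs_le_zeta {w A : ℝ} (hw : 0 ≤ w) (hA : 1 ≤ A) (t : ℝ) : |t| ≤ P.zeta w A t := by
  refine le_trans ?_ (P.abs_mul_rpow_κ_le hw (by linarith) t)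
  have := Real.one_le_rpow hA P.κ_pos.le
  nlinarith [abs_nonneg t]

lemma abs_mul_rpow_ν_le {w A : ℝ} (hw : 0 ≤ w) (hA : 0 < A) (t : ℝ) :
    |t| * A ^ P.ν ≤ P.zeta w A t * A ^ P.γ₁ := by
  rw [← P.κ_add, Real.rpow_add hA, ← mul_assoc]
  gcongr
  exact P.abs_mul_rpow_κ_le hw hA.le t

/-- The trivial bound for a sum of `A` variables, interpolated: `A * W ^ (1 / γ₂)` is at most
`A ^ ν` if `W ≤ A ^ γ₁`, and otherwise linear in `W`, with a factor which becomes small after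
multiplication by `|t|`. -/
lemma abs_mul_envelope_le {w A W t : ℝ} (hA : 1 ≤ A) (hW0 : 0 ≤ W) (hW : W ≤ w) :
    |t| * (A * (P.m + W ^ (1 / P.γ₂))) ≤
      (P.m + 1) * (|t| * A ^ P.ν) + P.zeta w A t * W := by
  have h1 := P.γ₁_pos
  have h2 := P.γ₂_pos
  have hA0 : 0 < A := by linarith
  have hw : 0 ≤ w := hW0.trans hW
  have hAν : A ≤ A ^ P.ν := Real.self_le_rpow_of_one_le hA P.one_le_ν
  have key : A * W ^ (1 / P.γ₂) ≤ A ^ P.ν + (A ^ P.κ + A * w ^ (1 / P.γ₂ - 1)) * W := by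
    have n1 := Real.rpow_nonneg hA0.le P.κ
    have n2 := Real.rpow_nonneg hw (1 / P.γ₂ - 1)
    have n3 := Real.rpow_nonneg hA0.le P.ν
    rcases le_or_gt W (A ^ P.γ₁) with h | h
    · have : W ^ (1 / P.γ₂) ≤ A ^ (P.γ₁ / P.γ₂) := by
        calc W ^ (1 / P.γ₂) ≤ (A ^ P.γ₁) ^ (1 / P.γ₂) :=
              Real.rpow_le_rpow hW0 h (by positivity)
          _ = _ := by rw [← Real.rpow_mul hA0.le]; ring_nf
      have e : A ^ P.ν = A ^ (P.γ₁ / P.γ₂) * A := by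
        rw [ν, Real.rpow_add hA0, Real.rpow_one]
      have : 0 ≤ (A ^ P.κ + A * w ^ (1 / P.γ₂ - 1)) * W := by positivity
      rw [e]; nlinarith
    · have hWp : 0 < W := lt_trans (Real.rpow_pos_of_pos hA0 _) h
      have e : W ^ (1 / P.γ₂) = W ^ (1 / P.γ₂ - 1) * W := by
        rw [← Real.rpow_add_one hWp.ne']; ring_nf
      have e2 : A ^ P.κ = A * (A ^ P.γ₁) ^ (1 / P.γ₂ - 1) := by
        rw [← Real.rpow_mul hA0.le, ← Real.rpow_one_add' hA0.le]
        · congr 1; rw [κ]; field_simp; ring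
        · have := P.κ_pos
          rw [κ] at this
          have e : 1 + P.γ₁ * (1 / P.γ₂ - 1) = P.γ₁ / P.γ₂ + 1 - P.γ₁ := by ring
          rw [e]; exact this.ne'
      have : W ^ (1 / P.γ₂ - 1) ≤ (A ^ P.γ₁) ^ (1 / P.γ₂ - 1) + w ^ (1 / P.γ₂ - 1) := by
        rcases le_total 0 (1 / P.γ₂ - 1) with h3 | h3
        · have := Real.rpow_le_rpow hW0 hW h3
          have := Real.rpow_nonneg (Real.rpow_nonneg hA0.le P.γ₁) (1 / P.γ₂ - 1)
          linarith
        · have := Real.rpow_le_rpow_of_nonpos (Real.rpow_pos_of_pos hA0 P.γ₁) h.le h3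
          linarith
      rw [e, e2]
      calc A * (W ^ (1 / P.γ₂ - 1) * W)
          ≤ A * (((A ^ P.γ₁) ^ (1 / P.γ₂ - 1) + w ^ (1 / P.γ₂ - 1)) * W) := by gcongr
        _ = (A * (A ^ P.γ₁) ^ (1 / P.γ₂ - 1) + A * w ^ (1 / P.γ₂ - 1)) * W := by ring
        _ ≤ _ := by linarith
  have ht := abs_nonneg t
  have hm := P.m_nonneg
  calc |t| * (A * (P.m + W ^ (1 / P.γ₂)))
      = P.m * (|t| * A) + |t| * (A * W ^ (1 / P.γ₂)) := by ring
    _ ≤ P.m * (|t| * A ^ P.ν) +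
        |t| * (A ^ P.ν + (A ^ P.κ + A * w ^ (1 / P.γ₂ - 1)) * W) := by gcongr
    _ = _ := by rw [zeta]; ring

lemma exists_envelope_le_exp :
    ∃ K : ℝ, 1 ≤ K ∧ ∀ x : ℝ, 0 ≤ x → P.m + x ^ (1 / P.γ₂) ≤ K * Real.exp (x / 64) := by
  have h2 := P.γ₂_pos
  obtain ⟨K, hK, h⟩ := exists_rpow_le_exp (1 / P.γ₂) (1 / 64) (by positivity) (by norm_num)
  refine ⟨K + P.m, by linarith [P.m_nonneg], fun x hx => ?_⟩
  have h1 := h x hx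
  have e : x / 64 = 1 / 64 * x := by ring
  have h3 : 1 ≤ Real.exp (1 / 64 * x) := Real.one_le_exp (by positivity)
  rw [e]
  nlinarith [P.m_nonneg]

end Params

/-! ### Hölder's inequality for cumulant generating functions -/

section Cgf
variable {Ω : Type*} {mΩ : MeasurableSpace Ω} {μ : Measure Ω} [IsProbabilityMeasure μ]

lemma integrable_of_abs_le {X : Ω → ℝ} (hX : Measurable X) {B : ℝ} (hB : ∀ ω, |X ω| ≤ B) :
    Integrable X μ :=
  Integrable.of_bound hX.aestronglyMeasurable B (ae_of_all _ hB)

lemma integrable_exp_of_abs_le {X : Ω → ℝ} (hX : Measurable X) {B : ℝ} (hB : ∀ ω, |X ω| ≤ B)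
    (t : ℝ) : Integrable (fun ω => Real.exp (t * X ω)) μ := by
  refine integrable_of_abs_le (B := Real.exp (|t| * B)) (by fun_prop) fun ω => ?_
  rw [abs_of_pos (Real.exp_pos _)]
  apply Real.exp_le_exp.2
  calc t * X ω ≤ |t * X ω| := le_abs_self _
    _ = |t| * |X ω| := abs_mul _ _
    _ ≤ _ := by have := hB ω; gcongr

lemma one_le_mgf {X : Ω → ℝ} (hX : Measurable X) {B : ℝ} (hB : ∀ ω, |X ω| ≤ B)
    (h0 : ∫ ω, X ω ∂μ = 0) (t : ℝ) : 1 ≤ mgf X μ t := by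
  have h1 : ∫ ω, (t * X ω + 1) ∂μ ≤ ∫ ω, Real.exp (t * X ω) ∂μ := by
    refine integral_mono ?_ (integrable_exp_of_abs_le hX hB t) fun ω => Real.add_one_le_exp _
    exact ((integrable_of_abs_le hX hB).const_mul t).add (integrable_const _)
  rw [integral_add ((integrable_of_abs_le hX hB).const_mul t) (integrable_const _),
    integral_const_mul, h0] at h1
  simpa [mgf] using h1

/-- Hölder's inequality with the conjugate exponents `1 + δ` and `1 + 1 / δ`: a small summand can be
removed at the price of a small change of `t`. -/
lemma cgf_add_le {X Y : Ω → ℝ} (hX : Measurable X) (hY : Measurable Y) {B : ℝ}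
    (hBX : ∀ ω, |X ω| ≤ B) (hBY : ∀ ω, |Y ω| ≤ B) {δ : ℝ} (hδ : 0 < δ) (t : ℝ) :
    cgf (fun ω => X ω + Y ω) μ t ≤
      1 / (1 + δ) * cgf X μ ((1 + δ) * t) + δ / (1 + δ) * cgf Y μ ((1 + 1 / δ) * t) := by
  have hp : (1 + δ).HolderConjugate (1 + 1 / δ) := by
    rw [Real.holderConjugate_iff]
    constructor
    · linarith
    · field_simp
      ring
  have hb : ∀ (Z : Ω → ℝ) (_ : Measurable Z) (_ : ∀ ω, |Z ω| ≤ B) (p : ℝ≥0∞),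
      MemLp (fun ω => Real.exp (t * Z ω)) p μ := by
    intro Z hZ hBZ p
    refine MemLp.of_bound (by fun_prop) (Real.exp (|t| * B)) (ae_of_all _ fun ω => ?_)
    rw [Real.norm_of_nonneg (Real.exp_pos _).le]
    apply Real.exp_le_exp.2
    calc t * Z ω ≤ |t * Z ω| := le_abs_self _
      _ = |t| * |Z ω| := abs_mul _ _
      _ ≤ _ := by have := hBZ ω; gcongr
  have h := integral_mul_le_Lp_mul_Lq_of_nonneg (μ := μ) hp
    (f := fun ω => Real.exp (t * X ω)) (g := fun ω => Real.exp (t * Y ω))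
    (ae_of_all _ fun ω => (Real.exp_pos _).le) (ae_of_all _ fun ω => (Real.exp_pos _).le)
    (hb X hX hBX _) (hb Y hY hBY _)
  have e1 : ∀ (Z : Ω → ℝ) (r : ℝ),
      ∫ ω, Real.exp (t * Z ω) ^ r ∂μ = mgf Z μ (r * t) := by
    intro Z r
    simp only [mgf]
    refine integral_congr_ae (ae_of_all _ fun ω => ?_)
    simp only [← Real.exp_mul]
    ring_nf
  have e2 : ∫ ω, Real.exp (t * X ω) * Real.exp (t * Y ω) ∂μ
      = mgf (fun ω => X ω + Y ω) μ t := by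
    simp only [mgf, ← Real.exp_add, mul_add]
  rw [e1, e1, e2] at h
  have p1 : 0 < mgf X μ ((1 + δ) * t) := mgf_pos (integrable_exp_of_abs_le hX hBX _)
  have p2 : 0 < mgf Y μ ((1 + 1 / δ) * t) := mgf_pos (integrable_exp_of_abs_le hY hBY _)
  have p3 : 0 < mgf (fun ω => X ω + Y ω) μ t :=
    mgf_pos (integrable_exp_of_abs_le (hX.add hY) (B := B + B)
      (fun ω => (abs_add_le _ _).trans (add_le_add (hBX ω) (hBY ω))) _)
  have h2 := Real.log_le_log p3 h
  rw [Real.log_mul (Real.rpow_pos_of_pos p1 _).ne' (Real.rpow_pos_of_pos p2 _).ne',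
    Real.log_rpow p1, Real.log_rpow p2] at h2
  have e3 : 1 / (1 + 1 / δ) = δ / (1 + δ) := by field_simp; ring
  rw [e3] at h2
  exact h2

end Cgf

/-! ### Weakly dependent sequences with exponential tails -/

/-- The block sum `Z a + ⋯ + Z (a + A - 1)`. -/
noncomputable def blockSum {Ω : Type*} (Z : ℕ → Ω → ℝ) (a A : ℕ) (ω : Ω) : ℝ :=
  ∑ i ∈ Finset.range A, Z (a + i) ω

/-- A bounded centered sequence `Z`, adapted to `σ`-algebras `F b` of the past (which contain the
variables `Z i` with `i < b`), whose terms are controlled by `m + W ^ (1 / γ₂)` with `W ≤ w`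
exponentially integrable, and whose block sums are weakly
dependent on the past in the following sense: inside the expectation of a function which is
Lipschitz in the block sum, the block sum can be replaced by an independent copy, at a cost which
is exponentially small in the distance `d` between the block and the past. -/
structure IsAdmissible (P : Params) {Ω : Type*} {mΩ : MeasurableSpace Ω} (μ : Measure Ω)
    (w : ℝ) (F : ℕ → MeasurableSpace Ω) (Z W : ℕ → Ω → ℝ) : Prop where
  past_le : ∀ b, F b ≤ mΩ
  adapted : ∀ b i, i < b → Measurable[F b] (Z i)
  measurable_W : ∀ i, Measurable (W i)
  W_nonneg : ∀ i ω, 0 ≤ W i ω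
  W_le : ∀ i ω, W i ω ≤ w
  abs_le : ∀ i ω, |Z i ω| ≤ P.m + W i ω ^ (1 / P.γ₂)
  exp_le : ∀ i, ∫ ω, Real.exp (W i ω / 2) ∂μ ≤ P.C
  centered : ∀ i, ∫ ω, Z i ω ∂μ = 0
  decouple : ∀ (b a A d : ℕ) (Φ : Ω → ℝ → ℝ), 1 ≤ d → b + d ≤ a →
    Measurable[(F b).prod Real.measurableSpace] (fun x : Ω × ℝ => Φ x.1 x.2) →
    (∀ ω, LipschitzWith 1 (Φ ω)) → (∃ B, ∀ ω, |Φ ω 0| ≤ B) →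
    |∫ ω, Φ ω (blockSum Z a A ω) ∂μ - ∫ ω, ∫ ω', Φ ω (blockSum Z a A ω') ∂μ ∂μ| ≤
      A * Real.exp (-(P.c * (d : ℝ) ^ P.γ₁))


section
variable {P : Params} {Ω : Type*} {mΩ : MeasurableSpace Ω} {μ : Measure Ω} [IsProbabilityMeasure μ]
  {w : ℝ} {F : ℕ → MeasurableSpace Ω} {Z W : ℕ → Ω → ℝ}

lemma blockSum_add (Z : ℕ → Ω → ℝ) (a A B : ℕ) (ω : Ω) :
    blockSum Z a (A + B) ω = blockSum Z a A ω + blockSum Z (a + A) B ω := by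
  simp [blockSum, Finset.sum_range_add, add_assoc]

@[simp] lemma blockSum_zero (Z : ℕ → Ω → ℝ) (a : ℕ) (ω : Ω) : blockSum Z a 0 ω = 0 := by
  simp [blockSum]

lemma blockSum_one (Z : ℕ → Ω → ℝ) (a : ℕ) (ω : Ω) : blockSum Z a 1 ω = Z a ω := by
  simp [blockSum]

namespace IsAdmissible
variable (h : IsAdmissible P μ w F Z W)
include h

lemma w_nonneg : 0 ≤ w := by
  have : Nonempty Ω := nonempty_of_isProbabilityMeasure μ
  obtain ⟨ω⟩ := this
  exact (h.W_nonneg 0 ω).trans (h.W_le 0 ω)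

lemma measurable (i : ℕ) : Measurable (Z i) :=
  (h.adapted (i + 1) i (Nat.lt_succ_self i)).mono (h.past_le _) le_rfl

lemma adapted_blockSum {a A b : ℕ} (hb : a + A ≤ b) : Measurable[F b] (blockSum Z a A) := by
  unfold blockSum
  refine Finset.measurable_fun_sum _ fun i hi => h.adapted b _ ?_
  have := Finset.mem_range.1 hi
  omega

lemma measurable_blockSum (a A : ℕ) : Measurable (blockSum Z a A) :=
  (h.adapted_blockSum le_rfl).mono (h.past_le _) le_rfl

lemma abs_blockSum_le (a A : ℕ) (ω : Ω) :
    |blockSum Z a A ω| ≤ A * (P.m + w ^ (1 / P.γ₂)) := by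
  have h2 := P.γ₂_pos
  refine (Finset.abs_sum_le_sum_abs _ _).trans ?_
  have : ∀ i ∈ Finset.range A, |Z (a + i) ω| ≤ P.m + w ^ (1 / P.γ₂) := fun i _ =>
    (h.abs_le _ ω).trans (by
      have := Real.rpow_le_rpow (h.W_nonneg (a + i) ω) (h.W_le (a + i) ω)
        (z := 1 / P.γ₂) (by positivity)
      linarith)
  have := Finset.sum_le_card_nsmul _ _ _ this
  rwa [Finset.card_range, nsmul_eq_mul] at this

lemma integrable_blockSum (a A : ℕ) : Integrable (blockSum Z a A) μ :=
  integrable_of_abs_le (h.measurable_blockSum a A) (h.abs_blockSum_le a A)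

lemma memLp_blockSum (a A : ℕ) (p : ℝ≥0∞) : MemLp (blockSum Z a A) p μ :=
  MemLp.of_bound (h.measurable_blockSum a A).aestronglyMeasurable _
    (ae_of_all _ (h.abs_blockSum_le a A))

lemma memLp (i : ℕ) (p : ℝ≥0∞) : MemLp (Z i) p μ := by
  have := h.memLp_blockSum i 1 p
  have e : blockSum Z i 1 = Z i := funext (blockSum_one Z i)
  rwa [e] at this

lemma integral_blockSum (a A : ℕ) : ∫ ω, blockSum Z a A ω ∂μ = 0 := by
  unfold blockSum
  rw [integral_finsetSum _ fun i _ => (h.memLp (a + i) 1).integrable le_rfl]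
  simp [h.centered]

lemma integrable_exp (t : ℝ) (a A : ℕ) :
    Integrable (fun ω => Real.exp (t * blockSum Z a A ω)) μ :=
  integrable_exp_of_abs_le (h.measurable_blockSum a A) (h.abs_blockSum_le a A) t

lemma one_le_mgf (t : ℝ) (a A : ℕ) : 1 ≤ mgf (blockSum Z a A) μ t :=
  ModerateDeviations.one_le_mgf (h.measurable_blockSum a A) (h.abs_blockSum_le a A)
    (h.integral_blockSum a A) t

lemma integrable_exp_half (i : ℕ) : Integrable (fun ω => Real.exp (W i ω / 2)) μ := by
  have := h.measurable_W i
  refine integrable_of_abs_le (B := Real.exp (w / 2)) (by fun_prop) fun ω => ?_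
  rw [abs_of_pos (Real.exp_pos _)]
  exact Real.exp_le_exp.2 (by have := h.W_le i ω; linarith)

/-- The expectation of a product of a function of the past and a Lipschitz function of a later
block almost factorizes. -/
lemma abs_integral_mul_sub_le {b a A d : ℕ} (hd : 1 ≤ d) (hb : b + d ≤ a) {U : Ω → ℝ}
    (hU : Measurable[F b] U) {B L : ℝ} (hB : 0 < B) (hL : 0 < L) (hUB : ∀ ω, |U ω| ≤ B)
    {G : ℝ → ℝ} (hG : ∀ x y, |G x - G y| ≤ L * |x - y|) :
    |∫ ω, U ω * G (blockSum Z a A ω) ∂μ - (∫ ω, U ω ∂μ) * ∫ ω, G (blockSum Z a A ω) ∂μ| ≤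
      B * L * (A * Real.exp (-(P.c * (d : ℝ) ^ P.γ₁))) := by
  have hBL : 0 < B * L := by positivity
  have hGc : Continuous G :=
    (LipschitzWith.of_dist_le_mul (K := ⟨L, hL.le⟩) fun x y => by
      exact hG x y).continuous
  have key := h.decouple b a A d (fun ω y => (B * L)⁻¹ * (U ω * G y)) hd hb ?_ ?_ ?_
  · simp only [integral_const_mul, integral_mul_const, ← mul_sub] at key
    rw [abs_mul, abs_of_pos (inv_pos.2 hBL), inv_mul_le_iff₀ hBL] at key
    exact key
  · have h1 : @Measurable (Ω × ℝ) ℝ ((F b).prod Real.measurableSpace) _ (fun x => U x.1) :=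
      @Measurable.comp _ _ _ ((F b).prod Real.measurableSpace) (F b) _ _ _ hU
        (@measurable_fst _ _ (F b) _)
    have h2 : @Measurable (Ω × ℝ) ℝ ((F b).prod Real.measurableSpace) _ (fun x => G x.2) :=
      @Measurable.comp _ _ _ ((F b).prod Real.measurableSpace) _ _ _ _ hGc.measurable
        (@measurable_snd _ _ (F b) _)
    have h3 : @Measurable (Ω × ℝ) ℝ ((F b).prod Real.measurableSpace) _
        (fun x => U x.1 * G x.2) := by
      let _ := (F b).prod Real.measurableSpace
      exact h1.mul h2
    exact @Measurable.comp _ _ _ ((F b).prod Real.measurableSpace) _ _ (fun y => (B * L)⁻¹ * y) _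
      (measurable_const_mul _) h3
  · intro ω
    refine LipschitzWith.of_dist_le_mul fun x y => ?_
    rw [Real.dist_eq, Real.dist_eq, ← mul_sub, ← mul_sub, abs_mul, abs_mul,
      abs_of_pos (inv_pos.2 hBL), inv_mul_le_iff₀ hBL, NNReal.coe_one, one_mul]
    have := hG x y
    have := hUB ω
    calc |U ω| * |G x - G y| ≤ B * (L * |x - y|) := by gcongr
      _ = _ := by ring
  · refine ⟨(B * L)⁻¹ * (B * |G 0|), fun ω => ?_⟩
    rw [abs_mul, abs_mul, abs_of_pos (inv_pos.2 hBL)]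
    have := hUB ω
    gcongr

end IsAdmissible

/-! ### Clipping -/

lemma measurable_clip (β : ℝ) : Measurable fun x : ℝ => max (-β) (min β x) := by fun_prop

lemma clip_eq_self {β x : ℝ} (hx : |x| ≤ β) : max (-β) (min β x) = x := by
  rw [abs_le] at hx
  rw [min_eq_right hx.2, max_eq_right hx.1]

lemma abs_clip_le {β : ℝ} (hβ : 0 ≤ β) (x : ℝ) : |max (-β) (min β x)| ≤ β := by
  rw [abs_le]; exact ⟨le_max_left _ _, max_le (by linarith) (min_le_left _ _)⟩

lemma abs_clip_le_abs {β : ℝ} (hβ : 0 ≤ β) (x : ℝ) : |max (-β) (min β x)| ≤ |x| := by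
  rcases le_total |x| β with hx | hx
  · rw [clip_eq_self hx]
  · exact (abs_clip_le hβ x).trans hx

lemma abs_sub_clip_le {β : ℝ} (hβ : 0 ≤ β) (x : ℝ) : |x - max (-β) (min β x)| ≤ |x| := by
  rcases le_total |x| β with hx | hx
  · rw [clip_eq_self hx]; simp
  · rcases le_total 0 x with h0 | h0
    · rw [abs_of_nonneg h0] at hx ⊢
      rw [min_eq_left hx, max_eq_right (by linarith), abs_of_nonneg] <;> linarith
    · rw [abs_of_nonpos h0] at hx ⊢
      rw [min_eq_right (by linarith), max_eq_left (by linarith), abs_of_nonpos] <;> linarith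

/-! ### Covariances -/

/-- Covariances decay at least like the fourth power of the distance, uniformly over all admissible
sequences. The earlier variable is clipped at the size which it exceeds only with a probability
exponentially small in a power of the distance. -/
lemma exists_abs_cov_le (P : Params) : ∃ K : ℝ, 0 < K ∧ ∀ {Ω : Type*} {_ : MeasurableSpace Ω}
    {μ : Measure Ω} [IsProbabilityMeasure μ] {w : ℝ} {F : ℕ → MeasurableSpace Ω}
    {Z W : ℕ → Ω → ℝ}, IsAdmissible P μ w F Z W → ∀ i k : ℕ,
    |cov[Z i, Z k; μ]| ≤ K / (1 + |(i : ℝ) - k|) ^ 4 := by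
  obtain ⟨K₁, hK₁, hexp⟩ := P.exists_envelope_le_exp
  have h1 := P.γ₁_pos
  have h2 := P.γ₂_pos
  have hc := P.c_pos
  have hC := P.one_le_C
  have hm := P.m_nonneg
  obtain ⟨K₂, hK₂, hb2⟩ := exists_rpow_mul_exp_neg_le (P.γ₁ / P.γ₂ + 4) P.c P.γ₁ (by positivity)
    hc h1
  obtain ⟨K₃, hK₃, hb3⟩ := exists_rpow_mul_exp_neg_le 4 (1 / 8) P.γ₁ (by norm_num) (by norm_num) h1
  obtain ⟨K, hK⟩ : ∃ K, K = 32 * K₁ ^ 2 * P.C + 81 * ((P.m + 1) * K₂ + 2 * K₁ ^ 2 * P.C * K₃) :=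
    ⟨_, rfl⟩
  refine ⟨K, by rw [hK]; positivity, ?_⟩
  intro Ω _ μ _ w F Z W h
  -- The product of two variables, even after an exponential tilt by `W i / 8`.
  have hprod : ∀ i k ω, |Z i ω| * |Z k ω| * Real.exp (W i ω / 8) ≤
      K₁ ^ 2 * (Real.exp (W i ω / 2) + Real.exp (W k ω / 2)) := by
    intro i k ω
    have a1 := (h.abs_le i ω).trans (hexp _ (h.W_nonneg i ω))
    have a2 := (h.abs_le k ω).trans (hexp _ (h.W_nonneg k ω))
    have n1 := h.W_nonneg i ω
    have n2 := h.W_nonneg k ω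
    have a3 : Real.exp (W i ω / 64) * Real.exp (W k ω / 64) * Real.exp (W i ω / 8) ≤
        Real.exp (W i ω / 2) + Real.exp (W k ω / 2) := by
      rw [← Real.exp_add, ← Real.exp_add]
      rcases le_total (W i ω) (W k ω) with hle | hle
      · have : Real.exp (W i ω / 64 + W k ω / 64 + W i ω / 8) ≤ Real.exp (W k ω / 2) :=
          Real.exp_le_exp.2 (by linarith)
        have := Real.exp_pos (W i ω / 2); linarith
      · have : Real.exp (W i ω / 64 + W k ω / 64 + W i ω / 8) ≤ Real.exp (W i ω / 2) :=
          Real.exp_le_exp.2 (by linarith)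
        have := Real.exp_pos (W k ω / 2); linarith
    calc |Z i ω| * |Z k ω| * Real.exp (W i ω / 8)
        ≤ (K₁ * Real.exp (W i ω / 64)) * (K₁ * Real.exp (W k ω / 64)) * Real.exp (W i ω / 8) := by
          gcongr
      _ = K₁ ^ 2 * (Real.exp (W i ω / 64) * Real.exp (W k ω / 64) * Real.exp (W i ω / 8)) := by ring
      _ ≤ _ := by gcongr
  have hmajI : ∀ i k, Integrable
      (fun ω => K₁ ^ 2 * (Real.exp (W i ω / 2) + Real.exp (W k ω / 2))) μ := fun i k =>
    ((h.integrable_exp_half i).add (h.integrable_exp_half k)).const_mul _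
  have hmaj : ∀ i k, ∫ ω, K₁ ^ 2 * (Real.exp (W i ω / 2) + Real.exp (W k ω / 2)) ∂μ ≤
      2 * K₁ ^ 2 * P.C := by
    intro i k
    rw [integral_const_mul, integral_add (h.integrable_exp_half i) (h.integrable_exp_half k)]
    have := h.exp_le i
    have := h.exp_le k
    nlinarith [sq_nonneg K₁]
  have hcov : ∀ i k, cov[Z i, Z k; μ] = ∫ ω, Z i ω * Z k ω ∂μ := fun i k => by
    rw [covariance_eq_sub (h.memLp i 2) (h.memLp k 2)]
    simp [h.centered]
  have hint : ∀ i k, Integrable (fun ω => Z i ω * Z k ω) μ := fun i k =>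
    (h.memLp i 2).integrable_mul (h.memLp k 2)
  have hcrude : ∀ i k, |cov[Z i, Z k; μ]| ≤ 2 * K₁ ^ 2 * P.C := by
    intro i k
    rw [hcov]
    refine (abs_integral_le_integral_abs).trans ((integral_mono (hint i k).abs (hmajI i k)
      fun ω => ?_).trans (hmaj i k))
    refine le_trans ?_ (hprod i k ω)
    have := Real.one_le_exp (x := W i ω / 8) (by have := h.W_nonneg i ω; positivity)
    rw [abs_mul]
    nlinarith [mul_nonneg (abs_nonneg (Z i ω)) (abs_nonneg (Z k ω))]
  have hfar : ∀ i d : ℕ, 2 ≤ d → |cov[Z i, Z (i + d); μ]| ≤ K / (1 + (d : ℝ)) ^ 4 := by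
    intro i d hd
    rw [hcov]
    set D : ℝ := ((d - 1 : ℕ) : ℝ) with hD
    have hD1 : 1 ≤ D := by
      have : 1 ≤ d - 1 := by omega
      rw [hD]; exact_mod_cast this
    have hdD : (d : ℝ) = D + 1 := by
      rw [hD]; push_cast [show 1 ≤ d by omega]; ring
    set β : ℝ := P.m + D ^ (P.γ₁ / P.γ₂) with hβ
    have hDp : 1 ≤ D ^ (P.γ₁ / P.γ₂) := Real.one_le_rpow hD1 (by positivity)
    have hβ0 : 0 < β := by linarith
    set U : Ω → ℝ := fun ω => max (-β) (min β (Z i ω)) with hU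
    have hUm : Measurable[F (i + 1)] U :=
      (measurable_clip β).comp (h.adapted (i + 1) i (Nat.lt_succ_self i))
    have hUm' : Measurable U := (measurable_clip β).comp (h.measurable i)
    have e1 := h.abs_integral_mul_sub_le (b := i + 1) (a := i + d) (A := 1) (d := d - 1)
      (by omega) (by omega) hUm hβ0 one_pos (fun ω => abs_clip_le hβ0.le _)
      (G := fun x => x) (fun x y => by simp)
    rw [h.integral_blockSum] at e1
    simp only [blockSum_one, mul_zero, sub_zero, Nat.cast_one, one_mul, mul_one] at e1
    have hUI : Integrable (fun ω => U ω * Z (i + d) ω) μ :=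
      ((h.memLp (i + d) 1).integrable le_rfl).bdd_mul (c := β) hUm'.aestronglyMeasurable
        (ae_of_all _ fun ω => abs_clip_le hβ0.le _)
    have e2 : |∫ ω, (Z i ω * Z (i + d) ω - U ω * Z (i + d) ω) ∂μ| ≤
        Real.exp (-(1 / 8 * D ^ P.γ₁)) * (2 * K₁ ^ 2 * P.C) := by
      refine (abs_integral_le_integral_abs).trans ((integral_mono ((hint i (i + d)).sub hUI).abs
        ((hmajI i (i + d)).const_mul (Real.exp (-(1 / 8 * D ^ P.γ₁)))) fun ω => ?_).trans ?_)
      · have p := hprod i (i + d) ω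
        have hpos : 0 ≤ Real.exp (-(1 / 8 * D ^ P.γ₁)) *
            (K₁ ^ 2 * (Real.exp (W i ω / 2) + Real.exp (W (i + d) ω / 2))) := by positivity
        simp only [Pi.sub_apply, ← sub_mul, abs_mul]
        rcases le_or_gt |Z i ω| β with hle | hgt
        · simp only [hU, clip_eq_self hle]; simpa using hpos
        · -- a variable exceeding the clipping level has a large `W`
          have hW : D ^ P.γ₁ ≤ W i ω := by
            by_contra hcon
            push Not at hcon
            have := Real.rpow_le_rpow (h.W_nonneg i ω) hcon.le (z := 1 / P.γ₂) (by positivity)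
            rw [← Real.rpow_mul (by linarith), mul_one_div] at this
            have := h.abs_le i ω
            linarith
          have : 1 ≤ Real.exp (-(1 / 8 * D ^ P.γ₁)) * Real.exp (W i ω / 8) := by
            rw [← Real.exp_add]; exact Real.one_le_exp (by linarith)
          calc |Z i ω - U ω| * |Z (i + d) ω| ≤ |Z i ω| * |Z (i + d) ω| := by
                exact mul_le_mul_of_nonneg_right (abs_sub_clip_le hβ0.le _) (abs_nonneg _)
            _ ≤ |Z i ω| * |Z (i + d) ω| *
                (Real.exp (-(1 / 8 * D ^ P.γ₁)) * Real.exp (W i ω / 8)) :=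
                le_mul_of_one_le_right (by positivity) this
            _ = Real.exp (-(1 / 8 * D ^ P.γ₁)) *
                (|Z i ω| * |Z (i + d) ω| * Real.exp (W i ω / 8)) := by ring
            _ ≤ _ := by gcongr
      · rw [integral_const_mul]
        gcongr
        exact hmaj _ _
    rw [integral_sub (hint _ _) hUI] at e2
    have e3 : |∫ ω, Z i ω * Z (i + d) ω ∂μ| ≤
        β * Real.exp (-(P.c * D ^ P.γ₁)) + Real.exp (-(1 / 8 * D ^ P.γ₁)) * (2 * K₁ ^ 2 * P.C) := by
      rw [abs_le] at e1 e2 ⊢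
      constructor <;> linarith
    have b2 := hb2 D (by linarith)
    have b3 := hb3 D (by linarith)
    rw [Real.rpow_add (by linarith)] at b2
    have e4 : D ^ (4 : ℝ) = D ^ 4 := by norm_cast
    rw [e4] at b2 b3
    have hD4 : 0 < D ^ 4 := by positivity
    have hβle : β ≤ (P.m + 1) * D ^ (P.γ₁ / P.γ₂) := by rw [hβ]; nlinarith
    rw [le_div_iff₀ (by positivity)]
    have e5 : (1 + (d : ℝ)) ^ 4 ≤ 81 * D ^ 4 := by
      have : 1 + (d : ℝ) ≤ 3 * D := by linarith
      calc (1 + (d : ℝ)) ^ 4 ≤ (3 * D) ^ 4 := by gcongr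
        _ = _ := by ring
    set X : ℝ := 2 * K₁ ^ 2 * P.C with hX
    have hX0 : 0 < X := by positivity
    calc |∫ ω, Z i ω * Z (i + d) ω ∂μ| * (1 + (d : ℝ)) ^ 4
        ≤ ((P.m + 1) * D ^ (P.γ₁ / P.γ₂) * Real.exp (-(P.c * D ^ P.γ₁)) +
            Real.exp (-(1 / 8 * D ^ P.γ₁)) * X) * (81 * D ^ 4) := by
          refine mul_le_mul (e3.trans ?_) e5 (by positivity) (by positivity)
          gcongr
      _ = 81 * ((P.m + 1) * (D ^ (P.γ₁ / P.γ₂) * D ^ 4 * Real.exp (-(P.c * D ^ P.γ₁))) +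
            X * (D ^ 4 * Real.exp (-(1 / 8 * D ^ P.γ₁)))) := by ring
      _ ≤ 81 * ((P.m + 1) * K₂ + X * K₃) := by gcongr
      _ ≤ K := by rw [hK]; nlinarith
  have hall : ∀ i d : ℕ, |cov[Z i, Z (i + d); μ]| ≤ K / (1 + (d : ℝ)) ^ 4 := by
    intro i d
    rcases le_or_gt 2 d with hd | hd
    · exact hfar i d hd
    · rw [le_div_iff₀ (by positivity)]
      have hd' : (d : ℝ) ≤ 1 := by
        have : d ≤ 1 := by omega
        exact_mod_cast this
      have : (1 + (d : ℝ)) ^ 4 ≤ 2 ^ 4 := by gcongr; linarith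
      calc |cov[Z i, Z (i + d); μ]| * (1 + (d : ℝ)) ^ 4 ≤ (2 * K₁ ^ 2 * P.C) * 2 ^ 4 := by
            gcongr
            exact hcrude _ _
        _ ≤ K := by
            rw [hK]
            have : 0 ≤ (P.m + 1) * K₂ + 2 * K₁ ^ 2 * P.C * K₃ := by positivity
            linarith
  intro i k
  rcases le_total i k with hik | hik
  · obtain ⟨d, rfl⟩ := Nat.exists_eq_add_of_le hik
    have := hall i d
    simpa [abs_sub_comm] using this
  · obtain ⟨d, rfl⟩ := Nat.exists_eq_add_of_le hik
    rw [covariance_comm]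
    have := hall k d
    simpa using this

end

lemma summable_int_inv_sq : Summable fun j : ℤ => 1 / (1 + |(j : ℝ)|) ^ 2 := by
  have h : Summable fun n : ℕ => 1 / (1 + (n : ℝ)) ^ 2 := by
    have := (summable_nat_add_iff 1).2 (Real.summable_one_div_nat_pow.2 one_lt_two)
    refine this.congr fun n => ?_
    push_cast
    rw [add_comm]
  refine Summable.of_nat_of_neg ?_ ?_
  · simpa using h
  · simpa using h

/-- The covariance of two blocks is at most linear in the length of either one alone, with a small
factor when they are far apart. -/
lemma exists_abs_cov_blockSum_le (P : Params) :
    ∃ K : ℝ, 0 < K ∧ ∀ {Ω : Type*} {_ : MeasurableSpace Ω}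
    {μ : Measure Ω} [IsProbabilityMeasure μ] {w : ℝ} {F : ℕ → MeasurableSpace Ω}
    {Z W : ℕ → Ω → ℝ}, IsAdmissible P μ w F Z W → ∀ (a A b B : ℕ) (q : ℝ), 0 ≤ q →
    (∀ i < A, ∀ k < B, q ≤ |((a + i : ℕ) : ℝ) - ((b + k : ℕ) : ℝ)|) →
    |cov[blockSum Z a A, blockSum Z b B; μ]| ≤ K * A / (1 + q) ^ 2 := by
  obtain ⟨K, hK, hcov⟩ := exists_abs_cov_le P
  set T : ℝ := ∑' j : ℤ, 1 / (1 + |(j : ℝ)|) ^ 2 with hT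
  have hT0 : 0 < T := by
    refine lt_of_lt_of_le (b := 1 / (1 + |((0 : ℤ) : ℝ)|) ^ 2) (by simp) ?_
    exact summable_int_inv_sq.le_tsum 0 fun j _ => by positivity
  refine ⟨K * T, by positivity, ?_⟩
  intro Ω _ μ _ w F Z W h a A b B q hq hgap
  have hsum : ∀ x : ℕ, ∑ k ∈ Finset.range B, 1 / (1 + |(x : ℝ) - ((b + k : ℕ) : ℝ)|) ^ 2 ≤ T := by
    intro x
    have e : ∑ k ∈ Finset.range B, 1 / (1 + |(x : ℝ) - ((b + k : ℕ) : ℝ)|) ^ 2 =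
        ∑ j ∈ (Finset.range B).image (fun k : ℕ => (x : ℤ) - (b + k : ℕ)),
          1 / (1 + |(j : ℝ)|) ^ 2 := by
      rw [Finset.sum_image]
      · refine Finset.sum_congr rfl fun k _ => ?_
        push_cast
        rfl
      · intro k _ l _ hkl
        simp only at hkl
        omega
    rw [e]
    exact summable_int_inv_sq.sum_le_tsum _ fun j _ => by positivity
  have e1 : cov[blockSum Z a A, blockSum Z b B; μ] =
      ∑ i ∈ Finset.range A, ∑ k ∈ Finset.range B, cov[Z (a + i), Z (b + k); μ] := by
    unfold blockSum
    exact covariance_fun_sum_fun_sum' (fun i _ => h.memLp _ 2) (fun i _ => h.memLp _ 2)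
  rw [e1]
  calc |∑ i ∈ Finset.range A, ∑ k ∈ Finset.range B, cov[Z (a + i), Z (b + k); μ]|
      ≤ ∑ i ∈ Finset.range A, ∑ k ∈ Finset.range B, |cov[Z (a + i), Z (b + k); μ]| :=
        (Finset.abs_sum_le_sum_abs _ _).trans
          (Finset.sum_le_sum fun i _ => Finset.abs_sum_le_sum_abs _ _)
    _ ≤ ∑ i ∈ Finset.range A, ∑ k ∈ Finset.range B,
          K / (1 + q) ^ 2 * (1 / (1 + |((a + i : ℕ) : ℝ) - ((b + k : ℕ) : ℝ)|) ^ 2) := by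
        refine Finset.sum_le_sum fun i hi => Finset.sum_le_sum fun k hk => ?_
        refine (hcov h _ _).trans ?_
        have hg := hgap i (Finset.mem_range.1 hi) k (Finset.mem_range.1 hk)
        set x := |((a + i : ℕ) : ℝ) - ((b + k : ℕ) : ℝ)|
        rw [div_mul_div_comm, mul_one]
        gcongr
        calc (1 + q) ^ 2 * (1 + x) ^ 2 ≤ (1 + x) ^ 2 * (1 + x) ^ 2 := by gcongr
          _ = _ := by ring
    _ ≤ ∑ i ∈ Finset.range A, K / (1 + q) ^ 2 * T := by
        refine Finset.sum_le_sum fun i _ => ?_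
        rw [← Finset.mul_sum]
        exact mul_le_mul_of_nonneg_left (hsum _) (by positivity)
    _ = K * T * A / (1 + q) ^ 2 := by
        rw [Finset.sum_const, Finset.card_range, nsmul_eq_mul]; ring

section
variable {P : Params} {Ω : Type*} {mΩ : MeasurableSpace Ω} {μ : Measure Ω} [IsProbabilityMeasure μ]
  {w : ℝ} {F : ℕ → MeasurableSpace Ω} {Z W : ℕ → Ω → ℝ}

/-- Variances are linear in the length of the block, and almost additive when a block is cut into
two pieces by removing a gap of length `d`. -/
lemma exists_variance_le (P : Params) : ∃ K : ℝ, 0 < K ∧ ∀ {Ω : Type*} {_ : MeasurableSpace Ω}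
    {μ : Measure Ω} [IsProbabilityMeasure μ] {w : ℝ} {F : ℕ → MeasurableSpace Ω}
    {Z W : ℕ → Ω → ℝ}, IsAdmissible P μ w F Z W →
    (∀ a A : ℕ, Var[blockSum Z a A; μ] ≤ K * A) ∧
    ∀ a A d B : ℕ, 1 ≤ d → A + d + B ≤ d ^ 2 →
      |Var[blockSum Z a (A + d + B); μ] -
        (Var[blockSum Z a A; μ] + Var[blockSum Z (a + A + d) B; μ])| ≤ K * d := by
  obtain ⟨K, hK, hcov⟩ := exists_abs_cov_blockSum_le P
  refine ⟨7 * K, by positivity, ?_⟩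
  intro Ω _ μ _ w F Z W h
  have h0 : ∀ a A b B : ℕ, |cov[blockSum Z a A, blockSum Z b B; μ]| ≤ K * A := fun a A b B => by
    simpa using hcov h a A b B 0 le_rfl fun i _ k _ => abs_nonneg _
  have hv : ∀ a A, Var[blockSum Z a A; μ] ≤ K * A := fun a A => by
    rw [← covariance_self (h.measurable_blockSum a A).aemeasurable]
    exact (le_abs_self _).trans (h0 a A a A)
  refine ⟨fun a A => (hv a A).trans ?_, ?_⟩
  · have : 0 ≤ K * A := by positivity
    linarith
  intro a A d B hd hle
  have m1 := h.memLp_blockSum a A 2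
  have m2 := h.memLp_blockSum (a + A) d 2
  have m3 := h.memLp_blockSum (a + A + d) B 2
  have e1 : blockSum Z a (A + d + B) =
      fun ω => (blockSum Z a A + blockSum Z (a + A) d) ω + blockSum Z (a + A + d) B ω := by
    funext ω
    rw [blockSum_add, blockSum_add, add_assoc a A d, Pi.add_apply]
  have e2 : cov[blockSum Z a A + blockSum Z (a + A) d, blockSum Z (a + A + d) B; μ] =
      cov[blockSum Z a A, blockSum Z (a + A + d) B; μ] +
      cov[blockSum Z (a + A) d, blockSum Z (a + A + d) B; μ] := covariance_add_left m1 m2 m3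
  rw [e1, variance_fun_add (m1.add m2) m3, variance_add m1 m2, e2]
  have c1 : |cov[blockSum Z a A, blockSum Z (a + A + d) B; μ]| ≤ K := by
    refine (hcov h a A (a + A + d) B d (by positivity) fun i hi k _ => ?_).trans ?_
    · rw [abs_sub_comm]
      refine le_trans ?_ (le_abs_self _)
      have : (a + i : ℕ) + d ≤ (a + A + d + k : ℕ) := by omega
      have : ((a + i : ℕ) : ℝ) + d ≤ ((a + A + d + k : ℕ) : ℝ) := by exact_mod_cast this
      linarith
    · rw [div_le_iff₀ (by positivity)]
      have : (A : ℝ) ≤ (d : ℝ) ^ 2 := by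
        have : A ≤ d ^ 2 := by omega
        exact_mod_cast this
      have : (A : ℝ) ≤ (1 + (d : ℝ)) ^ 2 := by nlinarith [Nat.cast_nonneg (α := ℝ) d]
      gcongr
  have c2 : |cov[blockSum Z (a + A) d, blockSum Z (a + A + d) B; μ]| ≤ K * d := h0 _ _ _ _
  have c3 : |cov[blockSum Z a A, blockSum Z (a + A) d; μ]| ≤ K * d := by
    rw [covariance_comm]; exact h0 _ _ _ _
  have c4 := hv (a + A) d
  have c5 := variance_nonneg (blockSum Z (a + A) d) μ
  have hd' : (1 : ℝ) ≤ d := by exact_mod_cast hd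
  have c6 : K ≤ K * d := le_mul_of_one_le_right hK.le hd'
  rw [abs_le] at c1 c2 c3 ⊢
  constructor <;> linarith

/-! ### Exponential moments of block sums -/

/-- The exponentially integrable majorant attached to a block. -/
noncomputable def blockMajorant (W : ℕ → Ω → ℝ) (a A : ℕ) (ω : Ω) : ℝ :=
  ∑ i ∈ Finset.range A, Real.exp (W (a + i) ω / 2)

namespace IsAdmissible

lemma integrable_blockMajorant (h : IsAdmissible P μ w F Z W) (a A : ℕ) :
    Integrable (blockMajorant W a A) μ :=
  integrable_finsetSum _ fun i _ => h.integrable_exp_half (a + i)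

lemma integral_blockMajorant_le (h : IsAdmissible P μ w F Z W) (a A : ℕ) :
    ∫ ω, blockMajorant W a A ω ∂μ ≤ A * P.C := by
  unfold blockMajorant
  rw [integral_finsetSum _ fun i _ => h.integrable_exp_half (a + i)]
  have := Finset.sum_le_card_nsmul (Finset.range A) _ P.C fun i _ => h.exp_le (a + i)
  rwa [Finset.card_range, nsmul_eq_mul] at this

/-- All sub-blocks of a block are controlled by the largest `W` of the block. -/
lemma exists_max (h : IsAdmissible P μ w F Z W) (a A : ℕ) (hA : 1 ≤ A) (ω : Ω) :
    ∃ V : ℝ, 0 ≤ V ∧ V ≤ w ∧ Real.exp (V / 2) ≤ blockMajorant W a A ω ∧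
      ∀ b B : ℕ, a ≤ b → b + B ≤ a + A →
        |blockSum Z b B ω| ≤ B * (P.m + V ^ (1 / P.γ₂)) := by
  obtain ⟨i, hi, hmax⟩ := Finset.exists_max_image (Finset.range A) (fun i => W (a + i) ω)
    ⟨0, Finset.mem_range.2 hA⟩
  have h2 := P.γ₂_pos
  refine ⟨W (a + i) ω, h.W_nonneg _ _, h.W_le _ _, ?_, fun b B hb hB => ?_⟩
  · exact Finset.single_le_sum (f := fun i => Real.exp (W (a + i) ω / 2))
      (fun _ _ => (Real.exp_pos _).le) hi
  · refine (Finset.abs_sum_le_sum_abs _ _).trans ?_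
    have : ∀ k ∈ Finset.range B, |Z (b + k) ω| ≤ P.m + W (a + i) ω ^ (1 / P.γ₂) := by
      intro k hk
      have hk' := Finset.mem_range.1 hk
      have := hmax (b + k - a) (Finset.mem_range.2 (by omega))
      rw [show a + (b + k - a) = b + k by omega] at this
      have := Real.rpow_le_rpow (h.W_nonneg (b + k) ω) this (z := 1 / P.γ₂) (by positivity)
      have := h.abs_le (b + k) ω
      linarith
    have := Finset.sum_le_card_nsmul _ _ _ this
    rwa [Finset.card_range, nsmul_eq_mul] at this

end IsAdmissible

/-- Pointwise control of the exponential moments of all sub-blocks of a block, by the same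
random envelope `u`. The second bound has an additional factor `exp (-A ^ γ₁ / 8)` if the envelope
exceeds its typical size `A * (m + A ^ (γ₁ / γ₂))`. -/
lemma exists_envelope (P : Params) : ∃ K : ℝ, 1 ≤ K ∧ ∀ {Ω : Type*} {_ : MeasurableSpace Ω}
    {μ : Measure Ω} [IsProbabilityMeasure μ] {w : ℝ} {F : ℕ → MeasurableSpace Ω}
    {Z W : ℕ → Ω → ℝ}, IsAdmissible P μ w F Z W → ∀ (a A : ℕ) (t : ℝ), 1 ≤ A →
    P.zeta w A t ≤ 1 / 16 → ∀ ω, ∃ u : ℝ, 0 ≤ u ∧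
      (∀ b B : ℕ, a ≤ b → b + B ≤ a + A → |blockSum Z b B ω| ≤ u) ∧
      ∀ k : ℕ, k ≤ 3 →
        u ^ k * Real.exp (2 * (|t| * u)) ≤
          A ^ k * K * Real.exp (2 * (P.m + 1) * (|t| * (A : ℝ) ^ P.ν)) * blockMajorant W a A ω ∧
        (A * (P.m + (A : ℝ) ^ (P.γ₁ / P.γ₂)) < u →
          u ^ k * Real.exp (2 * (|t| * u)) ≤
          A ^ k * K * Real.exp (2 * (P.m + 1) * (|t| * (A : ℝ) ^ P.ν)) *
            Real.exp (-((A : ℝ) ^ P.γ₁ / 8)) * blockMajorant W a A ω) := by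
  obtain ⟨K, hK, hexp⟩ := P.exists_envelope_le_exp
  have h2 := P.γ₂_pos
  have hm := P.m_nonneg
  refine ⟨K ^ 3, one_le_pow₀ hK, ?_⟩
  intro Ω _ μ _ w F Z W h a A t hA hz ω
  obtain ⟨V, hV0, hVw, hVM, hV⟩ := h.exists_max a A hA ω
  have hA' : (1 : ℝ) ≤ A := by exact_mod_cast hA
  have hVr := Real.rpow_nonneg hV0 (1 / P.γ₂)
  set E : ℝ := Real.exp (2 * (P.m + 1) * (|t| * (A : ℝ) ^ P.ν)) with hE
  have hu0 : 0 ≤ (A : ℝ) * (P.m + V ^ (1 / P.γ₂)) := by positivity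
  refine ⟨A * (P.m + V ^ (1 / P.γ₂)), hu0, ?_, fun k hk => ?_⟩
  · intro b B hb hB
    refine (hV b B hb hB).trans ?_
    gcongr
    omega
  have key : ((A : ℝ) * (P.m + V ^ (1 / P.γ₂))) ^ k *
      Real.exp (2 * (|t| * (A * (P.m + V ^ (1 / P.γ₂))))) ≤
      A ^ k * K ^ 3 * E * Real.exp (-(V / 8)) * blockMajorant W a A ω := by
    have h1 := P.abs_mul_envelope_le (t := t) hA' hV0 hVw
    have h3 : Real.exp (2 * (|t| * (A * (P.m + V ^ (1 / P.γ₂))))) ≤ E * Real.exp (V / 8) := by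
      rw [hE, ← Real.exp_add]
      apply Real.exp_le_exp.2
      nlinarith
    have h4 : (P.m + V ^ (1 / P.γ₂)) ^ k ≤ K ^ 3 * Real.exp (3 * V / 64) := by
      calc (P.m + V ^ (1 / P.γ₂)) ^ k ≤ (K * Real.exp (V / 64)) ^ k := by
            gcongr; exact hexp V hV0
        _ ≤ (K * Real.exp (V / 64)) ^ 3 := by
            have : 1 ≤ Real.exp (V / 64) := Real.one_le_exp (by positivity)
            exact pow_le_pow_right₀ (by nlinarith) hk
        _ = K ^ 3 * Real.exp (3 * V / 64) := by
            rw [mul_pow, ← Real.exp_nat_mul]; congr 2; push_cast; ring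
    have h5 : Real.exp (3 * V / 64) * Real.exp (V / 8) ≤
        Real.exp (-(V / 8)) * blockMajorant W a A ω := by
      refine le_trans ?_ (mul_le_mul_of_nonneg_left hVM (Real.exp_pos _).le)
      rw [← Real.exp_add, ← Real.exp_add]
      exact Real.exp_le_exp.2 (by linarith)
    calc ((A : ℝ) * (P.m + V ^ (1 / P.γ₂))) ^ k *
          Real.exp (2 * (|t| * (A * (P.m + V ^ (1 / P.γ₂)))))
        ≤ ((A : ℝ) ^ k * (K ^ 3 * Real.exp (3 * V / 64))) * (E * Real.exp (V / 8)) := by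
          rw [mul_pow]; gcongr
      _ = A ^ k * K ^ 3 * E * (Real.exp (3 * V / 64) * Real.exp (V / 8)) := by ring
      _ ≤ A ^ k * K ^ 3 * E * (Real.exp (-(V / 8)) * blockMajorant W a A ω) := by gcongr
      _ = _ := by ring
  have hM0 : 0 ≤ blockMajorant W a A ω := (Real.exp_pos _).le.trans hVM
  have hpre : 0 ≤ (A : ℝ) ^ k * K ^ 3 * E := by positivity
  refine ⟨key.trans ?_, fun hbig => key.trans ?_⟩
  · have : Real.exp (-(V / 8)) ≤ 1 := Real.exp_le_one_iff.2 (by linarith)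
    exact mul_le_mul_of_nonneg_right (mul_le_of_le_one_right hpre this) hM0
  · have hAV : (A : ℝ) ^ P.γ₁ ≤ V := by
      by_contra hcon
      push Not at hcon
      have := Real.rpow_le_rpow hV0 hcon.le (z := 1 / P.γ₂) (by positivity)
      rw [← Real.rpow_mul (by linarith), mul_one_div] at this
      have : (A : ℝ) * (P.m + V ^ (1 / P.γ₂)) ≤ A * (P.m + (A : ℝ) ^ (P.γ₁ / P.γ₂)) := by gcongr
      linarith
    gcongr

end

/-! ### The log-Laplace transform of two separated blocks, and of short blocks -/

set_option maxHeartbeats 1000000 in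
/-- Two blocks which are separated by a gap behave almost independently at the level of log-Laplace
transforms, with an error which is quadratic in `t`. The blocks are clipped at the typical size
of their envelope to make the exponentials Lipschitz; the clipping error is negligible because of
the exponential moments of the envelope. -/
lemma exists_abs_cgf_add_sub_le (P : Params) : ∃ K ε : ℝ, 0 < K ∧ 0 < ε ∧
    ∀ {Ω : Type*} {_ : MeasurableSpace Ω}
    {μ : Measure Ω} [IsProbabilityMeasure μ] {w : ℝ} {F : ℕ → MeasurableSpace Ω}
    {Z W : ℕ → Ω → ℝ}, IsAdmissible P μ w F Z W → ∀ (a A₁ d A₂ A : ℕ) (t : ℝ),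
    A₁ + d + A₂ = A → 1 ≤ d → A ≤ d ^ 2 → P.zeta w A t ≤ ε →
    16 * (P.m + 1) * (P.zeta w A t * (A : ℝ) ^ P.γ₁) ≤ P.c * (d : ℝ) ^ P.γ₁ →
    |cgf (fun ω => blockSum Z a A₁ ω + blockSum Z (a + A₁ + d) A₂ ω) μ t -
      (cgf (blockSum Z a A₁) μ t + cgf (blockSum Z (a + A₁ + d) A₂) μ t)| ≤ K * t ^ 2 := by
  obtain ⟨K, hK, henv⟩ := exists_envelope P
  have h1 := P.γ₁_pos
  have h2 := P.γ₂_pos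
  have hc := P.c_pos
  have hC := P.one_le_C
  have hm := P.m_nonneg
  have hν := P.one_le_ν
  obtain ⟨K₄, hK₄, hb4⟩ := exists_rpow_mul_exp_neg_le 4 (1 / 16) P.γ₁ (by norm_num) (by norm_num) h1
  obtain ⟨K₅, hK₅, hb5⟩ := exists_rpow_mul_exp_neg_le (2 * (P.ν + 1)) (P.c / 2) P.γ₁
    (by linarith) (by positivity) h1
  refine ⟨2 * (K * P.C) * K₄ + 4 * (K * P.C) ^ 2 * K₄ + (P.m + 1) * K₅, 1 / (64 * (P.m + 1)),
    by positivity, by positivity, ?_⟩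
  intro Ω _ μ _ w F Z W h a A₁ d A₂ A t hA hd hAd hz hgap
  rcases eq_or_ne t 0 with rfl | ht
  · simp
  have ht0 : 0 < |t| := abs_pos.2 ht
  have hA1 : 1 ≤ A := by omega
  have hA1' : (1 : ℝ) ≤ A := by exact_mod_cast hA1
  have hA0' : (0 : ℝ) < A := by linarith
  have hz0 : 0 ≤ P.zeta w A t := P.zeta_nonneg h.w_nonneg hA0'.le t
  have hz16 : P.zeta w A t ≤ 1 / 16 := by
    refine hz.trans ?_
    rw [div_le_div_iff₀ (by positivity) (by norm_num)]
    linarith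
  set x : ℝ := |t| * (A : ℝ) ^ P.ν with hx
  have hxz : x ≤ P.zeta w A t * (A : ℝ) ^ P.γ₁ := P.abs_mul_rpow_ν_le h.w_nonneg hA0' t
  have hx0 : 0 ≤ x := by positivity
  set E : ℝ := Real.exp (2 * (P.m + 1) * x) with hE
  have hE1 : 1 ≤ E := Real.one_le_exp (by positivity)
  set e8 : ℝ := Real.exp (-((A : ℝ) ^ P.γ₁ / 8)) with he8
  have he80 : 0 < e8 := Real.exp_pos _
  set β : ℝ := A * (P.m + (A : ℝ) ^ (P.γ₁ / P.γ₂)) with hβ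
  have hβ0 : 0 < β := by positivity
  have hβle : β ≤ (P.m + 1) * (A : ℝ) ^ P.ν := by
    have e : (A : ℝ) ^ P.ν = (A : ℝ) ^ (P.γ₁ / P.γ₂) * A := by
      rw [Params.ν, Real.rpow_add hA0', Real.rpow_one]
    have e2 : (A : ℝ) ≤ (A : ℝ) ^ P.ν := Real.self_le_rpow_of_one_le hA1' hν
    have : P.m * A ≤ P.m * (A : ℝ) ^ P.ν := by gcongr
    rw [hβ]; nlinarith
  have htβ : |t| * β ≤ (P.m + 1) * x := by
    calc |t| * β ≤ |t| * ((P.m + 1) * (A : ℝ) ^ P.ν) := by gcongr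
      _ = _ := by rw [hx]; ring
  set S₁ : Ω → ℝ := blockSum Z a A₁ with hS₁
  set S₂ : Ω → ℝ := blockSum Z (a + A₁ + d) A₂ with hS₂
  have mS₁ : Measurable S₁ := h.measurable_blockSum _ _
  have mS₂ : Measurable S₂ := h.measurable_blockSum _ _
  set M : Ω → ℝ := blockMajorant W a A with hM
  have hMI : Integrable M μ := h.integrable_blockMajorant a A
  have hMle : ∫ ω, M ω ∂μ ≤ A * P.C := h.integral_blockMajorant_le a A
  -- `D` and `D'` are the exponential minus one, before and after clipping. Subtracting one makes every
  -- product of the two blocks quadratic in `t`.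
  obtain ⟨D, hD⟩ : ∃ D : ℝ → ℝ, D = fun y => Real.exp (t * y) - 1 := ⟨_, rfl⟩
  obtain ⟨D', hD'⟩ : ∃ D' : ℝ → ℝ, D' = fun y => Real.exp (t * max (-β) (min β y)) - 1 := ⟨_, rfl⟩
  have mD : Measurable D := by rw [hD]; fun_prop
  have mD' : Measurable D' := by rw [hD']; fun_prop
  have hDD' : ∀ y, |y| ≤ β → D' y = D y := fun y hy => by rw [hD', hD]; simp only [clip_eq_self hy]
  have hDle : ∀ y u, |y| ≤ u → |D y| ≤ |t| * (u * Real.exp (|t| * u)) := by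
    intro y u hyu
    rw [hD]
    have hu : 0 ≤ u := (abs_nonneg _).trans hyu
    calc |Real.exp (t * y) - 1| ≤ |t * y| * Real.exp |t * y| := abs_exp_sub_one_le _
      _ = |t| * (|y| * Real.exp (|t| * |y|)) := by rw [abs_mul]; ring
      _ ≤ _ := by gcongr
  have hD'le : ∀ y u, |y| ≤ u → |D' y| ≤ |t| * (u * Real.exp (|t| * u)) := by
    intro y u hyu
    have := hDle (max (-β) (min β y)) u ((abs_clip_le_abs hβ0.le y).trans hyu)
    rw [hD] at this
    rw [hD']
    exact this
  have hD'β : ∀ y, |D' y| ≤ |t| * (β * Real.exp (|t| * β)) := by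
    intro y
    have := hDle (max (-β) (min β y)) β (abs_clip_le hβ0.le y)
    rw [hD] at this
    rw [hD']
    exact this
  have henv' := fun ω => henv h a A t hA1 hz16 ω
  have hsub : ∀ ω (u : ℝ), (∀ b B : ℕ, a ≤ b → b + B ≤ a + A → |blockSum Z b B ω| ≤ u) →
      |S₁ ω| ≤ u ∧ |S₂ ω| ≤ u := fun ω u hu =>
    ⟨hu _ _ le_rfl (by omega), hu _ _ (by omega) (by omega)⟩
  have hbd : ∀ S : Ω → ℝ, Measurable S → (∃ B, ∀ ω, |S ω| ≤ B) →
      (∃ B, ∀ ω, |D (S ω)| ≤ B) ∧ (∃ B, ∀ ω, |D' (S ω)| ≤ B) := by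
    rintro S - ⟨B, hB⟩
    exact ⟨⟨_, fun ω => hDle _ B (hB ω)⟩, ⟨_, fun ω => hD'le _ B (hB ω)⟩⟩
  have hint : ∀ G : Ω → ℝ, Measurable G → (∃ B, ∀ ω, |G ω| ≤ B) → Integrable G μ :=
    fun G hG ⟨B, hB⟩ => integrable_of_abs_le hG hB
  obtain ⟨bd1, bd1'⟩ := hbd S₁ mS₁ ⟨_, h.abs_blockSum_le _ _⟩
  obtain ⟨bd2, bd2'⟩ := hbd S₂ mS₂ ⟨_, h.abs_blockSum_le _ _⟩
  have i1 : Integrable (fun ω => D (S₁ ω)) μ := hint _ (mD.comp mS₁) bd1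
  have i1' : Integrable (fun ω => D' (S₁ ω)) μ := hint _ (mD'.comp mS₁) bd1'
  have i2 : Integrable (fun ω => D (S₂ ω)) μ := hint _ (mD.comp mS₂) bd2
  have i2' : Integrable (fun ω => D' (S₂ ω)) μ := hint _ (mD'.comp mS₂) bd2'
  have hprodbd : ∀ G G' : Ω → ℝ, (∃ B, ∀ ω, |G ω| ≤ B) → (∃ B, ∀ ω, |G' ω| ≤ B) →
      ∃ B, ∀ ω, |G ω * G' ω| ≤ B := by
    rintro G G' ⟨B, hB⟩ ⟨B', hB'⟩
    refine ⟨B * B', fun ω => ?_⟩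
    rw [abs_mul]
    have := hB ω
    have := hB' ω
    have := (abs_nonneg _).trans (hB ω)
    gcongr
  have i12 : Integrable (fun ω => D (S₁ ω) * D (S₂ ω)) μ :=
    hint _ ((mD.comp mS₁).mul (mD.comp mS₂)) (hprodbd _ _ bd1 bd2)
  have i12' : Integrable (fun ω => D' (S₁ ω) * D' (S₂ ω)) μ :=
    hint _ ((mD'.comp mS₁).mul (mD'.comp mS₂)) (hprodbd _ _ bd1' bd2')
  have hM0 : ∀ ω, 0 ≤ M ω := fun ω => Finset.sum_nonneg fun _ _ => (Real.exp_pos _).le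
  -- Expectations of `D` and `D'` are `O(t)`, and `r2` bounds the effect of clipping on them.
  have r1 : ∀ (G : ℝ → ℝ) (S : Ω → ℝ), (∀ y u, |y| ≤ u → |G y| ≤ |t| * (u * Real.exp (|t| * u))) →
      Integrable (fun ω => G (S ω)) μ →
      (∀ ω (u : ℝ), (∀ b B : ℕ, a ≤ b → b + B ≤ a + A → |blockSum Z b B ω| ≤ u) → |S ω| ≤ u) →
      |∫ ω, G (S ω) ∂μ| ≤ |t| * (A ^ 2 * (K * P.C) * E) := by
    intro G S hG hGI hS
    refine abs_integral_le_integral_abs.trans ((integral_mono hGI.abs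
      (hMI.const_mul (|t| * (A * K * E))) fun ω => ?_).trans ?_)
    · obtain ⟨u, hu0, hu, hk⟩ := henv' ω
      have hk1 := (hk 1 (by norm_num)).1
      rw [pow_one, pow_one] at hk1
      refine (hG _ _ (hS ω u hu)).trans ?_
      rw [mul_assoc |t|]
      refine mul_le_mul_of_nonneg_left (le_trans ?_ hk1) (abs_nonneg t)
      refine mul_le_mul_of_nonneg_left (Real.exp_le_exp.2 ?_) hu0
      have : 0 ≤ |t| * u := by positivity
      linarith
    · rw [integral_const_mul]
      calc |t| * (A * K * E) * ∫ ω, M ω ∂μ ≤ |t| * (A * K * E) * (A * P.C) := by gcongr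
        _ = _ := by ring
  have r2 : ∀ (S : Ω → ℝ), Integrable (fun ω => D (S ω)) μ → Integrable (fun ω => D' (S ω)) μ →
      (∀ ω (u : ℝ), (∀ b B : ℕ, a ≤ b → b + B ≤ a + A → |blockSum Z b B ω| ≤ u) → |S ω| ≤ u) →
      |∫ ω, D (S ω) ∂μ - ∫ ω, D' (S ω) ∂μ| ≤ |t| * (2 * (A ^ 2 * (K * P.C) * E * e8)) := by
    intro S hI hI' hS
    rw [← integral_sub hI hI']
    refine abs_integral_le_integral_abs.trans ((integral_mono (hI.sub hI').abs
      (hMI.const_mul (|t| * (2 * (A * K * E * e8)))) fun ω => ?_).trans ?_)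
    · obtain ⟨u, hu0, hu, hk⟩ := henv' ω
      have hk1 := (hk 1 (by norm_num)).2
      rw [pow_one, pow_one] at hk1
      simp only [Pi.sub_apply]
      have hM0' := hM0 ω
      rcases le_or_gt |S ω| β with hle | hgt
      · rw [hDD' _ hle, sub_self, abs_zero]
        positivity
      · have hSu := hS ω u hu
        have hexp : Real.exp (|t| * u) ≤ Real.exp (2 * (|t| * u)) := by
          apply Real.exp_le_exp.2
          have : 0 ≤ |t| * u := by positivity
          linarith
        calc |D (S ω) - D' (S ω)| ≤ |D (S ω)| + |D' (S ω)| := abs_sub _ _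
          _ ≤ |t| * (u * Real.exp (|t| * u)) + |t| * (u * Real.exp (|t| * u)) :=
              add_le_add (hDle _ _ hSu) (hD'le _ _ hSu)
          _ ≤ |t| * (u * Real.exp (2 * (|t| * u))) + |t| * (u * Real.exp (2 * (|t| * u))) := by
              gcongr
          _ = |t| * (2 * (u * Real.exp (2 * (|t| * u)))) := by ring
          _ ≤ |t| * (2 * (A * K * E * e8 * M ω)) := by
              have := hk1 (hgt.trans_le hSu)
              gcongr
          _ = _ := by ring
    · rw [integral_const_mul]
      calc |t| * (2 * (A * K * E * e8)) * ∫ ω, M ω ∂μ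
          ≤ |t| * (2 * (A * K * E * e8)) * (A * P.C) := by gcongr
        _ = _ := by ring
  -- The same for the expectation of the product: clipping matters only if the envelope exceeds `β`.
  have r3 : |∫ ω, D (S₁ ω) * D (S₂ ω) ∂μ - ∫ ω, D' (S₁ ω) * D' (S₂ ω) ∂μ| ≤
      t ^ 2 * (2 * (A ^ 3 * (K * P.C) * E * e8)) := by
    rw [← integral_sub i12 i12']
    refine abs_integral_le_integral_abs.trans ((integral_mono (i12.sub i12').abs
      (hMI.const_mul (t ^ 2 * (2 * (A ^ 2 * K * E * e8)))) fun ω => ?_).trans ?_)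
    · obtain ⟨u, hu0, hu, hk⟩ := henv' ω
      have hk2 := (hk 2 (by norm_num)).2
      obtain ⟨hu1, hu2⟩ := hsub ω u hu
      simp only [Pi.sub_apply]
      have hM0' := hM0 ω
      have hbig : β < u → |D (S₁ ω) * D (S₂ ω) - D' (S₁ ω) * D' (S₂ ω)| ≤
          t ^ 2 * (2 * (A ^ 2 * K * E * e8)) * M ω := by
        intro hβu
        have p1 := hDle _ _ hu1
        have p2 := hDle _ _ hu2
        have p3 := hD'le _ _ hu1
        have p4 := hD'le _ _ hu2
        have hsq : |t| * (u * Real.exp (|t| * u)) * (|t| * (u * Real.exp (|t| * u))) =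
            t ^ 2 * (u ^ 2 * Real.exp (2 * (|t| * u))) := by
          rw [two_mul (|t| * u), Real.exp_add, ← sq_abs t]; ring
        calc |D (S₁ ω) * D (S₂ ω) - D' (S₁ ω) * D' (S₂ ω)|
            ≤ |D (S₁ ω)| * |D (S₂ ω)| + |D' (S₁ ω)| * |D' (S₂ ω)| := by
              rw [← abs_mul, ← abs_mul]; exact abs_sub _ _
          _ ≤ |t| * (u * Real.exp (|t| * u)) * (|t| * (u * Real.exp (|t| * u))) +
              |t| * (u * Real.exp (|t| * u)) * (|t| * (u * Real.exp (|t| * u))) := by gcongr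
          _ = t ^ 2 * (2 * (u ^ 2 * Real.exp (2 * (|t| * u)))) := by rw [hsq]; ring
          _ ≤ t ^ 2 * (2 * (A ^ 2 * K * E * e8 * M ω)) := by
              have := hk2 hβu
              gcongr
          _ = _ := by ring
      rcases le_or_gt |S₁ ω| β with hle1 | hgt1
      · rcases le_or_gt |S₂ ω| β with hle2 | hgt2
        · rw [hDD' _ hle1, hDD' _ hle2, sub_self, abs_zero]
          positivity
        · exact hbig (hgt2.trans_le hu2)
      · exact hbig (hgt1.trans_le hu1)
    · rw [integral_const_mul]
      calc t ^ 2 * (2 * (A ^ 2 * K * E * e8)) * ∫ ω, M ω ∂μ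
          ≤ t ^ 2 * (2 * (A ^ 2 * K * E * e8)) * (A * P.C) := by gcongr
        _ = _ := by ring
  -- The clipped exponentials are Lipschitz, so that their product can be decoupled.
  have r4 : |∫ ω, D' (S₁ ω) * D' (S₂ ω) ∂μ - (∫ ω, D' (S₁ ω) ∂μ) * ∫ ω, D' (S₂ ω) ∂μ| ≤
      t ^ 2 * ((P.m + 1) * (A : ℝ) ^ (P.ν + 1) * (E * Real.exp (-(P.c * (d : ℝ) ^ P.γ₁)))) := by
    have := h.abs_integral_mul_sub_le (b := a + A₁) (a := a + A₁ + d) (A := A₂) hd le_rfl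
      (U := fun ω => D' (S₁ ω)) (mD'.comp (h.adapted_blockSum le_rfl))
      (B := |t| * (β * Real.exp (|t| * β))) (L := |t| * Real.exp (|t| * β)) (by positivity)
      (by positivity) (fun ω => hD'β _) (G := D') (fun y z => by
        rw [hD']
        simpa using lipschitz_exp_clip hβ0.le y z)
    refine this.trans ?_
    have e1 : Real.exp (|t| * β) * Real.exp (|t| * β) ≤ E := by
      rw [← Real.exp_add]
      exact Real.exp_le_exp.2 (by linarith)
    have e2 : (A₂ : ℝ) ≤ A := by
      have : A₂ ≤ A := by omega
      exact_mod_cast this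
    calc |t| * (β * Real.exp (|t| * β)) * (|t| * Real.exp (|t| * β)) *
          (A₂ * Real.exp (-(P.c * (d : ℝ) ^ P.γ₁)))
        = t ^ 2 * (β * A₂ * ((Real.exp (|t| * β) * Real.exp (|t| * β)) *
            Real.exp (-(P.c * (d : ℝ) ^ P.γ₁)))) := by rw [← sq_abs t]; ring
      _ ≤ t ^ 2 * ((P.m + 1) * (A : ℝ) ^ P.ν * A * (E * Real.exp (-(P.c * (d : ℝ) ^ P.γ₁)))) := by
          gcongr
      _ = _ := by rw [Real.rpow_add_one hA0'.ne']; ring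
  have s1 : ∀ ω (u : ℝ), (∀ b B : ℕ, a ≤ b → b + B ≤ a + A → |blockSum Z b B ω| ≤ u) → |S₁ ω| ≤ u :=
    fun ω u hu => (hsub ω u hu).1
  have s2 : ∀ ω (u : ℝ), (∀ b B : ℕ, a ≤ b → b + B ≤ a + A → |blockSum Z b B ω| ≤ u) → |S₂ ω| ≤ u :=
    fun ω u hu => (hsub ω u hu).2
  have q1 := r1 D S₁ hDle i1 s1
  have q2 := r1 D' S₂ hD'le i2' s2
  have q3 := r2 S₁ i1 i1' s1
  have q4 := r2 S₂ i2 i2' s2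
  have q1' := r1 D' S₁ hD'le i1' s1
  have hmix : |(∫ ω, D (S₁ ω) ∂μ) * (∫ ω, D (S₂ ω) ∂μ) -
      (∫ ω, D' (S₁ ω) ∂μ) * ∫ ω, D' (S₂ ω) ∂μ| ≤
      t ^ 2 * (4 * (A ^ 4 * (K * P.C) ^ 2 * (E ^ 2 * e8))) := by
    have e : (∫ ω, D (S₁ ω) ∂μ) * (∫ ω, D (S₂ ω) ∂μ) -
        (∫ ω, D' (S₁ ω) ∂μ) * ∫ ω, D' (S₂ ω) ∂μ =
        (∫ ω, D (S₁ ω) ∂μ) * ((∫ ω, D (S₂ ω) ∂μ) - ∫ ω, D' (S₂ ω) ∂μ) +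
        ((∫ ω, D (S₁ ω) ∂μ) - ∫ ω, D' (S₁ ω) ∂μ) * ∫ ω, D' (S₂ ω) ∂μ := by ring
    rw [e]
    refine (abs_add_le _ _).trans ?_
    rw [abs_mul, abs_mul]
    calc _ ≤ |t| * (A ^ 2 * (K * P.C) * E) * (|t| * (2 * (A ^ 2 * (K * P.C) * E * e8))) +
          |t| * (2 * (A ^ 2 * (K * P.C) * E * e8)) * (|t| * (A ^ 2 * (K * P.C) * E)) := by gcongr
      _ = _ := by rw [← sq_abs t]; ring
  have hE2 : (A : ℝ) ^ 4 * (E ^ 2 * e8) ≤ K₄ := by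
    have := hb4 A hA0'.le
    rw [show ((A : ℝ) ^ (4 : ℝ)) = (A : ℝ) ^ 4 by norm_cast] at this
    refine le_trans ?_ this
    gcongr
    rw [hE, he8, ← Real.exp_nat_mul, ← Real.exp_add]
    apply Real.exp_le_exp.2
    have : (P.m + 1) * P.zeta w A t ≤ 1 / 64 := by
      calc (P.m + 1) * P.zeta w A t ≤ (P.m + 1) * (1 / (64 * (P.m + 1))) := by gcongr
        _ = 1 / 64 := by field_simp
    have : (P.m + 1) * x ≤ 1 / 64 * (A : ℝ) ^ P.γ₁ := by
      calc (P.m + 1) * x ≤ (P.m + 1) * (P.zeta w A t * (A : ℝ) ^ P.γ₁) := by gcongr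
        _ = (P.m + 1) * P.zeta w A t * (A : ℝ) ^ P.γ₁ := by ring
        _ ≤ _ := by gcongr
    push_cast
    linarith
  have hE3 : (A : ℝ) ^ 3 * (E * e8) ≤ K₄ := by
    refine le_trans ?_ hE2
    have : E ≤ E ^ 2 := le_self_pow₀ hE1 two_ne_zero
    have : (A : ℝ) ^ 3 ≤ (A : ℝ) ^ 4 := pow_le_pow_right₀ hA1' (by norm_num)
    gcongr
  have hE4 : (A : ℝ) ^ (P.ν + 1) * (E * Real.exp (-(P.c * (d : ℝ) ^ P.γ₁))) ≤ K₅ := by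
    refine le_trans ?_ (hb5 d (by positivity))
    have hAd' : (A : ℝ) ≤ (d : ℝ) ^ (2 : ℝ) := by
      have : (A : ℝ) ≤ (d : ℝ) ^ 2 := by exact_mod_cast hAd
      exact_mod_cast this
    rw [Real.rpow_mul (by positivity)]
    have : 0 ≤ P.ν + 1 := by linarith
    gcongr
    rw [hE, ← Real.exp_add]
    apply Real.exp_le_exp.2
    have : (P.m + 1) * x ≤ (P.m + 1) * (P.zeta w A t * (A : ℝ) ^ P.γ₁) := by gcongr
    have : 0 ≤ (P.m + 1) * (P.zeta w A t * (A : ℝ) ^ P.γ₁) := by positivity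
    linarith
  have hcov : |mgf (fun ω => S₁ ω + S₂ ω) μ t - mgf S₁ μ t * mgf S₂ μ t| ≤
      (2 * (K * P.C) * K₄ + 4 * (K * P.C) ^ 2 * K₄ + (P.m + 1) * K₅) * t ^ 2 := by
    have j1 : Integrable (fun ω => Real.exp (t * S₁ ω)) μ := h.integrable_exp t a A₁
    have j2 : Integrable (fun ω => Real.exp (t * S₂ ω)) μ := h.integrable_exp t (a + A₁ + d) A₂
    have e1 : ∫ ω, D (S₁ ω) ∂μ = mgf S₁ μ t - 1 := by
      rw [hD]; simp only [mgf]
      rw [integral_sub j1 (integrable_const _)]; simp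
    have e2 : ∫ ω, D (S₂ ω) ∂μ = mgf S₂ μ t - 1 := by
      rw [hD]; simp only [mgf]
      rw [integral_sub j2 (integrable_const _)]; simp
    have e3 : mgf (fun ω => S₁ ω + S₂ ω) μ t = ∫ ω, D (S₁ ω) * D (S₂ ω) ∂μ +
        ∫ ω, D (S₁ ω) ∂μ + ∫ ω, D (S₂ ω) ∂μ + 1 := by
      have : mgf (fun ω => S₁ ω + S₂ ω) μ t =
          ∫ ω, (D (S₁ ω) * D (S₂ ω) + D (S₁ ω) + D (S₂ ω) + 1) ∂μ := by
        simp only [mgf]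
        refine integral_congr_ae (ae_of_all _ fun ω => ?_)
        rw [hD]
        simp only [mul_add, Real.exp_add]
        ring
      have j3 : Integrable (fun ω => D (S₁ ω) * D (S₂ ω) + D (S₁ ω)) μ := i12.add i1
      have j4 : Integrable (fun ω => D (S₁ ω) * D (S₂ ω) + D (S₁ ω) + D (S₂ ω)) μ := j3.add i2
      rw [this, integral_add j4 (integrable_const _), integral_add j3 i2, integral_add i12 i1]
      simp
    have e4 : mgf (fun ω => S₁ ω + S₂ ω) μ t - mgf S₁ μ t * mgf S₂ μ t =
        ∫ ω, D (S₁ ω) * D (S₂ ω) ∂μ - (∫ ω, D (S₁ ω) ∂μ) * ∫ ω, D (S₂ ω) ∂μ := by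
      rw [e3, e1, e2]; ring
    rw [e4]
    have ht2 := sq_nonneg t
    have b3 : t ^ 2 * (2 * (A ^ 3 * (K * P.C) * E * e8)) ≤ t ^ 2 * (2 * (K * P.C) * K₄) := by
      calc t ^ 2 * (2 * (A ^ 3 * (K * P.C) * E * e8))
          = t ^ 2 * (2 * (K * P.C) * (A ^ 3 * (E * e8))) := by ring
        _ ≤ _ := by gcongr
    have b4 : t ^ 2 * (4 * (A ^ 4 * (K * P.C) ^ 2 * (E ^ 2 * e8))) ≤
        t ^ 2 * (4 * (K * P.C) ^ 2 * K₄) := by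
      calc t ^ 2 * (4 * (A ^ 4 * (K * P.C) ^ 2 * (E ^ 2 * e8)))
          = t ^ 2 * (4 * (K * P.C) ^ 2 * (A ^ 4 * (E ^ 2 * e8))) := by ring
        _ ≤ _ := by gcongr
    have b5 : t ^ 2 * ((P.m + 1) * (A : ℝ) ^ (P.ν + 1) *
        (E * Real.exp (-(P.c * (d : ℝ) ^ P.γ₁)))) ≤ t ^ 2 * ((P.m + 1) * K₅) := by
      rw [mul_assoc (P.m + 1)]
      gcongr
    have r3' := r3.trans b3
    have r4' := r4.trans b5
    have hm' := hmix.trans b4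
    rw [abs_le] at r3' r4' hm' ⊢
    constructor <;> linarith
  have g1 : 1 ≤ mgf S₁ μ t := h.one_le_mgf t _ _
  have g2 : 1 ≤ mgf S₂ μ t := h.one_le_mgf t _ _
  have g3 : 1 ≤ mgf (fun ω => S₁ ω + S₂ ω) μ t := by
    refine one_le_mgf (mS₁.add mS₂) (B := A₁ * (P.m + w ^ (1 / P.γ₂)) + A₂ * (P.m + w ^ (1 / P.γ₂)))
      (fun ω => (abs_add_le _ _).trans
      (add_le_add (h.abs_blockSum_le _ _ ω) (h.abs_blockSum_le _ _ ω))) ?_ t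
    have : ∫ ω, (S₁ ω + S₂ ω) ∂μ = 0 := by
      rw [integral_add (h.integrable_blockSum _ _) (h.integrable_blockSum _ _),
        h.integral_blockSum, h.integral_blockSum, add_zero]
    exact this
  have g4 : 1 ≤ mgf S₁ μ t * mgf S₂ μ t := one_le_mul_of_one_le_of_one_le g1 g2
  simp only [cgf]
  rw [← Real.log_mul (by linarith) (by linarith)]
  exact (abs_log_sub_log_le g3 g4).trans hcov

/-- The second-order expansion of the log-Laplace transform of blocks of bounded length, by Taylor's
formula and the third moments of the envelope. -/
lemma exists_abs_cgf_sub_le_of_le (P : Params) (A₀ : ℕ) {η : ℝ} (hη : 0 < η) : ∃ ε : ℝ, 0 < ε ∧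
    ∀ {Ω : Type*} {_ : MeasurableSpace Ω}
    {μ : Measure Ω} [IsProbabilityMeasure μ] {w : ℝ} {F : ℕ → MeasurableSpace Ω}
    {Z W : ℕ → Ω → ℝ}, IsAdmissible P μ w F Z W → ∀ (a A : ℕ) (t : ℝ),
    A ≤ A₀ → P.zeta w A t ≤ ε →
    |cgf (blockSum Z a A) μ t - t ^ 2 * Var[blockSum Z a A; μ] / 2| ≤ η * t ^ 2 * A := by
  obtain ⟨K, hK, henv⟩ := exists_envelope P
  obtain ⟨K₁, hK₁, hvar⟩ := exists_variance_le P
  have h1 := P.γ₁_pos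
  have hC := P.one_le_C
  have hm := P.m_nonneg
  set H : ℝ := (A₀ : ℝ) ^ 4 * K * Real.exp (2 * (P.m + 1) * (A₀ : ℝ) ^ P.γ₁) * P.C with hH
  have hH0 : 0 ≤ H := by positivity
  set G : ℝ := H + (K₁ * A₀ + H) ^ 2 + 1 with hG
  have hG1 : 1 ≤ G := by rw [hG]; nlinarith [sq_nonneg (K₁ * A₀ + H)]
  refine ⟨min (1 / 16) (η / G), lt_min (by norm_num) (by positivity), ?_⟩
  intro Ω _ μ _ w F Z W h a A t hA hz
  rcases Nat.eq_zero_or_pos A with rfl | hA1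
  · have e : blockSum Z a 0 = fun _ => 0 := funext fun ω => blockSum_zero Z a ω
    simp [e, cgf_const, variance_eq_integral]
  have hA1' : (1 : ℝ) ≤ A := by exact_mod_cast hA1
  have hA' : (A : ℝ) ≤ A₀ := by exact_mod_cast hA
  have hz16 := hz.trans (min_le_left _ _)
  have htz := P.abs_le_zeta h.w_nonneg hA1' t
  have ht1 : |t| ≤ 1 := by linarith
  have htη : |t| * G ≤ η := by
    have := htz.trans (hz.trans (min_le_right _ _))
    rwa [le_div_iff₀ (by positivity)] at this
  set S : Ω → ℝ := blockSum Z a A with hS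
  have mS : Measurable S := h.measurable_blockSum _ _
  set V : ℝ := Var[S; μ] with hV
  have hV0 : 0 ≤ V := variance_nonneg _ _
  have hVle : V ≤ K₁ * A₀ := ((hvar h).1 a A).trans (by gcongr)
  have hVeq : V = ∫ ω, S ω ^ 2 ∂μ :=
    variance_of_integral_eq_zero mS.aemeasurable (h.integral_blockSum a A)
  have iS := h.integrable_blockSum a A
  have iS2 : Integrable (fun ω => S ω ^ 2) μ := (h.memLp_blockSum a A 2).integrable_sq
  have iE : Integrable (fun ω => Real.exp (t * S ω)) μ := h.integrable_exp t a A
  have hM0 : ∀ ω, 0 ≤ blockMajorant W a A ω :=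
    fun ω => Finset.sum_nonneg fun _ _ => (Real.exp_pos _).le
  have hbound : |mgf S μ t - 1 - t ^ 2 * V / 2| ≤ |t| ^ 3 * H := by
    have e : mgf S μ t - 1 - t ^ 2 * V / 2 =
        ∫ ω, (Real.exp (t * S ω) - 1 - t * S ω - (t * S ω) ^ 2 / 2) ∂μ := by
      have i3 : Integrable (fun ω => (t * S ω) ^ 2 / 2) μ := by
        have := iS2.const_mul (t ^ 2 / 2)
        refine this.congr (ae_of_all _ fun ω => ?_)
        simp only; ring
      have i4 : Integrable (fun ω => Real.exp (t * S ω) - 1) μ := iE.sub (integrable_const _)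
      have i5 : Integrable (fun ω => Real.exp (t * S ω) - 1 - t * S ω) μ :=
        i4.sub (iS.const_mul t)
      rw [integral_sub i5 i3, integral_sub i4 (iS.const_mul t),
        integral_sub iE (integrable_const _), integral_const_mul, h.integral_blockSum]
      have : ∫ ω, (t * S ω) ^ 2 / 2 ∂μ = t ^ 2 * V / 2 := by
        rw [hVeq, ← integral_const_mul, ← integral_div]
        refine integral_congr_ae (ae_of_all _ fun ω => ?_)
        simp only; ring
      rw [this]
      simp [mgf]
    rw [e]
    refine abs_integral_le_integral_abs.trans ((integral_mono_of_nonneg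
      (ae_of_all _ fun ω => abs_nonneg _)
      ((h.integrable_blockMajorant a A).const_mul (|t| ^ 3 * (A ^ 3 * K *
        Real.exp (2 * (P.m + 1) * (A₀ : ℝ) ^ P.γ₁)))) (ae_of_all _ fun ω => ?_)).trans ?_)
    · obtain ⟨u, hu0, hu, hk⟩ := henv h a A t hA1 hz16 ω
      have hSu : |S ω| ≤ u := hu _ _ le_rfl le_rfl
      have hk3 := (hk 3 le_rfl).1
      have hE : Real.exp (2 * (P.m + 1) * (|t| * (A : ℝ) ^ P.ν)) ≤
          Real.exp (2 * (P.m + 1) * (A₀ : ℝ) ^ P.γ₁) := by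
        apply Real.exp_le_exp.2
        have := P.abs_mul_rpow_ν_le h.w_nonneg (by linarith : (0 : ℝ) < A) t
        have hA0 : (A : ℝ) ^ P.γ₁ ≤ (A₀ : ℝ) ^ P.γ₁ := by gcongr
        have : |t| * (A : ℝ) ^ P.ν ≤ (A₀ : ℝ) ^ P.γ₁ := by
          refine this.trans ?_
          calc P.zeta w A t * (A : ℝ) ^ P.γ₁ ≤ 1 * (A₀ : ℝ) ^ P.γ₁ := by
                gcongr; linarith
            _ = _ := one_mul _
        gcongr
      have hM0' := hM0 ω
      calc |Real.exp (t * S ω) - 1 - t * S ω - (t * S ω) ^ 2 / 2|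
          ≤ |t * S ω| ^ 3 * Real.exp |t * S ω| := abs_exp_sub_quadratic_le _
        _ = |t| ^ 3 * (|S ω| ^ 3 * Real.exp (|t| * |S ω|)) := by rw [abs_mul]; ring
        _ ≤ |t| ^ 3 * (u ^ 3 * Real.exp (2 * (|t| * u))) := by
            have : |t| * |S ω| ≤ 2 * (|t| * u) := by
              have : |t| * |S ω| ≤ |t| * u := by gcongr
              have : 0 ≤ |t| * u := by positivity
              linarith
            gcongr
        _ ≤ |t| ^ 3 * (A ^ 3 * K * Real.exp (2 * (P.m + 1) * (|t| * (A : ℝ) ^ P.ν)) *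
              blockMajorant W a A ω) := by gcongr
        _ ≤ |t| ^ 3 * (A ^ 3 * K * Real.exp (2 * (P.m + 1) * (A₀ : ℝ) ^ P.γ₁) *
              blockMajorant W a A ω) := by gcongr
        _ = _ := by ring
    · rw [integral_const_mul]
      calc _ ≤ |t| ^ 3 * (A ^ 3 * K * Real.exp (2 * (P.m + 1) * (A₀ : ℝ) ^ P.γ₁)) * (A * P.C) := by
            gcongr
            exact h.integral_blockMajorant_le a A
        _ = |t| ^ 3 * ((A : ℝ) ^ 4 * K * Real.exp (2 * (P.m + 1) * (A₀ : ℝ) ^ P.γ₁) * P.C) := by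
            ring
        _ ≤ _ := by rw [hH]; gcongr
  have g1 : 1 ≤ mgf S μ t := h.one_le_mgf t _ _
  set y : ℝ := mgf S μ t - 1 with hy
  have hy0 : 0 ≤ y := by linarith
  have ht2 : |t| ^ 2 = t ^ 2 := sq_abs t
  have ht3 : |t| ^ 3 = t ^ 2 * |t| := by rw [← ht2]; ring
  have hyle : y ≤ t ^ 2 * (K₁ * A₀ + H) := by
    have h3 := (abs_le.1 hbound).2
    have : |t| ^ 3 * H ≤ t ^ 2 * H := by
      rw [ht3]
      have : t ^ 2 * |t| ≤ t ^ 2 := mul_le_of_le_one_right (sq_nonneg t) ht1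
      gcongr
    have : t ^ 2 * V ≤ t ^ 2 * (K₁ * A₀) := by gcongr
    nlinarith [mul_nonneg (sq_nonneg t) hV0]
  have hlog1 : Real.log (1 + y) ≤ y := by
    have := Real.log_le_sub_one_of_pos (x := 1 + y) (by linarith); linarith
  have hlog2 : y - y ^ 2 ≤ Real.log (1 + y) := by
    have := Real.one_sub_inv_le_log_of_pos (x := 1 + y) (by linarith)
    have e : 1 - (1 + y)⁻¹ = y / (1 + y) := by field_simp; ring
    have : y - y ^ 2 ≤ y / (1 + y) := by
      rw [le_div_iff₀ (by linarith)]
      nlinarith [pow_nonneg hy0 3]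
    linarith
  have hy2 : y ^ 2 ≤ t ^ 2 * |t| * (K₁ * A₀ + H) ^ 2 := by
    calc y ^ 2 ≤ (t ^ 2 * (K₁ * A₀ + H)) ^ 2 := by gcongr
      _ = t ^ 2 * (|t| * |t|) * (K₁ * A₀ + H) ^ 2 := by
          rw [← sq, sq_abs]; ring
      _ ≤ t ^ 2 * (|t| * 1) * (K₁ * A₀ + H) ^ 2 := by gcongr
      _ = _ := by ring
  have hfin : t ^ 2 * (|t| * G) ≤ η * t ^ 2 * A := by
    calc t ^ 2 * (|t| * G) ≤ t ^ 2 * η := by gcongr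
      _ ≤ t ^ 2 * η * A := le_mul_of_one_le_right (by positivity) hA1'
      _ = _ := by ring
  have hexp : t ^ 2 * (|t| * G) = t ^ 2 * |t| * H + t ^ 2 * |t| * (K₁ * A₀ + H) ^ 2 +
      t ^ 2 * |t| := by rw [hG]; ring
  have hnn : 0 ≤ t ^ 2 * |t| := by positivity
  have hc : cgf S μ t = Real.log (1 + y) := by rw [cgf, hy]; congr 1; ring
  rw [hc]
  rw [ht3, abs_le] at hbound
  rw [abs_le]
  constructor <;> linarith

/-! ### The second-order expansion of the log-Laplace transform -/

/-- When a block shrinks by a factor `r`, the effective size of `t` shrinks by a power of `r`, which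
compensates a moderate increase of `t` by a factor `q`. -/
lemma Params.zeta_le_of_le (P : Params) {w A A' t t' q r : ℝ} (hw : 0 ≤ w) (hA : 0 ≤ A)
    (hA' : 0 ≤ A') (hr0 : 0 < r) (hr : r ≤ 1) (hAr : A' ≤ r * A) (ht : |t'| ≤ q * |t|) :
    P.zeta w A' t' ≤ q * r ^ (min P.κ 1) * P.zeta w A t := by
  have hκ := P.κ_pos
  have hw' := Real.rpow_nonneg hw (1 / P.γ₂ - 1)
  have e1 : A' ^ P.κ ≤ r ^ (min P.κ 1) * A ^ P.κ := by
    calc A' ^ P.κ ≤ (r * A) ^ P.κ := by gcongr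
      _ = r ^ P.κ * A ^ P.κ := Real.mul_rpow hr0.le hA
      _ ≤ _ := by
        gcongr ?_ * _
        exact Real.rpow_le_rpow_of_exponent_ge hr0 hr (min_le_left _ _)
  have e2 : A' ≤ r ^ (min P.κ 1) * A := by
    refine hAr.trans ?_
    gcongr
    calc r = r ^ (1 : ℝ) := (Real.rpow_one r).symm
      _ ≤ _ := Real.rpow_le_rpow_of_exponent_ge hr0 hr (min_le_right _ _)
  have hqt : 0 ≤ q * |t| := (abs_nonneg _).trans ht
  rw [Params.zeta, Params.zeta]
  calc |t'| * (A' ^ P.κ + A' * w ^ (1 / P.γ₂ - 1))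
      ≤ (q * |t|) * (r ^ (min P.κ 1) * A ^ P.κ + r ^ (min P.κ 1) * A * w ^ (1 / P.γ₂ - 1)) := by
        gcongr
    _ = _ := by ring

/-- The upper half of the induction step, as a statement on numbers: `g`, `g₁`, `g₂`, `gd` stand
for log-Laplace transforms of a block, of its two halves and of the gap between them. -/
lemma upper_step {g g₁ g₂ gd t V V₁ V₂ A A₁ A₂ d s E K K₁ : ℝ} (hs : 0 < s) (hs1 : s ≤ 1)
    (hK : 0 ≤ K) (hK₁ : 0 ≤ K₁)
    (hg : g ≤ 1 / (1 + s) * (g₁ + g₂ + K * ((1 + s) * t) ^ 2) + s / (1 + s) * gd)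
    (h1 : g₁ ≤ ((1 + s) * t) ^ 2 * V₁ / 2 + E * ((1 + s) * t) ^ 2 * A₁)
    (h2 : g₂ ≤ ((1 + s) * t) ^ 2 * V₂ / 2 + E * ((1 + s) * t) ^ 2 * A₂)
    (h3 : gd ≤ ((1 + 1 / s) * t) ^ 2 * ((K₁ / 2 + 2) * d))
    (hV : V₁ + V₂ ≤ V + K₁ * d) (hVA : V ≤ K₁ * A) (hAA : A₁ + A₂ ≤ A)
    (hd0 : 0 ≤ d) (hd : d ≤ 2 * s ^ 2 * A) (hsA : 1 ≤ s * A) (hE0 : 0 ≤ E) (hE2 : E ≤ 2) :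
    g ≤ t ^ 2 * V / 2 + (E + (5 * K₁ + 10 + 2 * K) * s) * t ^ 2 * A := by
  have hA0 : 0 ≤ A := (pos_of_mul_pos_right (by linarith) hs.le).le
  have e1 : g ≤ t ^ 2 * ((1 + s) * ((V₁ + V₂) / 2 + E * (A₁ + A₂) + K) +
      (1 + s) * (d / s) * (K₁ / 2 + 2)) := by
    refine hg.trans ?_
    calc 1 / (1 + s) * (g₁ + g₂ + K * ((1 + s) * t) ^ 2) + s / (1 + s) * gd
        ≤ 1 / (1 + s) * ((((1 + s) * t) ^ 2 * V₁ / 2 + E * ((1 + s) * t) ^ 2 * A₁) +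
          (((1 + s) * t) ^ 2 * V₂ / 2 + E * ((1 + s) * t) ^ 2 * A₂) + K * ((1 + s) * t) ^ 2) +
          s / (1 + s) * (((1 + 1 / s) * t) ^ 2 * ((K₁ / 2 + 2) * d)) := by gcongr
      _ = _ := by field_simp; ring
  have hds : d / s ≤ 2 * (s * A) := by
    rw [div_le_iff₀ hs]; linarith
  have hdA : d ≤ 2 * (s * A) := by
    have : s ^ 2 * A ≤ s * A := mul_le_mul_of_nonneg_right (by nlinarith) hA0
    linarith
  have hsA0 : 0 ≤ s * A := by positivity
  have hds0 : 0 ≤ d / s := by positivity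
  have b1 : (1 + s) * ((V₁ + V₂) / 2) ≤ V / 2 + s * A * (5 / 2 * K₁) := by
    calc (1 + s) * ((V₁ + V₂) / 2) ≤ (1 + s) * ((V + K₁ * d) / 2) := by gcongr
      _ = V / 2 + s * V / 2 + (1 + s) * (K₁ * d) / 2 := by ring
      _ ≤ V / 2 + s * (K₁ * A) / 2 + (1 + 1) * (K₁ * (2 * (s * A))) / 2 := by gcongr
      _ = _ := by ring
  have b2 : (1 + s) * (E * (A₁ + A₂)) ≤ E * A + s * A * 2 := by
    calc (1 + s) * (E * (A₁ + A₂)) ≤ (1 + s) * (E * A) := by gcongr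
      _ = E * A + s * A * E := by ring
      _ ≤ _ := by gcongr
  have b3 : (1 + s) * K ≤ s * A * (2 * K) := by
    calc (1 + s) * K ≤ 1 * (2 * K) := by linarith [mul_le_mul_of_nonneg_right hs1 hK]
      _ ≤ _ := by gcongr
  have b4 : (1 + s) * (d / s) * (K₁ / 2 + 2) ≤ s * A * (2 * K₁ + 8) := by
    calc (1 + s) * (d / s) * (K₁ / 2 + 2) ≤ (1 + 1) * (2 * (s * A)) * (K₁ / 2 + 2) := by gcongr
      _ = _ := by ring
  calc g ≤ t ^ 2 * ((1 + s) * ((V₁ + V₂) / 2 + E * (A₁ + A₂) + K) +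
        (1 + s) * (d / s) * (K₁ / 2 + 2)) := e1
    _ ≤ t ^ 2 * (V / 2 + (E + (5 * K₁ + 10 + 2 * K) * s) * A) := by
        refine mul_le_mul_of_nonneg_left ?_ (sq_nonneg t)
        linarith [mul_nonneg hsA0 hK₁]
    _ = _ := by ring

/-- The lower half of the induction step. -/
lemma lower_step {g g₁ g₂ gd t V V₁ V₂ A A₁ A₂ d s E K K₁ : ℝ} (hs : 0 < s) (hs1 : s ≤ 1)
    (hK : 0 ≤ K) (hK₁ : 0 ≤ K₁)
    (hg : (1 + s) * (g₁ + g₂ - K * (t / (1 + s)) ^ 2) - s * gd ≤ g)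
    (h1 : (t / (1 + s)) ^ 2 * V₁ / 2 - E * (t / (1 + s)) ^ 2 * A₁ ≤ g₁)
    (h2 : (t / (1 + s)) ^ 2 * V₂ / 2 - E * (t / (1 + s)) ^ 2 * A₂ ≤ g₂)
    (h3 : gd ≤ (t / s) ^ 2 * ((K₁ / 2 + 2) * d)) (hV0 : 0 ≤ V₁ + V₂)
    (hV : V ≤ V₁ + V₂ + K₁ * d) (hV' : V₁ + V₂ ≤ V + K₁ * d)
    (hVA : V ≤ K₁ * A) (hAA : A₁ + A₂ ≤ A)
    (hd0 : 0 ≤ d) (hd : d ≤ 2 * s ^ 2 * A) (hsA : 1 ≤ s * A) (hE0 : 0 ≤ E) :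
    t ^ 2 * V / 2 - (E + (5 * K₁ + 10 + 2 * K) * s) * t ^ 2 * A ≤ g := by
  have hA0 : 0 ≤ A := (pos_of_mul_pos_right (by linarith) hs.le).le
  have e1 : t ^ 2 * (1 / (1 + s) * ((V₁ + V₂) / 2 - E * (A₁ + A₂) - K) -
      d / s * (K₁ / 2 + 2)) ≤ g := by
    refine le_trans ?_ hg
    calc _ = (1 + s) * (((t / (1 + s)) ^ 2 * V₁ / 2 - E * (t / (1 + s)) ^ 2 * A₁) +
          ((t / (1 + s)) ^ 2 * V₂ / 2 - E * (t / (1 + s)) ^ 2 * A₂) - K * (t / (1 + s)) ^ 2) -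
          s * ((t / s) ^ 2 * ((K₁ / 2 + 2) * d)) := by field_simp; ring
      _ ≤ _ := by gcongr
  have hds : d / s ≤ 2 * (s * A) := by
    rw [div_le_iff₀ hs]; linarith
  have hdA : d ≤ 2 * (s * A) := by
    have : s ^ 2 * A ≤ s * A := mul_le_mul_of_nonneg_right (by nlinarith) hA0
    linarith
  have hsA0 : 0 ≤ s * A := by positivity
  have hinv : 1 - s ≤ 1 / (1 + s) := by
    rw [le_div_iff₀ (by linarith)]; nlinarith
  have hinv1 : 1 / (1 + s) ≤ 1 := by
    rw [div_le_one (by linarith)]; linarith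
  have b1 : V / 2 - s * A * (5 / 2 * K₁) ≤ 1 / (1 + s) * ((V₁ + V₂) / 2) := by
    have c1 : K₁ * d ≤ K₁ * (2 * (s * A)) := by gcongr
    have c2 : s * (V₁ + V₂) ≤ s * (K₁ * A + K₁ * d) :=
      mul_le_mul_of_nonneg_left (by linarith) hs.le
    have c3 : s * (K₁ * d) ≤ 1 * (K₁ * d) := by gcongr
    have c4 : s * (K₁ * A) = s * A * K₁ := by ring
    calc V / 2 - s * A * (5 / 2 * K₁) ≤ (1 - s) * ((V₁ + V₂) / 2) := by linarith
      _ ≤ _ := by gcongr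
  have b2 : 1 / (1 + s) * (E * (A₁ + A₂)) ≤ E * A := by
    calc 1 / (1 + s) * (E * (A₁ + A₂)) ≤ 1 / (1 + s) * (E * A) := by gcongr
      _ ≤ 1 * (E * A) := by gcongr
      _ = _ := one_mul _
  have b3 : 1 / (1 + s) * K ≤ s * A * (2 * K) := by
    calc 1 / (1 + s) * K ≤ 1 * K := by gcongr
      _ ≤ s * A * K := by gcongr
      _ ≤ _ := mul_le_mul_of_nonneg_left (by linarith) hsA0
  have b4 : d / s * (K₁ / 2 + 2) ≤ s * A * (2 * K₁ + 8) := by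
    calc d / s * (K₁ / 2 + 2) ≤ 2 * (s * A) * (K₁ / 2 + 2) := by gcongr
      _ ≤ _ := by linarith [mul_nonneg hsA0 hK₁]
  calc t ^ 2 * V / 2 - (E + (5 * K₁ + 10 + 2 * K) * s) * t ^ 2 * A
      = t ^ 2 * (V / 2 - (E + (5 * K₁ + 10 + 2 * K) * s) * A) := by ring
    _ ≤ t ^ 2 * (1 / (1 + s) * ((V₁ + V₂) / 2 - E * (A₁ + A₂) - K) -
        d / s * (K₁ / 2 + 2)) := by
        refine mul_le_mul_of_nonneg_left ?_ (sq_nonneg t)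
        linarith [mul_nonneg hsA0 hK₁]
    _ ≤ g := e1

section
variable {P : Params} {Ω : Type*} {mΩ : MeasurableSpace Ω} {μ : Measure Ω} [IsProbabilityMeasure μ]
  {w : ℝ} {F : ℕ → MeasurableSpace Ω} {Z W : ℕ → Ω → ℝ}

/-- Removing a gap of length `d` from a block: the upper bound. -/
lemma IsAdmissible.cgf_le (h : IsAdmissible P μ w F Z W) (a A₁ d A₂ : ℕ) {s : ℝ} (hs : 0 < s)
    (t : ℝ) :
    cgf (blockSum Z a (A₁ + d + A₂)) μ t ≤
      1 / (1 + s) * cgf (fun ω => blockSum Z a A₁ ω + blockSum Z (a + A₁ + d) A₂ ω) μ ((1 + s) * t)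
        + s / (1 + s) * cgf (blockSum Z (a + A₁) d) μ ((1 + 1 / s) * t) := by
  have hb : ∀ a' A', A' ≤ A₁ + d + A₂ → ∀ ω, |blockSum Z a' A' ω| ≤
      (A₁ + d + A₂ : ℕ) * (P.m + w ^ (1 / P.γ₂)) := fun a' A' hA ω => by
    refine (h.abs_blockSum_le a' A' ω).trans ?_
    have := Real.rpow_nonneg h.w_nonneg (1 / P.γ₂)
    have := P.m_nonneg
    gcongr
  have e : blockSum Z a (A₁ + d + A₂) = fun ω =>
      (fun ω => blockSum Z a A₁ ω + blockSum Z (a + A₁ + d) A₂ ω) ω + blockSum Z (a + A₁) d ω := by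
    funext ω
    rw [blockSum_add, blockSum_add, add_assoc a A₁ d]; ring
  rw [e]
  refine cgf_add_le ((h.measurable_blockSum _ _).add (h.measurable_blockSum _ _))
    (h.measurable_blockSum _ _) (B := 2 * ((A₁ + d + A₂ : ℕ) * (P.m + w ^ (1 / P.γ₂)))) ?_ ?_ hs t
  · intro ω
    refine (abs_add_le _ _).trans ?_
    linarith [hb a A₁ (by omega) ω, hb (a + A₁ + d) A₂ (by omega) ω]
  · intro ω
    have := hb (a + A₁) d (by omega) ω
    linarith [abs_nonneg (blockSum Z (a + A₁) d ω)]

/-- Removing a gap of length `d` from a block: the lower bound, which is Hölder's inequality for the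
two remaining pieces, written as the whole block minus the gap. -/
lemma IsAdmissible.le_cgf (h : IsAdmissible P μ w F Z W) (a A₁ d A₂ : ℕ) {s : ℝ} (hs : 0 < s)
    (t : ℝ) :
    (1 + s) * cgf (fun ω => blockSum Z a A₁ ω + blockSum Z (a + A₁ + d) A₂ ω) μ (t / (1 + s))
        - s * cgf (blockSum Z (a + A₁) d) μ (-(t / s)) ≤ cgf (blockSum Z a (A₁ + d + A₂)) μ t := by
  have hb : ∀ a' A', A' ≤ A₁ + d + A₂ → ∀ ω, |blockSum Z a' A' ω| ≤
      (A₁ + d + A₂ : ℕ) * (P.m + w ^ (1 / P.γ₂)) := fun a' A' hA ω => by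
    refine (h.abs_blockSum_le a' A' ω).trans ?_
    have := Real.rpow_nonneg h.w_nonneg (1 / P.γ₂)
    have := P.m_nonneg
    gcongr
  have e : (fun ω => blockSum Z a A₁ ω + blockSum Z (a + A₁ + d) A₂ ω) = fun ω =>
      blockSum Z a (A₁ + d + A₂) ω + (-blockSum Z (a + A₁) d) ω := by
    funext ω
    rw [blockSum_add, blockSum_add, add_assoc a A₁ d, Pi.neg_apply]; ring
  have key := cgf_add_le (μ := μ) (h.measurable_blockSum a (A₁ + d + A₂))
    (h.measurable_blockSum (a + A₁) d).neg (hb a _ le_rfl)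
    (fun ω => by rw [Pi.neg_apply, abs_neg]; exact hb (a + A₁) d (by omega) ω) hs (t / (1 + s))
  rw [← e, cgf_neg] at key
  have e1 : (1 + s) * (t / (1 + s)) = t := by field_simp
  have e2 : -((1 + 1 / s) * (t / (1 + s))) = -(t / s) := by field_simp; ring
  rw [e1, e2] at key
  have := mul_le_mul_of_nonneg_left key (by linarith : 0 ≤ 1 + s)
  have e3 : ∀ x y : ℝ, (1 + s) * (1 / (1 + s) * x + s / (1 + s) * y) = x + s * y := by
    intro x y; field_simp
  rw [e3] at this
  linarith

end

/-- A gap of relative length `θ = s ^ M` is long enough for the decoupling of the two halves when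
`ρ` is small: the exponent `ρ * M * g` costs at most a square root of `ζ`. -/
lemma gap_condition {c m ζ s θ ρ M g : ℝ} (hc : 0 < c) (hm : 0 ≤ m) (hζ0 : 0 ≤ ζ) (hζ1 : ζ ≤ 1)
    (hζc : ζ ≤ (c / (32 * (m + 1))) ^ 2) (hs : 0 < s) (hζs : ζ ^ ρ ≤ s) (hθ : θ = s ^ M)
    (hM : 0 < M) (hg : 0 < g) (hρ : ρ * (M * g) ≤ 1 / 2) (hρ0 : 0 < ρ) :
    32 * (m + 1) * ζ ≤ c * θ ^ g := by
  have e1 : ζ ^ (1 / 2 : ℝ) ≤ θ ^ g := by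
    have h1 : (ζ ^ ρ) ^ (M * g) ≤ θ ^ g := by
      rw [hθ, ← Real.rpow_mul hs.le]
      exact Real.rpow_le_rpow (Real.rpow_nonneg hζ0 ρ) hζs (by positivity)
    refine le_trans ?_ h1
    rw [← Real.rpow_mul hζ0]
    rcases hζ0.eq_or_lt with h0 | h0
    · rw [← h0, Real.zero_rpow (by norm_num), Real.zero_rpow (by positivity)]
    · exact Real.rpow_le_rpow_of_exponent_ge h0 hζ1 hρ
  have e2 : ζ ^ (1 / 2 : ℝ) ≤ c / (32 * (m + 1)) := by
    calc ζ ^ (1 / 2 : ℝ) ≤ ((c / (32 * (m + 1))) ^ 2) ^ (1 / 2 : ℝ) :=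
          Real.rpow_le_rpow hζ0 hζc (by norm_num)
      _ = _ := by
          rw [← Real.rpow_natCast, ← Real.rpow_mul (by positivity)]; norm_num
  have e3 : ζ ^ (1 / 2 : ℝ) * ζ ^ (1 / 2 : ℝ) = ζ := by
    rw [← Real.rpow_add_of_nonneg hζ0 (by norm_num) (by norm_num)]; norm_num
  have hpos : 0 ≤ ζ ^ (1 / 2 : ℝ) := Real.rpow_nonneg hζ0 _
  calc 32 * (m + 1) * ζ = 32 * (m + 1) * (ζ ^ (1 / 2 : ℝ) * ζ ^ (1 / 2 : ℝ)) := by rw [e3]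
    _ ≤ 32 * (m + 1) * (c / (32 * (m + 1)) * θ ^ g) := by gcongr
    _ = _ := by field_simp

set_option maxHeartbeats 1000000 in
/-- The log-Laplace transform of a block is asymptotic to half the variance times `t ^ 2`,
uniformly over all blocks for which `P.zeta w A t` is small. By strong induction on the length:
a block is cut into two halves, separated by a gap of small relative length `s ^ M`. Hölder's
inequality with exponent `1 + s` removes the gap, and the two halves are decoupled. Both terms of
`s = A ^ (-ρ) + ζ ^ ρ` vary geometrically along the dyadic scales, so the errors are summable. -/
theorem exists_abs_cgf_sub_le_two_mul (P : Params) {η' : ℝ} (hη'0 : 0 < η') (hη'1 : η' ≤ 1 / 2) :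
    ∃ ε : ℝ, 0 < ε ∧
    ∀ {Ω : Type*} {_ : MeasurableSpace Ω}
    {μ : Measure Ω} [IsProbabilityMeasure μ] {w : ℝ} {F : ℕ → MeasurableSpace Ω}
    {Z W : ℕ → Ω → ℝ}, IsAdmissible P μ w F Z W → ∀ (a A : ℕ) (t : ℝ), P.zeta w A t ≤ ε →
    |cgf (blockSum Z a A) μ t - t ^ 2 * Var[blockSum Z a A; μ] / 2| ≤ 2 * η' * t ^ 2 * A := by
  obtain ⟨K, ε₁, hK, hε₁, hcgf⟩ := exists_abs_cgf_add_sub_le P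
  obtain ⟨K₁, hK₁, hvar⟩ := exists_variance_le P
  have hκ := P.κ_pos
  have hc := P.c_pos
  have hm := P.m_nonneg
  have hγ₁ := P.γ₁_pos
  obtain ⟨κ₀, hκ₀⟩ : ∃ κ₀, κ₀ = min P.κ 1 := ⟨_, rfl⟩
  have hκ₀0 : 0 < κ₀ := by rw [hκ₀]; exact lt_min hκ one_pos
  have hκ₀1 : κ₀ ≤ 1 := by rw [hκ₀]; exact min_le_right _ _
  obtain ⟨M, hM⟩ : ∃ M, M = 2 / κ₀ := ⟨_, rfl⟩
  have hMκ : M * κ₀ = 2 := by rw [hM]; field_simp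
  have hM2 : 2 ≤ M := by rw [hM, le_div_iff₀ hκ₀0]; linarith
  have hM0 : 0 < M := by linarith
  obtain ⟨ρ, hρ⟩ : ∃ ρ, ρ = min (1 / (2 * M)) (1 / (2 * M * P.γ₁)) := ⟨_, rfl⟩
  have hρ0 : 0 < ρ := by rw [hρ]; exact lt_min (by positivity) (by positivity)
  have hρM : ρ * M ≤ 1 / 2 := by
    calc ρ * M ≤ 1 / (2 * M) * M := by gcongr; rw [hρ]; exact min_le_left _ _
      _ = 1 / 2 := by field_simp
  have hρMγ : ρ * (M * P.γ₁) ≤ 1 / 2 := by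
    calc ρ * (M * P.γ₁) ≤ 1 / (2 * M * P.γ₁) * (M * P.γ₁) := by
          gcongr; rw [hρ]; exact min_le_right _ _
      _ = 1 / 2 := by field_simp
  have hρ1 : ρ ≤ 1 / 2 := by nlinarith
  -- From one dyadic scale to the next, the term `ζ ^ ρ` contracts by `q ^ ρ`, and `A ^ (-ρ)` expands
  -- by `2 ^ ρ`.
  obtain ⟨q, hq⟩ : ∃ q : ℝ, q = 2 ^ (-(κ₀ / 2)) := ⟨_, rfl⟩
  have hq0 : 0 < q := by rw [hq]; positivity
  have hq1 : q < 1 := by rw [hq]; exact Real.rpow_lt_one_of_one_lt_of_neg (by norm_num) (by linarith)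
  have hqρ : q ^ ρ < 1 := Real.rpow_lt_one hq0.le hq1 hρ0
  have h2ρ : 1 < (2 : ℝ) ^ ρ := Real.one_lt_rpow (by norm_num) hρ0
  obtain ⟨G, hG⟩ : ∃ G, G = 5 * K₁ + 10 + 2 * K := ⟨_, rfl⟩
  have hG0 : 0 < G := by rw [hG]; positivity
  obtain ⟨B, hB⟩ : ∃ B, B = G / min ((2 : ℝ) ^ ρ - 1) (1 - q ^ ρ) := ⟨_, rfl⟩
  have hmin0 : 0 < min ((2 : ℝ) ^ ρ - 1) (1 - q ^ ρ) := lt_min (by linarith) (by linarith)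
  have hB0 : 0 < B := by rw [hB]; positivity
  have hBG : B * min ((2 : ℝ) ^ ρ - 1) (1 - q ^ ρ) = G := by rw [hB]; field_simp
  have hB1 : G ≤ B * ((2 : ℝ) ^ ρ - 1) := by
    rw [← hBG]; exact mul_le_mul_of_nonneg_left (min_le_left _ _) hB0.le
  have hB2 : G ≤ B * (1 - q ^ ρ) := by
    rw [← hBG]; exact mul_le_mul_of_nonneg_left (min_le_right _ _) hB0.le
  obtain ⟨s₀, hs₀⟩ : ∃ s₀ : ℝ, s₀ = min (1 / 8) (2 ^ (κ₀ / 2) - 1) := ⟨_, rfl⟩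
  have hs₀0 : 0 < s₀ := by
    rw [hs₀]
    exact lt_min (by norm_num) (sub_pos.2 (Real.one_lt_rpow (by norm_num) (by positivity)))
  have hs₀8 : s₀ ≤ 1 / 8 := by rw [hs₀]; exact min_le_left _ _
  have hs₀q : 1 + s₀ ≤ 2 ^ (κ₀ / 2) := by
    have : s₀ ≤ 2 ^ (κ₀ / 2) - 1 := by rw [hs₀]; exact min_le_right _ _
    linarith
  -- Blocks shorter than `A₀` are covered by the Taylor expansion.
  have htend : Tendsto (fun n : ℕ => ((n : ℝ)) ^ (-ρ)) atTop (𝓝 0) :=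
    (tendsto_rpow_neg_atTop hρ0).comp tendsto_natCast_atTop_atTop
  obtain ⟨r₀, hr₀⟩ : ∃ r₀ : ℝ, r₀ = min (s₀ / 2) (η' / (2 * B * 2 ^ ρ)) := ⟨_, rfl⟩
  have hr₀0 : 0 < r₀ := by rw [hr₀]; exact lt_min (by positivity) (by positivity)
  obtain ⟨A₁, hA₁⟩ := eventually_atTop.1 (htend.eventually (gt_mem_nhds hr₀0))
  obtain ⟨A₀, hA₀⟩ : ∃ A₀, A₀ = max A₁ 1 := ⟨_, rfl⟩
  have hA₀1 : 1 ≤ A₀ := by rw [hA₀]; exact le_max_right _ _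
  have hlarge : ∀ A : ℕ, A₀ ≤ A → (A : ℝ) ^ (-ρ) ≤ s₀ / 2 ∧ B * 2 ^ ρ * (A : ℝ) ^ (-ρ) ≤ η' / 2 := by
    intro A hA
    have h1 := (hA₁ A (le_trans (by rw [hA₀]; exact le_max_left _ _) hA)).le
    refine ⟨h1.trans (by rw [hr₀]; exact min_le_left _ _), ?_⟩
    have h2 : (A : ℝ) ^ (-ρ) ≤ η' / (2 * B * 2 ^ ρ) := h1.trans (by rw [hr₀]; exact min_le_right _ _)
    calc B * 2 ^ ρ * (A : ℝ) ^ (-ρ) ≤ B * 2 ^ ρ * (η' / (2 * B * 2 ^ ρ)) := by gcongr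
      _ = η' / 2 := by field_simp
  obtain ⟨ε₂, hε₂, hbase⟩ := exists_abs_cgf_sub_le_of_le P A₀ (half_pos hη'0)
  obtain ⟨ε, hε⟩ : ∃ ε : ℝ, ε = min (min (ε₁ / 2) ε₂) (min (min 1 ((P.c / (32 * (P.m + 1))) ^ 2))
    ((min (s₀ / 2) (η' / B)) ^ (1 / ρ))) := ⟨_, rfl⟩
  have hmin1 : 0 < min (s₀ / 2) (η' / B) := lt_min (by positivity) (by positivity)
  have hε0 : 0 < ε := by
    rw [hε]
    exact lt_min (lt_min (by positivity) hε₂) (lt_min (lt_min one_pos (by positivity))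
      (Real.rpow_pos_of_pos hmin1 _))
  have hεε₁ : ε ≤ ε₁ / 2 := by rw [hε]; exact (min_le_left _ _).trans (min_le_left _ _)
  have hεε₂ : ε ≤ ε₂ := by rw [hε]; exact (min_le_left _ _).trans (min_le_right _ _)
  have hε1 : ε ≤ 1 := by
    rw [hε]; exact (min_le_right _ _).trans ((min_le_left _ _).trans (min_le_left _ _))
  have hεc : ε ≤ (P.c / (32 * (P.m + 1))) ^ 2 := by
    rw [hε]; exact (min_le_right _ _).trans ((min_le_left _ _).trans (min_le_right _ _))
  have hερ : ε ^ ρ ≤ min (s₀ / 2) (η' / B) := by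
    have : ε ≤ (min (s₀ / 2) (η' / B)) ^ (1 / ρ) := by
      rw [hε]; exact (min_le_right _ _).trans (min_le_right _ _)
    calc ε ^ ρ ≤ ((min (s₀ / 2) (η' / B)) ^ (1 / ρ)) ^ ρ := by gcongr
      _ = _ := by rw [← Real.rpow_mul hmin1.le]; field_simp; exact Real.rpow_one _
  refine ⟨ε, hε0, ?_⟩
  intro Ω _ μ _ w F Z W h
  have hw := h.w_nonneg
  -- The induction hypothesis is an error bound `pot` which increases, from a half block to the
  -- block, by at least the error `G * s` of one step, and which stays bounded by `2 * η'`.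
  obtain ⟨pot, hpot⟩ : ∃ pot : ℕ → ℝ → ℝ, pot = fun A ζ =>
    if A < A₀ then η' / 2 else η' - B * (A : ℝ) ^ (-ρ) + B * ζ ^ ρ := ⟨_, rfl⟩
  have hpot2 : ∀ (A : ℕ) (ζ : ℝ), 0 ≤ ζ → ζ ≤ ε → pot A ζ ≤ 2 * η' := by
    intro A ζ hζ0 hζ
    rw [hpot]
    simp only
    split_ifs
    · linarith
    · have : B * ζ ^ ρ ≤ B * (η' / B) := by
        gcongr
        exact (Real.rpow_le_rpow hζ0 hζ hρ0.le).trans (hερ.trans (min_le_right _ _))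
      have e : B * (η' / B) = η' := by field_simp
      have : 0 ≤ B * (A : ℝ) ^ (-ρ) := by positivity
      linarith
  suffices H : ∀ (A a : ℕ) (t : ℝ), P.zeta w A t ≤ ε →
      |cgf (blockSum Z a A) μ t - t ^ 2 * Var[blockSum Z a A; μ] / 2| ≤
        pot A (P.zeta w A t) * t ^ 2 * A by
    intro a A t hz
    refine (H A a t hz).trans ?_
    gcongr
    exact hpot2 A _ (P.zeta_nonneg hw (Nat.cast_nonneg A) t) hz
  intro A
  induction A using Nat.strong_induction_on with
  | _ A ih =>
  intro a t hz
  rcases lt_or_ge A A₀ with hlt | hge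
  · have e : pot A (P.zeta w A t) = η' / 2 := by rw [hpot]; simp [hlt]
    rw [e]
    exact hbase h a A t hlt.le (hz.trans hεε₂)
  obtain ⟨ζ, hζdef⟩ : ∃ ζ, ζ = P.zeta w A t := ⟨_, rfl⟩
  rw [← hζdef] at hz ⊢
  have hA1 : 1 ≤ A := hA₀1.trans hge
  have hA1' : (1 : ℝ) ≤ A := by exact_mod_cast hA1
  have hA0' : (0 : ℝ) < A := by linarith
  have hζ0 : 0 ≤ ζ := by rw [hζdef]; exact P.zeta_nonneg hw hA0'.le t
  have hζ1 : ζ ≤ 1 := hz.trans hε1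
  obtain ⟨hAs, hAη⟩ := hlarge A hge
  have hζρ0 : 0 ≤ ζ ^ ρ := Real.rpow_nonneg hζ0 ρ
  have hζs : ζ ^ ρ ≤ s₀ / 2 :=
    (Real.rpow_le_rpow hζ0 hz hρ0.le).trans (hερ.trans (min_le_left _ _))
  obtain ⟨s, hs⟩ : ∃ s, s = (A : ℝ) ^ (-ρ) + ζ ^ ρ := ⟨_, rfl⟩
  have hAρ0 : 0 < (A : ℝ) ^ (-ρ) := Real.rpow_pos_of_pos hA0' _
  have hs0 : 0 < s := by rw [hs]; linarith
  have hss₀ : s ≤ s₀ := by rw [hs]; linarith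
  have hs8 : s ≤ 1 / 8 := hss₀.trans hs₀8
  have hs1 : s ≤ 1 := by linarith
  have hs64 : s ^ 2 ≤ 1 / 64 := by
    calc s ^ 2 ≤ (1 / 8) ^ 2 := by gcongr
      _ = 1 / 64 := by norm_num
  have hζs' : ζ ^ ρ ≤ s := by rw [hs]; linarith
  -- the relative length of the gap
  obtain ⟨θ, hθ⟩ : ∃ θ, θ = s ^ M := ⟨_, rfl⟩
  have hθ0 : 0 < θ := by rw [hθ]; exact Real.rpow_pos_of_pos hs0 M
  have hθs : θ ≤ s ^ 2 := by
    rw [hθ]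
    have := Real.rpow_le_rpow_of_exponent_ge hs0 hs1 hM2
    exact_mod_cast this
  have hθA : (A : ℝ) ^ (1 / 2 : ℝ) ≤ θ * A := by
    have e1 : ((A : ℝ) ^ (-ρ)) ^ M ≤ θ := by
      rw [hθ]
      exact Real.rpow_le_rpow hAρ0.le (by rw [hs]; linarith) hM0.le
    have e2 : (A : ℝ) ^ (-(1 / 2 : ℝ)) ≤ ((A : ℝ) ^ (-ρ)) ^ M := by
      rw [← Real.rpow_mul hA0'.le]
      exact Real.rpow_le_rpow_of_exponent_le hA1' (by linarith)
    calc (A : ℝ) ^ (1 / 2 : ℝ) = (A : ℝ) ^ (-(1 / 2 : ℝ)) * A := by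
          rw [← Real.rpow_add_one hA0'.ne']; norm_num
      _ ≤ θ * A := by gcongr; exact e2.trans e1
  have hA12 : 1 ≤ (A : ℝ) ^ (1 / 2 : ℝ) := Real.one_le_rpow hA1' (by norm_num)
  obtain ⟨d, hd⟩ : ∃ d : ℕ, d = ⌈θ * A⌉₊ := ⟨_, rfl⟩
  have hdge : θ * A ≤ d := by rw [hd]; exact Nat.le_ceil _
  have hdle : (d : ℝ) ≤ 2 * θ * A := by
    have : (d : ℝ) < θ * A + 1 := by rw [hd]; exact Nat.ceil_lt_add_one (by positivity)
    linarith
  have hd1' : (1 : ℝ) ≤ d := by linarith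
  have hd1 : 1 ≤ d := by exact_mod_cast hd1'
  have hd2 : A ≤ d ^ 2 := by
    have e : ((A : ℝ) ^ (1 / 2 : ℝ)) ^ 2 = A := by
      rw [← Real.rpow_natCast, ← Real.rpow_mul hA0'.le]; norm_num
    have : (A : ℝ) ≤ (d : ℝ) ^ 2 := by
      rw [← e]; gcongr; linarith
    exact_mod_cast this
  have hdsA : (d : ℝ) ≤ 2 * s ^ 2 * A := hdle.trans (by gcongr)
  have hdA : (d : ℝ) ≤ A := by
    have : 2 * s ^ 2 ≤ 1 := by linarith
    calc (d : ℝ) ≤ 2 * s ^ 2 * A := hdsA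
      _ ≤ 1 * A := by gcongr
      _ = A := one_mul _
  have hdA' : d < A := by
    have : (d : ℝ) < A := by
      have : 2 * s ^ 2 < 1 := by linarith
      calc (d : ℝ) ≤ 2 * s ^ 2 * A := hdsA
        _ < 1 * A := by gcongr
        _ = A := one_mul _
    exact_mod_cast this
  have hsA : 1 ≤ s * A := by
    have e1 : (A : ℝ) ^ (-ρ) * A = (A : ℝ) ^ (1 - ρ) := by
      rw [← Real.rpow_add_one hA0'.ne']; ring_nf
    have e2 : 1 ≤ (A : ℝ) ^ (1 - ρ) := Real.one_le_rpow hA1' (by linarith)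
    calc 1 ≤ (A : ℝ) ^ (-ρ) * A := by rw [e1]; exact e2
      _ ≤ s * A := by gcongr; rw [hs]; linarith
  -- the two halves
  obtain ⟨B₁, hB₁⟩ : ∃ B₁, B₁ = (A - d) / 2 := ⟨_, rfl⟩
  obtain ⟨B₂, hB₂⟩ : ∃ B₂, B₂ = A - d - B₁ := ⟨_, rfl⟩
  have hsum : B₁ + d + B₂ = A := by omega
  have hsum' : (B₁ : ℝ) + d + B₂ = A := by exact_mod_cast hsum
  have hB₁h : (B₁ : ℝ) ≤ 1 / 2 * A := by
    have : 2 * B₁ ≤ A := by omega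
    have : 2 * (B₁ : ℝ) ≤ A := by exact_mod_cast this
    linarith
  have hB₂h : (B₂ : ℝ) ≤ 1 / 2 * A := by
    have : 2 * B₂ ≤ A := by omega
    have : 2 * (B₂ : ℝ) ≤ A := by exact_mod_cast this
    linarith
  -- Hölder's inequality changes `t` by a factor `1 + s` on the halves, and by the large factor
  -- `1 + 1 / s` on the gap, which is harmless because the gap is short.
  have hzhalf : ∀ (A' : ℕ) (t' : ℝ), (A' : ℝ) ≤ 1 / 2 * A → |t'| ≤ (1 + s) * |t| →
      P.zeta w A' t' ≤ q * ζ := by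
    intro A' t' hA' ht'
    have := P.zeta_le_of_le hw hA0'.le (Nat.cast_nonneg A') (by norm_num) (by norm_num) hA' ht'
    rw [← hζdef, ← hκ₀] at this
    refine this.trans ?_
    gcongr
    have e : q = 2 ^ (κ₀ / 2) * (1 / 2 : ℝ) ^ κ₀ := by
      rw [hq, one_div, Real.inv_rpow (by norm_num), ← Real.rpow_neg (by norm_num),
        ← Real.rpow_add (by norm_num)]
      congr 1; ring
    rw [e]
    gcongr
    linarith
  have hzgap : ∀ t' : ℝ, |t'| ≤ (1 + 1 / s) * |t| → P.zeta w d t' ≤ ζ := by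
    intro t' ht'
    have hr1 : 2 * θ ≤ 1 := by linarith
    have := P.zeta_le_of_le hw hA0'.le (Nat.cast_nonneg d) (by positivity) hr1 hdle ht'
    rw [← hζdef, ← hκ₀] at this
    refine this.trans (mul_le_of_le_one_left hζ0 ?_)
    have e1 : (2 * θ) ^ κ₀ = 2 ^ κ₀ * s ^ 2 := by
      rw [Real.mul_rpow (by norm_num) hθ0.le, hθ, ← Real.rpow_mul hs0.le, hMκ]
      norm_cast
    have e2 : (2 : ℝ) ^ κ₀ ≤ 2 := by
      calc (2 : ℝ) ^ κ₀ ≤ 2 ^ (1 : ℝ) := Real.rpow_le_rpow_of_exponent_le (by norm_num) hκ₀1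
        _ = 2 := Real.rpow_one 2
    rw [e1]
    calc (1 + 1 / s) * (2 ^ κ₀ * s ^ 2) ≤ (1 + 1 / s) * (2 * s ^ 2) := by gcongr
      _ = 2 * s ^ 2 + 2 * s := by field_simp
      _ ≤ 1 := by linarith
  -- the gap is long enough for the decoupling of the halves
  have hgapc : ∀ t' : ℝ, |t'| ≤ (1 + s) * |t| →
      P.zeta w A t' ≤ 2 * ζ ∧ P.zeta w A t' ≤ ε₁ ∧
      16 * (P.m + 1) * (P.zeta w A t' * (A : ℝ) ^ P.γ₁) ≤ P.c * (d : ℝ) ^ P.γ₁ := by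
    intro t' ht'
    have e0 : P.zeta w A t' ≤ 2 * ζ := by
      have := P.zeta_le_of_le hw hA0'.le hA0'.le one_pos le_rfl (one_mul (A : ℝ)).ge ht'
      rw [← hζdef, Real.one_rpow, mul_one] at this
      refine this.trans ?_
      gcongr; linarith
    refine ⟨e0, by linarith, ?_⟩
    have e4 := gap_condition hc hm hζ0 hζ1 (hz.trans hεc) hs0 hζs' hθ hM0 hγ₁ hρMγ hρ0
    calc 16 * (P.m + 1) * (P.zeta w A t' * (A : ℝ) ^ P.γ₁)
        ≤ 16 * (P.m + 1) * (2 * ζ * (A : ℝ) ^ P.γ₁) := by gcongr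
      _ = 32 * (P.m + 1) * ζ * (A : ℝ) ^ P.γ₁ := by ring
      _ ≤ P.c * θ ^ P.γ₁ * (A : ℝ) ^ P.γ₁ := by gcongr
      _ = P.c * (θ * A) ^ P.γ₁ := by rw [Real.mul_rpow hθ0.le hA0'.le]; ring
      _ ≤ P.c * (d : ℝ) ^ P.γ₁ := by gcongr
  -- the potential on the halves
  obtain ⟨E, hE⟩ : ∃ E, E = η' - B * 2 ^ ρ * (A : ℝ) ^ (-ρ) + B * (q ^ ρ * ζ ^ ρ) := ⟨_, rfl⟩
  have hBq0 : 0 ≤ B * (q ^ ρ * ζ ^ ρ) := by positivity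
  have hE0 : 0 ≤ E := by rw [hE]; linarith
  have hE2 : E ≤ 2 := by
    have : B * (q ^ ρ * ζ ^ ρ) ≤ B * (1 * (η' / B)) := by
      gcongr
      exact (Real.rpow_le_rpow hζ0 hz hρ0.le).trans (hερ.trans (min_le_right _ _))
    have e : B * (1 * (η' / B)) = η' := by field_simp
    have : 0 ≤ B * 2 ^ ρ * (A : ℝ) ^ (-ρ) := by positivity
    rw [hE]; linarith
  have hpotE : ∀ (A' : ℕ) (ζ' : ℝ), (A' : ℝ) ≤ 1 / 2 * A → 0 ≤ ζ' → ζ' ≤ q * ζ →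
      pot A' ζ' ≤ E := by
    intro A' ζ' hA' hζ'0 hζ'
    rw [hpot]
    simp only
    split_ifs with hcase
    · rw [hE]; linarith
    · push Not at hcase
      have hA'0 : (0 : ℝ) < A' := by
        have : 0 < A' := by omega
        exact_mod_cast this
      have e1 : 2 ^ ρ * (A : ℝ) ^ (-ρ) ≤ (A' : ℝ) ^ (-ρ) := by
        have : (1 / 2 * (A : ℝ)) ^ (-ρ) ≤ (A' : ℝ) ^ (-ρ) :=
          Real.rpow_le_rpow_of_nonpos hA'0 hA' (by linarith)
        rw [Real.mul_rpow (by norm_num) hA0'.le, one_div, Real.inv_rpow (by norm_num),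
          ← Real.rpow_neg (by norm_num), neg_neg] at this
        exact this
      have e2 : ζ' ^ ρ ≤ q ^ ρ * ζ ^ ρ := by
        rw [← Real.mul_rpow hq0.le hζ0]
        exact Real.rpow_le_rpow hζ'0 hζ' hρ0.le
      rw [hE, mul_assoc]
      gcongr
  have hpotA : E + G * s ≤ pot A ζ := by
    have e : pot A ζ = η' - B * (A : ℝ) ^ (-ρ) + B * ζ ^ ρ := by
      rw [hpot]; simp [not_lt.2 hge]
    rw [e, hE, hs]
    have c1 := mul_le_mul_of_nonneg_right hB1 hAρ0.le
    have c2 := mul_le_mul_of_nonneg_right hB2 hζρ0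
    linarith
  have hqζ : q * ζ ≤ ε := (mul_le_of_le_one_left hζ0 hq1.le).trans hz
  have ihhalf : ∀ (A' a' : ℕ) (t' : ℝ), A' < A → (A' : ℝ) ≤ 1 / 2 * A → |t'| ≤ (1 + s) * |t| →
      |cgf (blockSum Z a' A') μ t' - t' ^ 2 * Var[blockSum Z a' A'; μ] / 2| ≤ E * t' ^ 2 * A' := by
    intro A' a' t' hlt hA' ht'
    have h1 := hzhalf A' t' hA' ht'
    refine (ih A' hlt a' t' (h1.trans hqζ)).trans ?_
    gcongr
    exact hpotE A' _ hA' (P.zeta_nonneg hw (Nat.cast_nonneg A') t') h1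
  have ihgap : ∀ t' : ℝ, |t'| ≤ (1 + 1 / s) * |t| →
      cgf (blockSum Z (a + B₁) d) μ t' ≤ t' ^ 2 * ((K₁ / 2 + 2) * d) := by
    intro t' ht'
    have h1 := (hzgap t' ht').trans hz
    have h2 := (abs_le.1 (ih d hdA' (a + B₁) t' h1)).2
    have h3 := hpot2 d _ (P.zeta_nonneg hw (Nat.cast_nonneg d) t') h1
    have h4 := (hvar h).1 (a + B₁) d
    have h5 : pot d (P.zeta w d t') * t' ^ 2 * d ≤ 2 * t' ^ 2 * d := by gcongr; linarith
    have h6 : t' ^ 2 * Var[blockSum Z (a + B₁) d; μ] ≤ t' ^ 2 * (K₁ * d) := by gcongr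
    linarith
  have hB₁A : B₁ < A := by omega
  have hB₂A : B₂ < A := by omega
  have hvA := (hvar h).1 a A
  have hvd := (hvar h).2 a B₁ d B₂ hd1 (by omega)
  rw [hsum] at hvd
  obtain ⟨hvd1, hvd2⟩ := abs_le.1 hvd
  have hV1 := variance_nonneg (blockSum Z a B₁) μ
  have hV2 := variance_nonneg (blockSum Z (a + B₁ + d) B₂) μ
  have hAA : (B₁ : ℝ) + B₂ ≤ A := by linarith
  have hup : cgf (blockSum Z a A) μ t ≤ t ^ 2 * Var[blockSum Z a A; μ] / 2 +
      (E + (5 * K₁ + 10 + 2 * K) * s) * t ^ 2 * A := by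
    have ht' : |(1 + s) * t| ≤ (1 + s) * |t| := by
      rw [abs_mul, abs_of_pos (by linarith : 0 < 1 + s)]
    have ht'' : |(1 + 1 / s) * t| ≤ (1 + 1 / s) * |t| := by
      rw [abs_mul, abs_of_pos (by positivity : 0 < 1 + 1 / s)]
    obtain ⟨-, c1, c2⟩ := hgapc _ ht'
    have hce := (abs_le.1 (hcgf h a B₁ d B₂ A _ hsum hd1 hd2 c1 c2)).2
    have hcl := h.cgf_le a B₁ d B₂ hs0 t
    rw [hsum] at hcl
    refine upper_step (V₁ := Var[blockSum Z a B₁; μ]) (V₂ := Var[blockSum Z (a + B₁ + d) B₂; μ])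
      (d := d) hs0 hs1 hK.le hK₁.le
      (g₁ := cgf (blockSum Z a B₁) μ ((1 + s) * t))
      (g₂ := cgf (blockSum Z (a + B₁ + d) B₂) μ ((1 + s) * t))
      (gd := cgf (blockSum Z (a + B₁) d) μ ((1 + 1 / s) * t))
      (hcl.trans ?_) ?_ ?_ (ihgap _ ht'') (by linarith) hvA hAA (Nat.cast_nonneg d) hdsA hsA hE0 hE2
    · gcongr
      linarith
    · linarith [(abs_le.1 (ihhalf B₁ a _ hB₁A hB₁h ht')).2]
    · linarith [(abs_le.1 (ihhalf B₂ (a + B₁ + d) _ hB₂A hB₂h ht')).2]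
  have hlow : t ^ 2 * Var[blockSum Z a A; μ] / 2 -
      (E + (5 * K₁ + 10 + 2 * K) * s) * t ^ 2 * A ≤ cgf (blockSum Z a A) μ t := by
    have ht' : |t / (1 + s)| ≤ (1 + s) * |t| := by
      rw [abs_div, abs_of_pos (by linarith : 0 < 1 + s), div_le_iff₀ (by linarith)]
      linarith [abs_nonneg t, mul_nonneg (abs_nonneg t) hs0.le,
        mul_nonneg (mul_nonneg (abs_nonneg t) hs0.le) hs0.le]
    have ht'' : |-(t / s)| ≤ (1 + 1 / s) * |t| := by
      rw [abs_neg, abs_div, abs_of_pos hs0, add_mul, one_mul, one_div, inv_mul_eq_div]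
      linarith [abs_nonneg t]
    obtain ⟨-, c1, c2⟩ := hgapc _ ht'
    have hce := (abs_le.1 (hcgf h a B₁ d B₂ A _ hsum hd1 hd2 c1 c2)).1
    have hcl := h.le_cgf a B₁ d B₂ hs0 t
    rw [hsum] at hcl
    have hgd := ihgap _ ht''
    rw [neg_sq] at hgd
    refine lower_step (V₁ := Var[blockSum Z a B₁; μ]) (V₂ := Var[blockSum Z (a + B₁ + d) B₂; μ])
      (d := d) hs0 hs1 hK.le hK₁.le
      (g₁ := cgf (blockSum Z a B₁) μ (t / (1 + s)))
      (g₂ := cgf (blockSum Z (a + B₁ + d) B₂) μ (t / (1 + s)))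
      (gd := cgf (blockSum Z (a + B₁) d) μ (-(t / s)))
      (le_trans ?_ hcl) ?_ ?_ hgd (by linarith) (by linarith) (by linarith) hvA hAA
      (Nat.cast_nonneg d) hdsA hsA hE0
    · gcongr
      linarith
    · linarith [(abs_le.1 (ihhalf B₁ a _ hB₁A hB₁h ht')).1]
    · linarith [(abs_le.1 (ihhalf B₂ (a + B₁ + d) _ hB₂A hB₂h ht')).1]
  rw [← hG] at hup hlow
  have hfin : (E + G * s) * t ^ 2 * A ≤ pot A ζ * t ^ 2 * A := by gcongr
  rw [abs_le]
  constructor <;> linarith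

/-- The log-Laplace transform of a block of length `A` is `t ^ 2 / 2` times its variance, up to an
error which is small compared to `t ^ 2 * A`, as soon as `P.zeta w A t` is small. -/
theorem exists_abs_cgf_sub_le (P : Params) {η : ℝ} (hη : 0 < η) : ∃ ε : ℝ, 0 < ε ∧
    ∀ {Ω : Type*} {_ : MeasurableSpace Ω}
    {μ : Measure Ω} [IsProbabilityMeasure μ] {w : ℝ} {F : ℕ → MeasurableSpace Ω}
    {Z W : ℕ → Ω → ℝ}, IsAdmissible P μ w F Z W → ∀ (a A : ℕ) (t : ℝ), P.zeta w A t ≤ ε →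
    |cgf (blockSum Z a A) μ t - t ^ 2 * Var[blockSum Z a A; μ] / 2| ≤ η * t ^ 2 * A := by
  obtain ⟨ε, hε, H⟩ := exists_abs_cgf_sub_le_two_mul P (η' := min η 1 / 2)
    (by positivity) (by linarith [min_le_right η 1])
  refine ⟨ε, hε, ?_⟩
  intro Ω _ μ _ w F Z W h a A t hz
  refine (H h a A t hz).trans ?_
  gcongr
  linarith [min_le_left η 1]

/-! ### Sums of separated blocks -/

section
variable {P : Params} {Ω : Type*} {mΩ : MeasurableSpace Ω} {μ : Measure Ω} [IsProbabilityMeasure μ]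
  {w : ℝ} {F : ℕ → MeasurableSpace Ω} {Z W : ℕ → Ω → ℝ}

lemma separated_le {s l : ℕ → ℕ} {q : ℕ} (hsep : ∀ i, s i + l i + q ≤ s (i + 1)) (j m : ℕ) :
    s j + l j + (m + 1) * q ≤ s (j + (m + 1)) := by
  induction m with
  | zero => simpa using hsep j
  | succ m ih =>
    have := hsep (j + (m + 1))
    rw [show j + (m + 1 + 1) = j + (m + 1) + 1 by ring]
    have e : (m + 1 + 1) * q = (m + 1) * q + q := by ring
    omega

/-- The law `ν` of the sum of independent copies of separated blocks is close to the law of the sum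
of the blocks themselves, when tested against Lipschitz functions. The blocks are replaced by
copies one at a time, starting with the last one. -/
lemma IsAdmissible.exists_decoupled_law (h : IsAdmissible P μ w F Z W) {s l : ℕ → ℕ} {q : ℕ}
    (hq : 1 ≤ q) (hsep : ∀ i, s i + l i + q ≤ s (i + 1)) (k : ℕ) :
    ∃ ν : Measure ℝ, IsProbabilityMeasure ν ∧ (∃ B, ∀ᵐ x ∂ν, |x| ≤ B) ∧
      (∀ t, mgf id ν t = ∏ i ∈ Finset.range k, mgf (blockSum Z (s i) (l i)) μ t) ∧
      ∀ φ : ℝ → ℝ, LipschitzWith 1 φ →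
        |∫ ω, φ (∑ i ∈ Finset.range k, blockSum Z (s i) (l i) ω) ∂μ - ∫ x, φ x ∂ν| ≤
          (∑ i ∈ Finset.range k, (l i : ℝ)) * Real.exp (-(P.c * (q : ℝ) ^ P.γ₁)) := by
  induction k with
  | zero =>
    refine ⟨Measure.dirac 0, inferInstance, ⟨0, ?_⟩, fun t => ?_, fun φ hφ => ?_⟩
    · simp [ae_dirac_eq]
    · simp [mgf]
    · simp
  | succ k ih =>
    obtain ⟨ν, hν, ⟨B, hB⟩, hmgf, hφν⟩ := ih
    set Y : Ω → ℝ := blockSum Z (s k) (l k) with hY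
    have mY : Measurable Y := h.measurable_blockSum _ _
    set D : ℝ := l k * (P.m + w ^ (1 / P.γ₂)) with hD
    have hYD : ∀ ω, |Y ω| ≤ D := h.abs_blockSum_le _ _
    have : IsProbabilityMeasure (μ.map Y) := Measure.isProbabilityMeasure_map mY.aemeasurable
    have hYae : ∀ᵐ y ∂(μ.map Y), |y| ≤ D := by
      rw [ae_map_iff mY.aemeasurable (measurableSet_le (by fun_prop) (by fun_prop))]
      exact ae_of_all _ hYD
    set π : Measure (ℝ × ℝ) := ν.prod (μ.map Y) with hπ
    have madd : Measurable fun x : ℝ × ℝ => x.1 + x.2 := by fun_prop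
    have hπ1 : ∀ᵐ x ∂π, |x.1| ≤ B := Measure.quasiMeasurePreserving_fst.ae hB
    have hπ2 : ∀ᵐ x ∂π, |x.2| ≤ D := Measure.quasiMeasurePreserving_snd.ae hYae
    have hπb : ∀ᵐ x ∂π, |x.1 + x.2| ≤ B + D := by
      filter_upwards [hπ1, hπ2] with x h1 h2
      exact (abs_add_le _ _).trans (add_le_add h1 h2)
    refine ⟨π.map fun x => x.1 + x.2, Measure.isProbabilityMeasure_map madd.aemeasurable,
      ⟨B + D, ?_⟩, fun t => ?_, fun φ hφ => ?_⟩
    · rw [ae_map_iff madd.aemeasurable (measurableSet_le (by fun_prop) (by fun_prop))]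
      exact hπb
    · rw [Finset.prod_range_succ, ← hmgf t]
      simp only [mgf, id]
      rw [integral_map madd.aemeasurable (by fun_prop)]
      simp only [mul_add, Real.exp_add]
      rw [integral_prod_mul (fun x => Real.exp (t * x)) (fun y => Real.exp (t * y)),
        integral_map mY.aemeasurable (by fun_prop)]
    · have hφc : Continuous φ := hφ.continuous
      have hφl : ∀ x, |φ x| ≤ |φ 0| + |x| := fun x => by
        have := hφ.dist_le_mul x 0
        simp only [NNReal.coe_one, one_mul, Real.dist_eq, sub_zero] at this
        have h2 := abs_sub_abs_le_abs_sub (φ x) (φ 0)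
        linarith
      set V : Ω → ℝ := fun ω => ∑ i ∈ Finset.range k, blockSum Z (s i) (l i) ω with hV
      set b : ℕ := s k - q with hb
      have hbk : ∀ i ∈ Finset.range k, s i + l i ≤ b := by
        intro i hi
        have hi' := Finset.mem_range.1 hi
        have := separated_le hsep i (k - i - 1)
        rw [show i + (k - i - 1 + 1) = k by omega] at this
        have : q ≤ (k - i - 1 + 1) * q := Nat.le_mul_of_pos_left q (by omega)
        omega
      have mV : Measurable[F b] V :=
        Finset.measurable_fun_sum _ fun i hi => h.adapted_blockSum (hbk i hi)
      have mV' : Measurable V := mV.mono (h.past_le _) le_rfl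
      obtain ⟨D', hD'⟩ : ∃ D', ∀ ω, |V ω| ≤ D' := by
        refine ⟨∑ i ∈ Finset.range k, l i * (P.m + w ^ (1 / P.γ₂)), fun ω => ?_⟩
        exact (Finset.abs_sum_le_sum_abs _ _).trans
          (Finset.sum_le_sum fun i _ => h.abs_blockSum_le _ _ ω)
      set ψ : ℝ → ℝ := fun x => ∫ ω', φ (x + Y ω') ∂μ with hψ
      have hφY : ∀ x, Integrable (fun ω' => φ (x + Y ω')) μ := fun x => by
        refine integrable_of_abs_le (B := |φ 0| + (|x| + D))
          (hφc.measurable.comp (measurable_const.add mY)) fun ω => ?_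
        have := hφl (x + Y ω)
        have := abs_add_le x (Y ω)
        have := hYD ω
        linarith
      have hψl : LipschitzWith 1 ψ := by
        refine LipschitzWith.of_dist_le_mul fun x y => ?_
        rw [Real.dist_eq, hψ]
        simp only
        rw [← integral_sub (hφY x) (hφY y)]
        refine abs_integral_le_integral_abs.trans ?_
        calc ∫ ω, |φ (x + Y ω) - φ (y + Y ω)| ∂μ ≤ ∫ _, |x - y| ∂μ := by
              refine integral_mono ((hφY x).sub (hφY y)).abs (integrable_const _) fun ω => ?_
              have := hφ.dist_le_mul (x + Y ω) (y + Y ω)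
              simpa [Real.dist_eq] using this
          _ = _ := by simp [Real.dist_eq]
      have e1 : ∫ x, φ x ∂(π.map fun x => x.1 + x.2) = ∫ x, ψ x ∂ν := by
        rw [integral_map madd.aemeasurable hφc.aestronglyMeasurable, hπ, integral_prod]
        · refine integral_congr_ae (ae_of_all _ fun x => ?_)
          simp only [hψ]
          rw [integral_map mY.aemeasurable]
          exact (hφc.comp (by fun_prop)).aestronglyMeasurable
        · refine Integrable.of_bound (hφc.comp (by fun_prop)).aestronglyMeasurable
            (|φ 0| + (B + D)) ?_
          filter_upwards [hπb] with x hx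
          rw [Real.norm_eq_abs]
          linarith [hφl (x.1 + x.2)]
      have e2 : |∫ ω, φ (V ω + Y ω) ∂μ - ∫ ω, ψ (V ω) ∂μ| ≤
          l k * Real.exp (-(P.c * (q : ℝ) ^ P.γ₁)) := by
        -- for `k = 0` there is no past, and `b + q ≤ s k` may fail
        rcases Nat.eq_zero_or_pos k with rfl | hk
        · have e : ∀ ω, V ω = 0 := fun ω => by simp [hV]
          simp only [e, hψ, zero_add, integral_const, probReal_univ, one_smul, sub_self, abs_zero]
          positivity
        · have hbq : b + q ≤ s k := by
            have := hsep (k - 1)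
            rw [show k - 1 + 1 = k by omega] at this
            omega
          refine h.decouple b (s k) (l k) q (fun ω y => φ (V ω + y)) hq hbq ?_ (fun ω => ?_)
            ⟨|φ 0| + D', fun ω => ?_⟩
          · have h1 : @Measurable (Ω × ℝ) ℝ ((F b).prod Real.measurableSpace) _ (fun x => V x.1) :=
              @Measurable.comp _ _ _ ((F b).prod Real.measurableSpace) (F b) _ _ _ mV
                (@measurable_fst _ _ (F b) _)
            have h2 : @Measurable (Ω × ℝ) ℝ ((F b).prod Real.measurableSpace) _ (fun x => x.2) :=
              @measurable_snd _ _ (F b) _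
            have h3 : @Measurable (Ω × ℝ) ℝ ((F b).prod Real.measurableSpace) _
                (fun x => V x.1 + x.2) := by
              let _ := (F b).prod Real.measurableSpace
              exact h1.add h2
            exact @Measurable.comp _ _ _ ((F b).prod Real.measurableSpace) _ _ _ _
              hφc.measurable h3
          · refine LipschitzWith.of_dist_le_mul fun x y => ?_
            have := hφ.dist_le_mul (V ω + x) (V ω + y)
            simpa [Real.dist_eq] using this
          · rw [add_zero]
            linarith [hφl (V ω), hD' ω]
      have e3 := hφν ψ hψl
      rw [e1, Finset.sum_range_succ, add_mul]
      simp only [Finset.sum_range_succ]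
      rw [_root_.abs_le] at e2 e3 ⊢
      constructor <;> linarith

lemma exists_sum_inv_sq_le : ∃ K : ℝ, 0 < K ∧ ∀ k : ℕ,
    ∑ j ∈ Finset.range k, 1 / ((k - j : ℕ) : ℝ) ^ 2 ≤ K := by
  have hs : Summable fun n : ℕ => 1 / ((n + 1 : ℕ) : ℝ) ^ 2 :=
    (summable_nat_add_iff 1).2 (Real.summable_one_div_nat_pow.2 one_lt_two)
  refine ⟨∑' n : ℕ, 1 / ((n + 1 : ℕ) : ℝ) ^ 2, hs.tsum_pos (fun n => by positivity) 0 (by simp),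
    fun k => ?_⟩
  rw [← Finset.sum_range_reflect]
  refine le_trans (le_of_eq ?_) (hs.sum_le_tsum (Finset.range k) fun n _ => by positivity)
  refine Finset.sum_congr rfl fun j hj => ?_
  have := Finset.mem_range.1 hj
  rw [show k - (k - 1 - j) = j + 1 by omega]

/-- The variance of a sum of blocks separated by gaps of length `q` is the sum of the variances,
up to an error which is linear in the total length, with a factor `1 / q ^ 2`. -/
lemma exists_abs_variance_sum_sub_le (P : Params) : ∃ K : ℝ, 0 < K ∧
    ∀ {Ω : Type*} {_ : MeasurableSpace Ω}
    {μ : Measure Ω} [IsProbabilityMeasure μ] {w : ℝ} {F : ℕ → MeasurableSpace Ω}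
    {Z W : ℕ → Ω → ℝ}, IsAdmissible P μ w F Z W → ∀ {s l : ℕ → ℕ} {q : ℕ},
    1 ≤ q → (∀ i, s i + l i + q ≤ s (i + 1)) → ∀ k : ℕ,
    |Var[fun ω => ∑ i ∈ Finset.range k, blockSum Z (s i) (l i) ω; μ] -
      ∑ i ∈ Finset.range k, Var[blockSum Z (s i) (l i); μ]| ≤
      K / (q : ℝ) ^ 2 * ∑ i ∈ Finset.range k, (l i : ℝ) := by
  obtain ⟨K, hK, hcov⟩ := exists_abs_cov_blockSum_le P
  obtain ⟨T, hT, hsum⟩ := exists_sum_inv_sq_le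
  refine ⟨2 * (K * T), by positivity, ?_⟩
  intro Ω _ μ _ w F Z W h s l q hq hsep k
  have hq' : (1 : ℝ) ≤ q := by exact_mod_cast hq
  have hq0 : (0 : ℝ) < q := by linarith
  induction k with
  | zero => simp [variance_eq_integral]
  | succ k ih =>
    have m1 : MemLp (fun ω => ∑ i ∈ Finset.range k, blockSum Z (s i) (l i) ω) 2 μ :=
      memLp_finsetSum _ fun i _ => h.memLp_blockSum _ _ 2
    have m2 := h.memLp_blockSum (s k) (l k) 2
    have c1 : |cov[fun ω => ∑ i ∈ Finset.range k, blockSum Z (s i) (l i) ω,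
        blockSum Z (s k) (l k); μ]| ≤ K * T / (q : ℝ) ^ 2 * l k := by
      rw [covariance_fun_sum_left' (fun i _ => h.memLp_blockSum _ _ 2) m2]
      calc |∑ i ∈ Finset.range k, cov[blockSum Z (s i) (l i), blockSum Z (s k) (l k); μ]|
          ≤ ∑ i ∈ Finset.range k, |cov[blockSum Z (s i) (l i), blockSum Z (s k) (l k); μ]| :=
            Finset.abs_sum_le_sum_abs _ _
        _ ≤ ∑ i ∈ Finset.range k, K * l k / (q : ℝ) ^ 2 * (1 / ((k - i : ℕ) : ℝ) ^ 2) := by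
            refine Finset.sum_le_sum fun i hi => ?_
            have hi' := Finset.mem_range.1 hi
            have hki : (0 : ℝ) < ((k - i : ℕ) : ℝ) := by
              have : 0 < k - i := by omega
              exact_mod_cast this
            have hs := separated_le hsep i (k - i - 1)
            rw [show i + (k - i - 1 + 1) = k by omega, show k - i - 1 + 1 = k - i by omega] at hs
            rw [covariance_comm]
            refine (hcov h (s k) (l k) (s i) (l i) (((k - i) * q : ℕ) : ℝ) (by positivity)
              fun x hx y hy => ?_).trans ?_
            · refine le_trans ?_ (le_abs_self _)
              have : (s i + y : ℕ) + (k - i) * q ≤ (s k + x : ℕ) := by omega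
              have : ((s i + y : ℕ) : ℝ) + ((k - i) * q : ℕ) ≤ ((s k + x : ℕ) : ℝ) := by
                exact_mod_cast this
              linarith
            · rw [div_mul_div_comm, mul_one]
              push_cast
              gcongr
              rw [← mul_pow, mul_comm]
              gcongr
              linarith
        _ = K * l k / (q : ℝ) ^ 2 * ∑ i ∈ Finset.range k, 1 / ((k - i : ℕ) : ℝ) ^ 2 := by
            rw [Finset.mul_sum]
        _ ≤ K * l k / (q : ℝ) ^ 2 * T := by gcongr; exact hsum k
        _ = _ := by ring
    simp only [Finset.sum_range_succ]
    rw [variance_fun_add m1 m2]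
    have e : 2 * (K * T) / (q : ℝ) ^ 2 * l k = 2 * (K * T / (q : ℝ) ^ 2 * l k) := by ring
    rw [mul_add, e]
    rw [abs_le] at ih c1 ⊢
    constructor <;> linarith

/-! ### Big blocks and gaps -/

/-- The length of the `i`-th big block inside `{0, …, n - 1}`, for big blocks of length `p` starting
at the multiples of `p + q`; it is shorter than `p` only at the right end. -/
def bigLength (n p q i : ℕ) : ℕ := min p (n - i * (p + q))

/-- The length of the gap which follows the `i`-th big block. -/
def gapLength (n p q i : ℕ) : ℕ := min q (n - (i * (p + q) + p))

lemma sum_bigLength_add_gapLength (n p q k : ℕ) :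
    ∑ i ∈ Finset.range k, (bigLength n p q i + gapLength n p q i) = min n (k * (p + q)) := by
  induction k with
  | zero => simp
  | succ k ih =>
    rw [Finset.sum_range_succ, ih, bigLength, gapLength, add_mul, one_mul]
    omega

lemma sum_bigLength_le (n p q k : ℕ) :
    ∑ i ∈ Finset.range k, (bigLength n p q i : ℝ) ≤ n := by
  have h := sum_bigLength_add_gapLength n p q k
  have : ∑ i ∈ Finset.range k, bigLength n p q i ≤ n := by
    rw [Finset.sum_add_distrib] at h
    have := min_le_left n (k * (p + q))
    omega
  exact_mod_cast this

lemma sum_gapLength_le (n p q k : ℕ) :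
    p * ∑ i ∈ Finset.range k, (gapLength n p q i : ℝ) ≤ q * n := by
  have h : ∀ i, p * gapLength n p q i ≤ q * bigLength n p q i := by
    intro i
    rcases Nat.eq_zero_or_pos (n - (i * (p + q) + p)) with h0 | h0
    · simp [gapLength, h0]
    · have e : bigLength n p q i = p := by rw [bigLength]; omega
      rw [e, mul_comm]
      exact Nat.mul_le_mul_right _ (min_le_left _ _)
  rw [Finset.mul_sum]
  calc ∑ i ∈ Finset.range k, (p : ℝ) * (gapLength n p q i : ℝ)
      ≤ ∑ i ∈ Finset.range k, (q : ℝ) * (bigLength n p q i : ℝ) := by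
        refine Finset.sum_le_sum fun i _ => ?_
        exact_mod_cast h i
    _ = q * ∑ i ∈ Finset.range k, (bigLength n p q i : ℝ) := by rw [Finset.mul_sum]
    _ ≤ q * n := by gcongr; exact sum_bigLength_le n p q k

/-- The sum over the big blocks. -/
noncomputable def bigSum (Z : ℕ → Ω → ℝ) (n p q : ℕ) (ω : Ω) : ℝ :=
  ∑ i ∈ Finset.range n, blockSum Z (i * (p + q)) (bigLength n p q i) ω

/-- The sum over the gaps. -/
noncomputable def gapSum (Z : ℕ → Ω → ℝ) (n p q : ℕ) (ω : Ω) : ℝ :=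
  ∑ i ∈ Finset.range n, blockSum Z (i * (p + q) + p) (gapLength n p q i) ω

lemma bigSum_add_gapSum (Z : ℕ → Ω → ℝ) (n : ℕ) {p q : ℕ} (hp : 1 ≤ p) (ω : Ω) :
    bigSum Z n p q ω + gapSum Z n p q ω = blockSum Z 0 n ω := by
  have key : ∀ k, ∑ i ∈ Finset.range k, (blockSum Z (i * (p + q)) (bigLength n p q i) ω +
      blockSum Z (i * (p + q) + p) (gapLength n p q i) ω) =
      blockSum Z 0 (min n (k * (p + q))) ω := by
    intro k
    induction k with
    | zero => simp
    | succ k ih =>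
      rw [Finset.sum_range_succ, ih]
      rcases le_total n (k * (p + q)) with h0 | h0
      · have e1 : bigLength n p q k = 0 := by rw [bigLength]; omega
        have e2 : gapLength n p q k = 0 := by rw [gapLength]; omega
        have e3 : min n ((k + 1) * (p + q)) = n := by
          rw [add_mul]; omega
        simp [e1, e2, e3, h0]
      · rw [min_eq_right h0]
        have e : min n ((k + 1) * (p + q)) =
            k * (p + q) + bigLength n p q k + gapLength n p q k := by
          rw [bigLength, gapLength, add_mul]; omega
        rw [e, blockSum_add, blockSum_add, zero_add, zero_add, add_assoc]
        congr 2
        rcases Nat.eq_zero_or_pos (gapLength n p q k) with hg | hg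
        · simp [hg]
        · have : bigLength n p q k = p := by
            rw [gapLength] at hg; rw [bigLength]; omega
          rw [this]
  have h1 := key n
  rw [Finset.sum_add_distrib] at h1
  rw [bigSum, gapSum, h1, min_eq_left]
  exact Nat.le_mul_of_pos_right n (by omega)

lemma bigLength_separated (n p q i : ℕ) :
    i * (p + q) + bigLength n p q i + q ≤ (i + 1) * (p + q) := by
  have := min_le_left p (n - i * (p + q))
  rw [bigLength, add_mul]; omega

lemma gapLength_separated (n p q i : ℕ) :
    i * (p + q) + p + gapLength n p q i + p ≤ (i + 1) * (p + q) + p := by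
  have := min_le_left q (n - (i * (p + q) + p))
  rw [gapLength, add_mul]; omega

/-- The variance of the whole sum is the sum of the variances of the big blocks, up to errors coming
from the dependence between the big blocks and from the total length of the gaps. -/
lemma exists_abs_variance_sub_sum_le (P : Params) : ∃ K : ℝ, 0 < K ∧
    ∀ {Ω : Type*} {_ : MeasurableSpace Ω}
    {μ : Measure Ω} [IsProbabilityMeasure μ] {w : ℝ} {F : ℕ → MeasurableSpace Ω}
    {Z W : ℕ → Ω → ℝ}, IsAdmissible P μ w F Z W → ∀ {n p q : ℕ}, 1 ≤ p → 1 ≤ q →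
    |Var[blockSum Z 0 n; μ] -
      ∑ i ∈ Finset.range n, Var[blockSum Z (i * (p + q)) (bigLength n p q i); μ]| ≤
      K * (1 / (q : ℝ) ^ 2 + q / p) * n := by
  obtain ⟨K₁, hK₁, hvs⟩ := exists_abs_variance_sum_sub_le P
  obtain ⟨K₂, hK₂, hcov⟩ := exists_abs_cov_blockSum_le P
  obtain ⟨K₃, hK₃, hvar⟩ := exists_variance_le P
  refine ⟨K₁ + (2 * K₂ + K₁ + K₃), by positivity, ?_⟩
  intro Ω _ μ _ w F Z W h n p q hp hq
  have hp' : (1 : ℝ) ≤ p := by exact_mod_cast hp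
  have hp0 : (0 : ℝ) < p := by linarith
  have hq' : (1 : ℝ) ≤ q := by exact_mod_cast hq
  have hgap : ∑ i ∈ Finset.range n, (gapLength n p q i : ℝ) ≤ q / p * n := by
    have := sum_gapLength_le n p q n
    rw [div_mul_eq_mul_div, le_div_iff₀ hp0]
    linarith
  have hgap0 : 0 ≤ ∑ i ∈ Finset.range n, (gapLength n p q i : ℝ) := by positivity
  have b1 := hvs h hq (s := fun i => i * (p + q)) (l := bigLength n p q)
    (bigLength_separated n p q) n
  have b2 := hvs h hp (s := fun i => i * (p + q) + p) (l := gapLength n p q)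
    (gapLength_separated n p q) n
  have mb : MemLp (bigSum Z n p q) 2 μ := memLp_finsetSum _ fun i _ => h.memLp_blockSum _ _ 2
  have mg : MemLp (gapSum Z n p q) 2 μ := memLp_finsetSum _ fun i _ => h.memLp_blockSum _ _ 2
  have mS := h.memLp_blockSum 0 n 2
  have e : bigSum Z n p q = fun ω => blockSum Z 0 n ω - gapSum Z n p q ω := by
    funext ω
    rw [← bigSum_add_gapSum Z n hp ω]; ring
  have e1 : Var[bigSum Z n p q; μ] = Var[blockSum Z 0 n; μ] -
      2 * cov[blockSum Z 0 n, gapSum Z n p q; μ] + Var[gapSum Z n p q; μ] := by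
    rw [e, variance_fun_sub mS mg]
  have c1 : |cov[blockSum Z 0 n, gapSum Z n p q; μ]| ≤ K₂ * (q / p * n) := by
    unfold gapSum
    rw [covariance_fun_sum_right' (fun i _ => h.memLp_blockSum _ _ 2) mS]
    calc _ ≤ ∑ i ∈ Finset.range n,
          |cov[blockSum Z 0 n, blockSum Z (i * (p + q) + p) (gapLength n p q i); μ]| :=
          Finset.abs_sum_le_sum_abs _ _
      _ ≤ ∑ i ∈ Finset.range n, K₂ * (gapLength n p q i : ℝ) := by
          refine Finset.sum_le_sum fun i _ => ?_
          rw [covariance_comm]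
          simpa using hcov h (i * (p + q) + p) (gapLength n p q i) 0 n 0 le_rfl
            fun _ _ _ _ => abs_nonneg _
      _ = K₂ * ∑ i ∈ Finset.range n, (gapLength n p q i : ℝ) := by rw [Finset.mul_sum]
      _ ≤ _ := by gcongr
  have c2 : Var[gapSum Z n p q; μ] ≤ (K₁ + K₃) * (q / p * n) := by
    have h1 := (abs_le.1 b2).2
    have h2 : ∑ i ∈ Finset.range n, Var[blockSum Z (i * (p + q) + p) (gapLength n p q i); μ] ≤
        K₃ * ∑ i ∈ Finset.range n, (gapLength n p q i : ℝ) := by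
      rw [Finset.mul_sum]
      exact Finset.sum_le_sum fun i _ => (hvar h).1 _ _
    have h3 : K₁ / (p : ℝ) ^ 2 * ∑ i ∈ Finset.range n, (gapLength n p q i : ℝ) ≤
        K₁ * ∑ i ∈ Finset.range n, (gapLength n p q i : ℝ) := by
      gcongr
      exact div_le_self hK₁.le (one_le_pow₀ hp')
    have h4 : (K₁ + K₃) * ∑ i ∈ Finset.range n, (gapLength n p q i : ℝ) ≤
        (K₁ + K₃) * (q / p * n) := by gcongr
    have h5 : Var[gapSum Z n p q; μ] = Var[fun ω => ∑ i ∈ Finset.range n,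
      blockSum Z (i * (p + q) + p) (gapLength n p q i) ω; μ] := rfl
    rw [h5]
    linarith
  have c3 := variance_nonneg (gapSum Z n p q) μ
  have b1' : |Var[bigSum Z n p q; μ] -
      ∑ i ∈ Finset.range n, Var[blockSum Z (i * (p + q)) (bigLength n p q i); μ]| ≤
      K₁ / (q : ℝ) ^ 2 * n := by
    refine b1.trans ?_
    gcongr
    exact sum_bigLength_le n p q n
  rw [e1] at b1'
  have hx : 0 ≤ 1 / (q : ℝ) ^ 2 * n := by positivity
  have hy : 0 ≤ (q : ℝ) / p * n := by positivity
  have e2 : K₁ / (q : ℝ) ^ 2 * n = K₁ * (1 / (q : ℝ) ^ 2 * n) := by ring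
  have e3 : (K₁ + (2 * K₂ + K₁ + K₃)) * (1 / (q : ℝ) ^ 2 + q / p) * n =
      (K₁ + (2 * K₂ + K₁ + K₃)) * (1 / (q : ℝ) ^ 2 * n) +
      (K₁ + (2 * K₂ + K₁ + K₃)) * (q / p * n) := by ring
  rw [e2] at b1'
  rw [e3]
  have n1 := mul_nonneg hK₁.le hx
  have n2 := mul_nonneg hK₁.le hy
  have n3 := mul_nonneg hK₂.le hx
  have n4 := mul_nonneg hK₂.le hy
  have n5 := mul_nonneg hK₃.le hx
  have n6 := mul_nonneg hK₃.le hy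
  rw [abs_le] at b1' c1 ⊢
  constructor <;> linarith

end

/-! ### Exponential equivalence and large deviations -/

section
variable {Ω : Type*} {mΩ : MeasurableSpace Ω} {μ : Measure Ω} [IsProbabilityMeasure μ]

lemma integrable_comp_of_bounded {α : Type*} {_ : MeasurableSpace α} {ρ : Measure α}
    [IsProbabilityMeasure ρ] {X : α → ℝ} (hX : Measurable X) {g : ℝ → ℝ} (hg : Continuous g)
    (δ : ℝ) : Integrable (fun ω => max 0 (min δ (g (X ω)))) ρ := by
  refine integrable_of_abs_le (B := |δ|) ((by fun_prop : Continuous fun x =>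
    max 0 (min δ (g x))).measurable.comp hX) fun ω => ?_
  rw [abs_of_nonneg (le_max_left _ _)]
  exact max_le (abs_nonneg _) ((min_le_left _ _).trans (le_abs_self _))

lemma mul_measureReal_le_integral {α : Type*} {_ : MeasurableSpace α} {ρ : Measure α}
    [IsProbabilityMeasure ρ] {X : α → ℝ} (hX : Measurable X) {g : ℝ → ℝ} (hg : Continuous g)
    (δ : ℝ) :
    δ * ρ.real {ω | δ ≤ g (X ω)} ≤ ∫ ω, max 0 (min δ (g (X ω))) ∂ρ := by
  have hm : MeasurableSet {ω | δ ≤ g (X ω)} :=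
    measurableSet_le measurable_const (hg.measurable.comp hX)
  rw [mul_comm, ← smul_eq_mul, ← integral_indicator_const _ hm]
  refine integral_mono ((integrable_const δ).indicator hm) (integrable_comp_of_bounded hX hg δ)
    fun ω => ?_
  by_cases h : ω ∈ {ω | δ ≤ g (X ω)}
  · have h' : δ ≤ g (X ω) := h
    simp [Set.indicator_of_mem h, min_eq_left h']
  · simp [Set.indicator_of_notMem h]

lemma integral_le_mul_measureReal {α : Type*} {_ : MeasurableSpace α} {ρ : Measure α}
    [IsProbabilityMeasure ρ] {X : α → ℝ} (hX : Measurable X) {g : ℝ → ℝ} (hg : Continuous g)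
    {δ : ℝ} (hδ : 0 < δ) :
    ∫ ω, max 0 (min δ (g (X ω))) ∂ρ ≤ δ * ρ.real {ω | 0 < g (X ω)} := by
  have hm : MeasurableSet {ω | 0 < g (X ω)} :=
    measurableSet_lt measurable_const (hg.measurable.comp hX)
  rw [mul_comm, ← smul_eq_mul, ← integral_indicator_const _ hm]
  refine integral_mono (integrable_comp_of_bounded hX hg δ) ((integrable_const δ).indicator hm)
    fun ω => ?_
  by_cases h : ω ∈ {ω | 0 < g (X ω)}
  · simp only [Set.indicator_of_mem h]
    exact max_le hδ.le (min_le_left _ _)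
  · have h' : g (X ω) ≤ 0 := not_lt.1 h
    simp only [Set.indicator_of_notMem h]
    exact max_le le_rfl ((min_le_right _ _).trans h')

lemma lipschitzWith_clip {g : ℝ → ℝ} (hg : LipschitzWith 1 g) (δ : ℝ) :
    LipschitzWith 1 fun x => max 0 (min δ (g x)) := (hg.const_min δ).const_max 0

/-- Closeness of two laws in the Wasserstein distance bounds the probability of a set under the
first law by the probability of an enlarged set under the second one, and conversely. -/
lemma measureReal_le_add_div {α β : Type*} {_ : MeasurableSpace α} {_ : MeasurableSpace β}
    {ρ : Measure α} {ρ' : Measure β} [IsProbabilityMeasure ρ] [IsProbabilityMeasure ρ']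
    {X : α → ℝ} {X' : β → ℝ} (hX : Measurable X) (hX' : Measurable X') {e : ℝ}
    (he : ∀ φ : ℝ → ℝ, LipschitzWith 1 φ → |∫ ω, φ (X ω) ∂ρ - ∫ ω, φ (X' ω) ∂ρ'| ≤ e)
    {g : ℝ → ℝ} (hg : LipschitzWith 1 g) {δ : ℝ} (hδ : 0 < δ) :
    ρ.real {ω | δ ≤ g (X ω)} ≤ ρ'.real {ω | 0 < g (X' ω)} + e / δ := by
  have h1 := mul_measureReal_le_integral (ρ := ρ) hX hg.continuous δ
  have h2 := integral_le_mul_measureReal (ρ := ρ') hX' hg.continuous hδ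
  have h3 := (abs_le.1 (he _ (lipschitzWith_clip hg δ))).2
  rw [← mul_le_mul_iff_right₀ hδ, mul_add, mul_div_cancel₀ _ hδ.ne']
  linarith

/-- The sequence `Y` is, up to a superexponentially small Wasserstein distance, distributed as a
sequence of bounded random variables whose log-Laplace transforms at `l * v n` are equivalent to
`L l * v n`. -/
def HasLaplaceModel (μ : Measure Ω) (Y : ℕ → Ω → ℝ) (v : ℕ → ℝ) (L : ℝ → ℝ) : Prop :=
  ∃ (ν : ℕ → Measure ℝ) (e : ℕ → ℝ),
    (∀ᶠ n in atTop, IsProbabilityMeasure (ν n) ∧ (∃ B, ∀ᵐ x ∂ν n, |x| ≤ B) ∧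
      ∀ φ : ℝ → ℝ, LipschitzWith 1 φ → |∫ ω, φ (Y n ω) ∂μ - ∫ x, φ x ∂ν n| ≤ e n) ∧
    (∀ K : ℝ, ∀ᶠ n in atTop, e n ≤ Real.exp (-(K * v n))) ∧
    ∀ l η : ℝ, 0 < η →
      ∀ᶠ n in atTop, |Real.log (mgf id (ν n) (l * v n)) - L l * v n| ≤ η * v n

lemma eventually_mul_exp_le {v : ℕ → ℝ} (hv : Tendsto v atTop atTop) (C : ℝ) {θ θ' : ℝ}
    (h : θ < θ') : ∀ᶠ n in atTop, C * Real.exp (-(θ' * v n)) ≤ Real.exp (-(θ * v n)) := by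
  have h1 : Tendsto (fun n => (θ' - θ) * v n) atTop atTop := hv.const_mul_atTop (by linarith)
  filter_upwards [h1.eventually_ge_atTop (Real.log (max C 1))] with n hn
  have : C ≤ Real.exp ((θ' - θ) * v n) :=
    (le_max_left C 1).trans ((Real.log_le_iff_le_exp (by positivity)).1 hn)
  calc C * Real.exp (-(θ' * v n)) ≤ Real.exp ((θ' - θ) * v n) * Real.exp (-(θ' * v n)) := by
        gcongr
    _ = _ := by rw [← Real.exp_add]; congr 1; ring

lemma integrable_exp_id {ν : Measure ℝ} [IsProbabilityMeasure ν] {B : ℝ}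
    (hB : ∀ᵐ x ∂ν, |x| ≤ B) (t : ℝ) : Integrable (fun x => Real.exp (t * id x)) ν := by
  refine Integrable.of_bound (by fun_prop) (Real.exp (|t| * B)) ?_
  filter_upwards [hB] with x hx
  rw [Real.norm_eq_abs, Real.abs_exp, id]
  refine Real.exp_le_exp.2 ?_
  calc t * x ≤ |t * x| := le_abs_self _
    _ = |t| * |x| := abs_mul _ _
    _ ≤ |t| * B := by gcongr

/-- The upper bound: Chernoff's inequality for the model. -/
lemma HasLaplaceModel.upper_bound {Y : ℕ → Ω → ℝ} {v : ℕ → ℝ} {L : ℝ → ℝ}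
    (hv : Tendsto v atTop atTop) (hYm : ∀ n, Measurable (Y n)) (h : HasLaplaceModel μ Y v L)
    {r l θ : ℝ} (hl : 0 < l) (h1 : θ < l * r - L l) (h2 : θ < l * r - L (-l)) :
    ∀ᶠ n in atTop, μ.real {ω | r ≤ |Y n ω|} ≤ Real.exp (-(θ * v n)) := by
  obtain ⟨ν, e, hν, he, hL⟩ := h
  set g : ℝ := min (l * r - L l) (l * r - L (-l)) - θ with hg
  have hg0 : 0 < g := sub_pos.2 (lt_min h1 h2)
  have hg1 : g ≤ l * r - L l - θ := sub_le_sub_right (min_le_left _ _) _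
  have hg2 : g ≤ l * r - L (-l) - θ := sub_le_sub_right (min_le_right _ _) _
  set δ : ℝ := g / 4 / l with hδ
  have hδ0 : 0 < δ := by positivity
  have hlδ : l * δ = g / 4 := by rw [hδ]; field_simp
  have hθ : θ < θ + g / 2 := by linarith
  filter_upwards [hν, he (θ + g / 2), hL l (g / 4) (by positivity), hL (-l) (g / 4) (by positivity),
    eventually_mul_exp_le hv (2 + 1 / δ) hθ, hv.eventually_ge_atTop 0] with n hn1 hn2 hn3 hn4 hn5 hn6
  obtain ⟨hp, ⟨B, hB⟩, hφ⟩ := hn1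
  have i1 := integrable_exp_id hB (l * v n)
  have i2 := integrable_exp_id hB (-l * v n)
  have k0 := measureReal_le_add_div (ρ := μ) (ρ' := ν n) (X' := id) (hYm n) measurable_id hφ
    (g := fun x => |x| - (r - δ)) (by
      refine LipschitzWith.of_dist_le_mul fun x y => ?_
      rw [NNReal.coe_one, one_mul, Real.dist_eq, Real.dist_eq]
      simpa using abs_abs_sub_abs_le_abs_sub x y) hδ0
  have k1 := measure_ge_le_exp_mul_mgf (μ := ν n) (X := id) (r - δ) (t := l * v n)
    (by positivity) i1
  have k2 := measure_le_le_exp_mul_mgf (μ := ν n) (X := id) (-(r - δ)) (t := -l * v n)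
    (by nlinarith) i2
  have k3 : (ν n).real {x | 0 < |id x| - (r - δ)} ≤
      (ν n).real {x | r - δ ≤ id x} + (ν n).real {x | id x ≤ -(r - δ)} := by
    refine (measureReal_mono (fun x hx => ?_)).trans (measureReal_union_le _ _)
    have hx' : 0 < |x| - (r - δ) := hx
    rcases abs_cases x with h | h
    · exact Or.inl (show r - δ ≤ x by linarith)
    · exact Or.inr (show x ≤ -(r - δ) by linarith)
  have m1 : Real.exp (-(l * v n) * (r - δ)) * mgf id (ν n) (l * v n) ≤
      Real.exp (-((θ + g / 2) * v n)) := by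
    rw [← Real.exp_log (mgf_pos i1), ← Real.exp_add]
    gcongr
    have e1 := (abs_le.1 hn3).2
    have e2 : -(l * v n) * (r - δ) = -(l * r) * v n + g / 4 * v n := by rw [← hlδ]; ring
    have e3 : g * v n ≤ (l * r - L l - θ) * v n := by gcongr
    linarith
  have m2 : Real.exp (-(-l * v n) * (-(r - δ))) * mgf id (ν n) (-l * v n) ≤
      Real.exp (-((θ + g / 2) * v n)) := by
    rw [← Real.exp_log (mgf_pos i2), ← Real.exp_add]
    gcongr
    have e1 := (abs_le.1 hn4).2
    have e2 : -(-l * v n) * (-(r - δ)) = -(l * r) * v n + g / 4 * v n := by rw [← hlδ]; ring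
    have e3 : g * v n ≤ (l * r - L (-l) - θ) * v n := by gcongr
    linarith
  have k4 : μ.real {ω | r ≤ |Y n ω|} ≤ μ.real {ω | δ ≤ |Y n ω| - (r - δ)} :=
    measureReal_mono fun ω hω => by
      have : r ≤ |Y n ω| := hω
      exact (show δ ≤ |Y n ω| - (r - δ) by linarith)
  have k5 : e n / δ ≤ 1 / δ * Real.exp (-((θ + g / 2) * v n)) := by
    rw [one_div, inv_mul_eq_div]; gcongr
  linarith

/-- The lower bound: under the law tilted by `exp (t₀ v x)`, the mass concentrates around `t₀`,
since its complement is controlled by the Laplace transform at `t₀ ± ε`. -/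
lemma HasLaplaceModel.lower_bound {Y : ℕ → Ω → ℝ} {v : ℕ → ℝ}
    (hv : Tendsto v atTop atTop) (hYm : ∀ n, Measurable (Y n))
    (h : HasLaplaceModel μ Y v fun l => l ^ 2 / 2)
    {t₀ ε θ : ℝ} (hε : 0 < ε) (hθ : t₀ ^ 2 / 2 < θ) :
    ∀ᶠ n in atTop, Real.exp (-(θ * v n)) ≤ μ.real {ω | |Y n ω - t₀| < ε} := by
  obtain ⟨ν, e, hν, he, hL⟩ := h
  set g : ℝ := θ - t₀ ^ 2 / 2 with hg
  have hg0 : 0 < g := sub_pos.2 hθ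
  set ε' : ℝ := min (ε / 2) (g / 4 / (|t₀| + 1)) with hε'
  have hε0 : 0 < ε' := by positivity
  have hε1 : ε' ≤ ε / 2 := min_le_left _ _
  have hε2 : ε' * |t₀| ≤ g / 4 := by
    have h1 : ε' * (|t₀| + 1) ≤ g / 4 :=
      (le_div_iff₀ (by positivity)).1 (min_le_right (ε / 2) (g / 4 / (|t₀| + 1)))
    linarith
  set η : ℝ := min (g / 8) (ε' ^ 2 / 8) with hη
  have hη0 : 0 < η := by positivity
  have hη1 : η ≤ g / 8 := min_le_left _ _
  have hη2 : η ≤ ε' ^ 2 / 8 := min_le_right _ _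
  filter_upwards [hν, he (θ + 1), hL t₀ η hη0, hL (t₀ + ε') η hη0, hL (t₀ - ε') η hη0,
    eventually_mul_exp_le hv 4 (show η - t₀ ^ 2 / 2 < ε' ^ 2 / 2 - η - t₀ ^ 2 / 2 by
      have : 0 < ε' ^ 2 := by positivity
      linarith),
    eventually_mul_exp_le hv 4 (show θ - g / 2 < θ by linarith),
    eventually_mul_exp_le hv (4 / ε) (show θ < θ + 1 by linarith), hv.eventually_ge_atTop 0]
    with n hn1 hn2 hn3 hn4 hn5 hn6 hn7 hn8 hn9
  obtain ⟨hp, ⟨B, hB⟩, hφ⟩ := hn1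
  have i0 := integrable_exp_id hB (t₀ * v n)
  have i1 := integrable_exp_id hB ((t₀ + ε') * v n)
  have i2 := integrable_exp_id hB ((t₀ - ε') * v n)
  set N : Set ℝ := {x | |x - t₀| < ε'} with hN
  have hNm : MeasurableSet N := measurableSet_lt (by fun_prop) measurable_const
  set V := v n with hV
  have key : mgf id (ν n) (t₀ * V) ≤
      Real.exp ((t₀ ^ 2 + ε' * |t₀|) * V) * (ν n).real N +
      (Real.exp (-(ε' * (t₀ + ε')) * V) * mgf id (ν n) ((t₀ + ε') * V) +
       Real.exp (ε' * (t₀ - ε') * V) * mgf id (ν n) ((t₀ - ε') * V)) := by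
    rw [mul_comm _ ((ν n).real N), ← smul_eq_mul ((ν n).real N), ← integral_indicator_const _ hNm]
    unfold mgf
    rw [← integral_const_mul, ← integral_const_mul,
      ← integral_add (i1.const_mul _) (i2.const_mul _)]
    have i3 := (i1.const_mul (Real.exp (-(ε' * (t₀ + ε')) * V))).add
      (i2.const_mul (Real.exp (ε' * (t₀ - ε') * V)))
    refine (integral_mono i0 (((integrable_const _).indicator hNm).add i3) fun x => ?_).trans
      (integral_add ((integrable_const _).indicator hNm) i3).le
    simp only [id, Pi.add_apply]
    rw [← Real.exp_add, ← Real.exp_add]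
    have p1 := Real.exp_pos (-(ε' * (t₀ + ε')) * V + (t₀ + ε') * V * x)
    have p2 := Real.exp_pos (ε' * (t₀ - ε') * V + (t₀ - ε') * V * x)
    by_cases hx : x ∈ N
    · rw [Set.indicator_of_mem hx]
      have hx' : |x - t₀| < ε' := hx
      have : Real.exp (t₀ * V * x) ≤ Real.exp ((t₀ ^ 2 + ε' * |t₀|) * V) := by
        refine Real.exp_le_exp.2 ?_
        have : t₀ * (x - t₀) ≤ ε' * |t₀| := by
          calc t₀ * (x - t₀) ≤ |t₀ * (x - t₀)| := le_abs_self _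
            _ = |t₀| * |x - t₀| := abs_mul _ _
            _ ≤ |t₀| * ε' := by gcongr
            _ = _ := mul_comm _ _
        have := mul_le_mul_of_nonneg_right this hn9
        linarith
      linarith
    · rw [Set.indicator_of_notMem hx]
      have hx' : ε' ≤ |x - t₀| := not_lt.1 hx
      rcases abs_cases (x - t₀) with h | h
      · have : Real.exp (t₀ * V * x) ≤ Real.exp (-(ε' * (t₀ + ε')) * V + (t₀ + ε') * V * x) := by
          gcongr
          have : 0 ≤ ε' * (x - t₀ - ε') * V := by
            have : 0 ≤ x - t₀ - ε' := by linarith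
            positivity
          linarith
        linarith
      · have : Real.exp (t₀ * V * x) ≤ Real.exp (ε' * (t₀ - ε') * V + (t₀ - ε') * V * x) := by
          gcongr
          have : 0 ≤ ε' * (t₀ - x - ε') * V := by
            have : 0 ≤ t₀ - x - ε' := by linarith
            positivity
          linarith
        linarith
  have b0 : Real.exp (-((η - t₀ ^ 2 / 2) * V)) ≤ mgf id (ν n) (t₀ * V) := by
    rw [← Real.exp_log (mgf_pos i0)]
    gcongr
    have := (abs_le.1 hn3).1
    linarith
  have b1 : Real.exp (-(ε' * (t₀ + ε')) * V) * mgf id (ν n) ((t₀ + ε') * V) ≤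
      Real.exp (-((ε' ^ 2 / 2 - η - t₀ ^ 2 / 2) * V)) := by
    rw [← Real.exp_log (mgf_pos i1), ← Real.exp_add]
    gcongr
    have := (abs_le.1 hn4).2
    linarith
  have b2 : Real.exp (ε' * (t₀ - ε') * V) * mgf id (ν n) ((t₀ - ε') * V) ≤
      Real.exp (-((ε' ^ 2 / 2 - η - t₀ ^ 2 / 2) * V)) := by
    rw [← Real.exp_log (mgf_pos i2), ← Real.exp_add]
    gcongr
    have := (abs_le.1 hn5).2
    linarith
  have b3 : Real.exp (-((θ - g / 2) * V)) ≤ 2 * (ν n).real N := by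
    have h1 : Real.exp (-((η - t₀ ^ 2 / 2) * V)) ≤
        2 * (Real.exp ((t₀ ^ 2 + ε' * |t₀|) * V) * (ν n).real N) := by linarith
    have h2 : Real.exp (-((t₀ ^ 2 + ε' * |t₀|) * V)) * Real.exp (-((η - t₀ ^ 2 / 2) * V)) ≤
        2 * (ν n).real N := by
      calc _ ≤ Real.exp (-((t₀ ^ 2 + ε' * |t₀|) * V)) *
            (2 * (Real.exp ((t₀ ^ 2 + ε' * |t₀|) * V) * (ν n).real N)) := by gcongr
        _ = 2 * (Real.exp (-((t₀ ^ 2 + ε' * |t₀|) * V)) * Real.exp ((t₀ ^ 2 + ε' * |t₀|) * V)) *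
            (ν n).real N := by ring
        _ = _ := by rw [← Real.exp_add, neg_add_cancel, Real.exp_zero, mul_one]
    refine le_trans ?_ h2
    rw [← Real.exp_add]
    gcongr
    have : (t₀ ^ 2 + ε' * |t₀| + (η - t₀ ^ 2 / 2)) * V ≤ (θ - g / 2) * V := by
      gcongr
      linarith
    linarith
  have b4 := measureReal_le_add_div (ρ := ν n) (ρ' := μ) (X := id) (e := e n) measurable_id (hYm n)
    (fun φ hφ' => by rw [abs_sub_comm]; exact hφ φ hφ')
    (g := fun x => ε - |x - t₀|) (by
      refine LipschitzWith.of_dist_le_mul fun x y => ?_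
      rw [NNReal.coe_one, one_mul, Real.dist_eq, Real.dist_eq, sub_sub_sub_cancel_left,
        abs_sub_comm x y]
      simpa using abs_abs_sub_abs_le_abs_sub (y - t₀) (x - t₀)) (half_pos hε)
  have b5 : (ν n).real N ≤ (ν n).real {x | ε / 2 ≤ ε - |id x - t₀|} :=
    measureReal_mono fun x hx => by
      have hx' : |x - t₀| < ε' := hx
      exact (show ε / 2 ≤ ε - |x - t₀| by linarith)
  have b6 : {ω | 0 < ε - |Y n ω - t₀|} = {ω | |Y n ω - t₀| < ε} := by
    ext ω; simp
  rw [b6] at b4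
  have b7 : e n / (ε / 2) ≤ Real.exp (-(θ * V)) / 2 := by
    calc e n / (ε / 2) ≤ Real.exp (-((θ + 1) * V)) / (ε / 2) := by gcongr
      _ = (4 / ε * Real.exp (-((θ + 1) * V))) / 2 := by field_simp; ring
      _ ≤ _ := by gcongr
  have := Real.exp_pos (-(θ * V))
  linarith

/-- A sequence whose Laplace limit vanishes is superexponentially negligible. -/
lemma eventually_measureReal_le_of_laplace_zero {G : ℕ → Ω → ℝ} {v : ℕ → ℝ}
    (hv : Tendsto v atTop atTop) (hGm : ∀ n, Measurable (G n))
    (hG : HasLaplaceModel μ G v fun _ => 0) {δ : ℝ} (hδ : 0 < δ) (K : ℝ) :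
    ∀ᶠ n in atTop, μ.real {ω | δ ≤ |G n ω|} ≤ Real.exp (-(K * v n)) := by
  have e : (|K| + 1) / δ * δ = |K| + 1 := by field_simp
  refine hG.upper_bound hv hGm (l := (|K| + 1) / δ) (by positivity) ?_ ?_ <;>
    · rw [e]
      linarith [le_abs_self K]

variable {R Y G : ℕ → Ω → ℝ} {v : ℕ → ℝ}

/-- The upper bound passes from `Y` to any `R` which is exponentially equivalent to `Y + G`. -/
lemma eventually_measureReal_abs_le (hv : Tendsto v atTop atTop) (hYm : ∀ n, Measurable (Y n))
    (hGm : ∀ n, Measurable (G n)) (hY : HasLaplaceModel μ Y v fun l => l ^ 2 / 2)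
    (hG : HasLaplaceModel μ G v fun _ => 0)
    (hR : ∀ δ K : ℝ, 0 < δ → ∀ᶠ n in atTop,
      μ.real {ω | δ ≤ |R n ω - (Y n ω + G n ω)|} ≤ Real.exp (-(K * v n)))
    {r θ : ℝ} (hr : 0 < r) (hθ : θ < r ^ 2 / 2) :
    ∀ᶠ n in atTop, μ.real {ω | r ≤ |R n ω|} ≤ Real.exp (-(θ * v n)) := by
  set g : ℝ := r ^ 2 / 2 - θ with hg
  have hg0 : 0 < g := sub_pos.2 hθ
  set δ : ℝ := g / 8 / r with hδ
  have hδ0 : 0 < δ := by positivity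
  have hrδ : r * δ = g / 8 := by rw [hδ]; field_simp
  have hY' := hY.upper_bound hv hYm (r := r - 2 * δ) (l := r) (θ := θ + g / 2) hr
    (by nlinarith) (by nlinarith)
  filter_upwards [hY', eventually_measureReal_le_of_laplace_zero hv hGm hG hδ0 (θ + g / 2),
    hR δ (θ + g / 2) hδ0, eventually_mul_exp_le hv 3 (show θ < θ + g / 2 by linarith)]
    with n h1 h2 h3 h4
  have : μ.real {ω | r ≤ |R n ω|} ≤ μ.real {ω | r - 2 * δ ≤ |Y n ω|} +
      μ.real {ω | δ ≤ |G n ω|} + μ.real {ω | δ ≤ |R n ω - (Y n ω + G n ω)|} := by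
    refine (measureReal_mono (s₂ := ({ω | r - 2 * δ ≤ |Y n ω|} ∪ {ω | δ ≤ |G n ω|}) ∪
      {ω | δ ≤ |R n ω - (Y n ω + G n ω)|}) fun ω hω => ?_).trans ((measureReal_union_le _ _).trans
        (add_le_add_left (measureReal_union_le _ _) _))
    by_contra hcon
    simp only [Set.mem_union, Set.mem_ofPred_eq, not_or, not_le] at hcon hω
    have a1 := abs_add_le (R n ω - (Y n ω + G n ω)) (Y n ω + G n ω)
    have a2 := abs_add_le (Y n ω) (G n ω)
    rw [sub_add_cancel] at a1
    linarith [hcon.1.1, hcon.1.2, hcon.2]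
  linarith

/-- The lower bound passes from `Y` to any `R` which is exponentially equivalent to `Y + G`. -/
lemma eventually_le_measureReal_abs_sub (hv : Tendsto v atTop atTop)
    (hYm : ∀ n, Measurable (Y n))
    (hGm : ∀ n, Measurable (G n)) (hY : HasLaplaceModel μ Y v fun l => l ^ 2 / 2)
    (hG : HasLaplaceModel μ G v fun _ => 0)
    (hR : ∀ δ K : ℝ, 0 < δ → ∀ᶠ n in atTop,
      μ.real {ω | δ ≤ |R n ω - (Y n ω + G n ω)|} ≤ Real.exp (-(K * v n)))
    {t₀ ε θ : ℝ} (hε : 0 < ε) (hθ : t₀ ^ 2 / 2 < θ) :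
    ∀ᶠ n in atTop, Real.exp (-(θ * v n)) ≤ μ.real {ω | |R n ω - t₀| < ε} := by
  obtain ⟨θ₁, h1, h2⟩ := exists_between hθ
  have hε3 : 0 < ε / 3 := by positivity
  filter_upwards [hY.lower_bound hv hYm hε3 h1,
    eventually_measureReal_le_of_laplace_zero hv hGm hG hε3 θ,
    hR (ε / 3) θ hε3, eventually_mul_exp_le hv 3 h2]
    with n h1 h2 h3 h4
  have : μ.real {ω | |Y n ω - t₀| < ε / 3} ≤ μ.real {ω | |R n ω - t₀| < ε} +
      μ.real {ω | ε / 3 ≤ |G n ω|} + μ.real {ω | ε / 3 ≤ |R n ω - (Y n ω + G n ω)|} := by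
    refine (measureReal_mono (s₂ := ({ω | |R n ω - t₀| < ε} ∪ {ω | ε / 3 ≤ |G n ω|}) ∪
      {ω | ε / 3 ≤ |R n ω - (Y n ω + G n ω)|}) fun ω hω => ?_).trans
        ((measureReal_union_le _ _).trans (add_le_add_left (measureReal_union_le _ _) _))
    by_contra hcon
    simp only [Set.mem_union, Set.mem_ofPred_eq, not_or, not_le, not_lt] at hcon hω
    have a1 := abs_add_le (R n ω - (Y n ω + G n ω)) ((Y n ω - t₀) + G n ω)
    have a2 := abs_add_le (Y n ω - t₀) (G n ω)
    rw [show R n ω - (Y n ω + G n ω) + ((Y n ω - t₀) + G n ω) = R n ω - t₀ by ring] at a1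
    linarith [hcon.1.1, hcon.1.2, hcon.2]
  linarith

end

/-! ### The moderate deviation principle in extended reals -/

section
variable {Ω : Type*} {mΩ : MeasurableSpace Ω} {μ : Measure Ω} [IsProbabilityMeasure μ]

lemma mul_log_le_of_measureReal_le {a θ : ℝ} (ha : 0 < a) {A : Set Ω}
    (h : μ.real A ≤ Real.exp (-(θ * (1 / a)))) :
    (a : EReal) * ENNReal.log (μ A) ≤ ((-θ : ℝ) : EReal) := by
  have h1 : μ A ≤ ENNReal.ofReal (Real.exp (-(θ * (1 / a)))) :=
    (ENNReal.le_ofReal_iff_toReal_le (measure_ne_top _ _) (Real.exp_pos _).le).2 h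
  have h2 := ENNReal.log_le_log h1
  rw [ENNReal.log_ofReal_of_pos (Real.exp_pos _), Real.log_exp] at h2
  calc (a : EReal) * ENNReal.log (μ A) ≤ (a : EReal) * ((-(θ * (1 / a)) : ℝ) : EReal) :=
        mul_le_mul_of_nonneg_left h2 (by exact_mod_cast ha.le)
    _ = _ := by
        rw [← EReal.coe_mul]
        congr 1
        field_simp

lemma le_mul_log_of_le_measureReal {a θ : ℝ} (ha : 0 < a) {A : Set Ω}
    (h : Real.exp (-(θ * (1 / a))) ≤ μ.real A) :
    ((-θ : ℝ) : EReal) ≤ (a : EReal) * ENNReal.log (μ A) := by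
  have h1 : ENNReal.ofReal (Real.exp (-(θ * (1 / a)))) ≤ μ A := ENNReal.ofReal_le_of_le_toReal h
  have h2 := ENNReal.log_le_log h1
  rw [ENNReal.log_ofReal_of_pos (Real.exp_pos _), Real.log_exp] at h2
  calc ((-θ : ℝ) : EReal) = (a : EReal) * ((-(θ * (1 / a)) : ℝ) : EReal) := by
        rw [← EReal.coe_mul]
        congr 1
        field_simp
    _ ≤ _ := mul_le_mul_of_nonneg_left h2 (by exact_mod_cast ha.le)

lemma coe_ofReal_sq_div_two (t : ℝ) :
    ((ENNReal.ofReal (t ^ 2 / 2) : ℝ≥0∞) : EReal) = ((t ^ 2 / 2 : ℝ) : EReal) := by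
  rw [EReal.coe_ennreal_ofReal, max_eq_left (by positivity)]

/-- On the real line, the moderate deviation principle with rate function `t ^ 2 / 2` follows from
upper bounds for the complements of intervals centered at `0` and lower bounds for small
intervals. -/
lemma satisfiesMDP_of_bounds {T : ℕ → Ω → ℝ} {a : ℕ → ℝ} (ha : Tendsto a atTop (𝓝 0))
    (hpos : ∀ᶠ n in atTop, 0 < a n)
    (hup : ∀ r θ : ℝ, 0 < r → θ < r ^ 2 / 2 → ∀ᶠ n in atTop,
      μ.real {ω | r ≤ |Real.sqrt (a n) * T n ω|} ≤ Real.exp (-(θ * (1 / a n))))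
    (hlow : ∀ t₀ ε θ : ℝ, 0 < ε → t₀ ^ 2 / 2 < θ → ∀ᶠ n in atTop,
      Real.exp (-(θ * (1 / a n))) ≤ μ.real {ω | |Real.sqrt (a n) * T n ω - t₀| < ε}) :
    SatisfiesMDP μ T a fun t : ℝ => ENNReal.ofReal (t ^ 2 / 2) := by
  refine ⟨ha, fun A _ => ⟨?_, ?_⟩⟩
  · rw [EReal.neg_le]
    refine le_iInf₂ fun t₀ ht₀ => ?_
    rw [coe_ofReal_sq_div_two, EReal.neg_le]
    refine EReal.ge_of_forall_gt_iff_ge.1 fun z hz => ?_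
    obtain ⟨ε, hε, hball⟩ := Metric.isOpen_iff.1 isOpen_interior t₀ ht₀
    have hz' : t₀ ^ 2 / 2 < -z := by
      rw [← EReal.coe_neg, EReal.coe_lt_coe_iff] at hz
      linarith
    refine le_liminf_of_le (by isBoundedDefault) ?_
    filter_upwards [hlow t₀ ε (-z) hε hz', hpos] with n hn hn'
    have := le_mul_log_of_le_measureReal (μ := μ) (θ := -z) hn'
        (A := {ω | Real.sqrt (a n) * T n ω ∈ A})
      (hn.trans (measureReal_mono fun ω hω =>
        (interior_subset (hball hω) : Real.sqrt (a n) * T n ω ∈ A)))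
    rwa [neg_neg] at this
  · refine EReal.le_of_forall_lt_iff_le.1 fun z hz => ?_
    refine limsup_le_of_le (by isBoundedDefault) ?_
    rcases le_or_gt 0 z with h0 | h0
    · filter_upwards [hpos] with n hn
      have := mul_log_le_of_measureReal_le (μ := μ) (θ := -z) hn
        (A := {ω | Real.sqrt (a n) * T n ω ∈ A})
        (measureReal_le_one.trans (Real.one_le_exp (by
          have : 0 ≤ z * (1 / a n) := by positivity
          linarith)))
      rwa [neg_neg] at this
    have hz1 : ((-z : ℝ) : EReal) < ⨅ t ∈ closure A,
        ((ENNReal.ofReal (t ^ 2 / 2) : ℝ≥0∞) : EReal) := by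
      rw [EReal.coe_neg, EReal.neg_lt_comm]
      exact hz
    obtain ⟨y, hy1, hy2⟩ := EReal.lt_iff_exists_real_btwn.1 hz1
    have hy1' : -z < y := EReal.coe_lt_coe_iff.1 hy1
    have hy0 : 0 < 2 * y := by linarith
    have hs : Real.sqrt (2 * y) ^ 2 = 2 * y := Real.sq_sqrt hy0.le
    filter_upwards [hup (Real.sqrt (2 * y)) (-z) (Real.sqrt_pos.2 hy0) (by rw [hs]; linarith), hpos]
      with n hn hn'
    have := mul_log_le_of_measureReal_le (μ := μ) (θ := -z) hn'
        (A := {ω | Real.sqrt (a n) * T n ω ∈ A})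
      ((measureReal_mono fun ω hω => ?_).trans hn)
    · rwa [neg_neg] at this
    · have h1 := hy2.le.trans (iInf₂_le _ (subset_closure (show Real.sqrt (a n) * T n ω ∈ A from hω)))
      rw [coe_ofReal_sq_div_two, EReal.coe_le_coe_iff] at h1
      exact Real.sqrt_le_iff.2 ⟨abs_nonneg _, by rw [sq_abs]; linarith⟩

lemma isGoodRateFunction_sq : IsGoodRateFunction fun t : ℝ => ENNReal.ofReal (t ^ 2 / 2) := by
  refine ⟨Continuous.lowerSemicontinuous (ENNReal.continuous_ofReal.comp (by fun_prop)), fun α => ?_⟩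
  have : {t : ℝ | ENNReal.ofReal (t ^ 2 / 2) ≤ α} =
      Set.Icc (-Real.sqrt (2 * α)) (Real.sqrt (2 * α)) := by
    ext t
    rw [Set.mem_ofPred_eq, ENNReal.ofReal_le_iff_le_toReal ENNReal.coe_ne_top, ENNReal.coe_toReal,
      Set.mem_Icc, ← abs_le, ← Real.sqrt_sq_eq_abs, Real.sqrt_le_sqrt_iff (by positivity)]
    constructor <;> intro h <;> linarith
  rw [this]
  exact isCompact_Icc

end

/-! ### Moments of variables with exponential tails -/

section
variable {Ω : Type*} {mΩ : MeasurableSpace Ω} {μ : Measure Ω} [IsProbabilityMeasure μ]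

/-- The layer cake formula for `exp (u / 2) - 1` at `u = |X| ^ g`. -/
lemma lintegral_exp_tail_le (X : Ω → ℝ) (hX : Measurable X) {g : ℝ} (hg : 0 < g)
    (htail : ∀ t : ℝ, 0 < t → μ {ω | t < |X ω|} ≤ ENNReal.ofReal (Real.exp (1 - t ^ g))) :
    ∫⁻ ω, ENNReal.ofReal (Real.exp (|X ω| ^ g / 2) - 1) ∂μ ≤ ENNReal.ofReal (Real.exp 1) := by
  have hd : ∀ u : ℝ, ∫ t in (0 : ℝ)..u, 1 / 2 * Real.exp (1 / 2 * t) = Real.exp (u / 2) - 1 := by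
    intro u
    rw [intervalIntegral.integral_eq_sub_of_hasDerivAt (f := fun t => Real.exp (1 / 2 * t))
      (fun t _ => ?_) (Continuous.intervalIntegrable (by fun_prop) _ _)]
    · rw [mul_zero, Real.exp_zero]
      congr 2; ring
    · have h := ((hasDerivAt_id t).const_mul (1 / 2 : ℝ)).exp
      rwa [mul_one, mul_comm] at h
  have hU : Measurable fun ω => |X ω| ^ g := by fun_prop
  have key := lintegral_comp_eq_lintegral_meas_lt_mul μ (f := fun ω => |X ω| ^ g)
    (g := fun t => 1 / 2 * Real.exp (1 / 2 * t))
    (ae_of_all _ fun ω => Real.rpow_nonneg (abs_nonneg _) _) hU.aemeasurable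
    (fun t _ => Continuous.intervalIntegrable (by fun_prop) _ _)
    (ae_of_all _ fun t => by positivity)
  simp only [hd] at key
  rw [key]
  have hint : IntegrableOn (fun t : ℝ => Real.exp 1 / 2 * Real.exp (-(1 / 2) * t)) (Set.Ioi 0) :=
    (integrableOn_exp_mul_Ioi (by norm_num) 0).const_mul _
  calc ∫⁻ t in Set.Ioi 0, μ {a | t < |X a| ^ g} * ENNReal.ofReal (1 / 2 * Real.exp (1 / 2 * t))
      ≤ ∫⁻ t in Set.Ioi 0, ENNReal.ofReal (Real.exp 1 / 2 * Real.exp (-(1 / 2) * t)) := by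
        refine setLIntegral_mono' measurableSet_Ioi fun t ht => ?_
        have ht' : (0 : ℝ) < t := ht
        have h1 : μ {a | t < |X a| ^ g} ≤ ENNReal.ofReal (Real.exp (1 - t)) := by
          have h2 := htail (t ^ (1 / g)) (by positivity)
          rw [← Real.rpow_mul ht'.le, one_div_mul_cancel hg.ne', Real.rpow_one] at h2
          refine (measure_mono fun ω hω => ?_).trans h2
          have hω' : t < |X ω| ^ g := hω
          show t ^ (1 / g) < |X ω|
          calc t ^ (1 / g) < (|X ω| ^ g) ^ (1 / g) := by gcongr
            _ = |X ω| := by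
              rw [← Real.rpow_mul (abs_nonneg _), mul_one_div_cancel hg.ne', Real.rpow_one]
        calc _ ≤ ENNReal.ofReal (Real.exp (1 - t)) *
              ENNReal.ofReal (1 / 2 * Real.exp (1 / 2 * t)) := by gcongr
          _ = ENNReal.ofReal (Real.exp 1 / 2 * Real.exp (-(1 / 2) * t)) := by
            rw [← ENNReal.ofReal_mul (Real.exp_pos _).le]
            congr 1
            have e1 : Real.exp (1 - t) * (1 / 2 * Real.exp (1 / 2 * t)) =
              1 / 2 * (Real.exp (1 - t) * Real.exp (1 / 2 * t)) := by ring
            have e2 : Real.exp 1 / 2 * Real.exp (-(1 / 2) * t) =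
              1 / 2 * (Real.exp 1 * Real.exp (-(1 / 2) * t)) := by ring
            rw [e1, e2, ← Real.exp_add, ← Real.exp_add]
            congr 2; ring
    _ = ENNReal.ofReal (∫ t in Set.Ioi 0, Real.exp 1 / 2 * Real.exp (-(1 / 2) * t)) := by
        rw [ofReal_integral_eq_lintegral_ofReal hint (ae_of_all _ fun t => by positivity)]
    _ = ENNReal.ofReal (Real.exp 1) := by
        congr 1
        rw [integral_const_mul, integral_exp_mul_Ioi (by norm_num) 0]
        simp

lemma integrable_exp_tail {X : Ω → ℝ} (hX : Measurable X) {g : ℝ} (hg : 0 < g)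
    (htail : ∀ t : ℝ, 0 < t → μ {ω | t < |X ω|} ≤ ENNReal.ofReal (Real.exp (1 - t ^ g))) :
    Integrable (fun ω => Real.exp (|X ω| ^ g / 2)) μ ∧
      ∫ ω, Real.exp (|X ω| ^ g / 2) ∂μ ≤ 1 + Real.exp 1 := by
  have h := lintegral_exp_tail_le X hX hg htail
  have hm : Measurable fun ω => Real.exp (|X ω| ^ g / 2) - 1 := by fun_prop
  have h0 : ∀ ω, 0 ≤ Real.exp (|X ω| ^ g / 2) - 1 := fun ω =>
    sub_nonneg.2 (Real.one_le_exp (by positivity))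
  have hi : Integrable (fun ω => Real.exp (|X ω| ^ g / 2) - 1) μ :=
    ⟨hm.aestronglyMeasurable, (hasFiniteIntegral_iff_ofReal (ae_of_all _ h0)).2
      (h.trans_lt ENNReal.ofReal_lt_top)⟩
  have hi' : Integrable (fun ω => Real.exp (|X ω| ^ g / 2)) μ := by
    refine (hi.add (integrable_const (1 : ℝ))).congr (ae_of_all _ fun ω => ?_)
    simp
  refine ⟨hi', ?_⟩
  have e : ∫ ω, (Real.exp (|X ω| ^ g / 2) - 1) ∂μ ≤ Real.exp 1 := by
    rw [integral_eq_lintegral_of_nonneg_ae (ae_of_all _ h0) hm.aestronglyMeasurable]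
    exact ENNReal.toReal_le_of_le_ofReal (Real.exp_pos _).le h
  rw [integral_sub hi' (integrable_const _)] at e
  simp only [integral_const, probReal_univ, smul_eq_mul, mul_one] at e
  linarith

/-- Bounds for the moments of order `r` of a random variable with exponential tails, and of what
truncation removes from it. -/
lemma exists_moment_le {r g : ℝ} (hr : 0 < r) (hg : 0 < g) : ∃ K : ℝ, 1 ≤ K ∧
    ∀ {Ω : Type*} {_ : MeasurableSpace Ω} {μ : Measure Ω} [IsProbabilityMeasure μ] {X : Ω → ℝ},
    Measurable X →
    (∀ t : ℝ, 0 < t → μ {ω | t < |X ω|} ≤ ENNReal.ofReal (Real.exp (1 - t ^ g))) →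
    Integrable (fun ω => |X ω| ^ r) μ ∧ ∫ ω, |X ω| ^ r ∂μ ≤ K ∧
    ∀ T : ℝ, 0 ≤ T → ∫ ω, |X ω - max (-T) (min T (X ω))| ^ r ∂μ ≤
      K * Real.exp (-(T ^ g / 4)) := by
  obtain ⟨K, hK, h⟩ := exists_rpow_mul_exp_neg_le r (1 / 4) g hr.le (by norm_num) hg
  have h4 : ∀ x : ℝ, |x| ^ r ≤ K * Real.exp (|x| ^ g / 4) := fun x => by
    have := h |x| (abs_nonneg x)
    rw [Real.exp_neg, ← div_eq_mul_inv, div_le_iff₀ (Real.exp_pos _)] at this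
    rwa [one_div, inv_mul_eq_div] at this
  have hE : 1 ≤ 1 + Real.exp 1 := by linarith [Real.exp_pos 1]
  refine ⟨K * (1 + Real.exp 1), one_le_mul_of_one_le_of_one_le hK hE, ?_⟩
  intro Ω _ μ _ X hX htail
  obtain ⟨hi, hle⟩ := integrable_exp_tail hX hg htail
  have hb : ∀ ω, |X ω| ^ r ≤ K * Real.exp (|X ω| ^ g / 2) := fun ω => by
    refine (h4 _).trans ?_
    have : 0 ≤ |X ω| ^ g := by positivity
    gcongr ?_ * Real.exp ?_
    linarith
  have hm : Measurable fun ω => |X ω| ^ r := by fun_prop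
  have hint : Integrable (fun ω => |X ω| ^ r) μ := by
    refine (hi.const_mul K).mono' hm.aestronglyMeasurable (ae_of_all _ fun ω => ?_)
    rw [Real.norm_eq_abs, abs_of_nonneg (by positivity)]
    exact hb ω
  refine ⟨hint, ?_, fun T hT => ?_⟩
  · calc ∫ ω, |X ω| ^ r ∂μ ≤ ∫ ω, K * Real.exp (|X ω| ^ g / 2) ∂μ :=
        integral_mono hint (hi.const_mul K) hb
      _ ≤ _ := by rw [integral_const_mul]; gcongr
  · have hmT : Measurable fun ω => |X ω - max (-T) (min T (X ω))| ^ r := by fun_prop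
    have hbT : ∀ ω, |X ω - max (-T) (min T (X ω))| ^ r ≤
        Real.exp (-(T ^ g / 4)) * K * Real.exp (|X ω| ^ g / 2) := fun ω => by
      rcases le_or_gt |X ω| T with hω | hω
      · rw [clip_eq_self hω, sub_self, abs_zero, Real.zero_rpow hr.ne']
        positivity
      · calc |X ω - max (-T) (min T (X ω))| ^ r ≤ |X ω| ^ r := by
              exact Real.rpow_le_rpow (abs_nonneg _) (abs_sub_clip_le hT _) hr.le
          _ ≤ K * Real.exp (|X ω| ^ g / 4) := h4 _
          _ ≤ K * Real.exp (-(T ^ g / 4) + |X ω| ^ g / 2) := by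
              have : T ^ g ≤ |X ω| ^ g := by gcongr
              gcongr
              linarith
          _ = _ := by rw [Real.exp_add]; ring
    have hintT : Integrable (fun ω => |X ω - max (-T) (min T (X ω))| ^ r) μ := by
      refine hint.mono' hmT.aestronglyMeasurable (ae_of_all _ fun ω => ?_)
      rw [Real.norm_eq_abs, abs_of_nonneg (by positivity)]
      exact Real.rpow_le_rpow (abs_nonneg _) (abs_sub_clip_le hT _) hr.le
    calc _ ≤ ∫ ω, Real.exp (-(T ^ g / 4)) * K * Real.exp (|X ω| ^ g / 2) ∂μ :=
          integral_mono hintT (hi.const_mul _) hbT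
      _ ≤ Real.exp (-(T ^ g / 4)) * K * (1 + Real.exp 1) := by
          rw [integral_const_mul]; gcongr
      _ = _ := by ring

end

/-! ### Decoupling by the coefficient `τ` -/

section
variable {Ω : Type*} {mΩ : MeasurableSpace Ω} {μ : Measure Ω} [IsProbabilityMeasure μ]

lemma integral_eq_integral_condDistrib {β : Type*} {mβ : MeasurableSpace β} {X : Ω → β}
    {Y : Ω → ℝ} (hX : Measurable X) (hY : Measurable Y) {f : β × ℝ → ℝ}
    (hf : Measurable f) (hint : Integrable (fun ω => f (X ω, Y ω)) μ) :
    Integrable (fun ω => ∫ y, f (X ω, y) ∂condDistrib Y X μ (X ω)) μ ∧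
      ∫ ω, f (X ω, Y ω) ∂μ = ∫ ω, ∫ y, f (X ω, y) ∂condDistrib Y X μ (X ω) ∂μ := by
  have hf_int : Integrable f (μ.map fun a => (X a, Y a)) :=
    (integrable_map_measure hf.aestronglyMeasurable (hX.prodMk hY).aemeasurable).2 hint
  refine ⟨hf_int.integral_condDistrib hX.aemeasurable hY.aemeasurable, ?_⟩
  rw [← integral_condExp hX.comap_le]
  exact integral_congr_ae (condExp_prod_ae_eq_integral_condDistrib' hX hY.aemeasurable hf_int)

/-- In the expectation of a random `1`-Lipschitz function which depends on `m` only, evaluated at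
`Y`, the variable `Y` can be replaced by an independent copy at the cost of `τ(m, Y)`: the supremum
over Lipschitz functions in the definition of the coefficient stands inside of the integral. -/
lemma enorm_integral_sub_le_tauReal {Ω : Type*} {m mΩ : MeasurableSpace Ω} {μ : Measure Ω}
    [IsProbabilityMeasure μ] (hm : m ≤ mΩ) {Y : Ω → ℝ}
    (hY : Measurable Y) {B B' : ℝ} (hYB : ∀ ω, |Y ω| ≤ B) {Φ : Ω → ℝ → ℝ}
    (hΦ : Measurable[m.prod Real.measurableSpace] fun x : Ω × ℝ => Φ x.1 x.2)
    (hΦl : ∀ ω, LipschitzWith 1 (Φ ω)) (hΦB : ∀ ω, |Φ ω 0| ≤ B') :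
    ‖∫ ω, Φ ω (Y ω) ∂μ - ∫ ω, ∫ ω', Φ ω (Y ω') ∂μ ∂μ‖ₑ ≤ tauReal m μ Y := by
  have hΦ' : Measurable fun x : Ω × ℝ => Φ x.1 x.2 :=
    hΦ.mono (sup_le_sup (MeasurableSpace.comap_mono hm) le_rfl) le_rfl
  have hb : ∀ ω y, |Φ ω y| ≤ B' + |y| := fun ω y => by
    have h1 := (hΦl ω).dist_le_mul y 0
    rw [NNReal.coe_one, one_mul, Real.dist_eq, Real.dist_eq, sub_zero] at h1
    have h2 := abs_add_le (Φ ω y - Φ ω 0) (Φ ω 0)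
    rw [sub_add_cancel] at h2
    linarith [hΦB ω]
  have i0 : Integrable (fun ω => Φ ω (Y ω)) μ :=
    integrable_of_abs_le (B := B' + B) (hΦ'.comp (measurable_id.prodMk hY))
      fun ω => (hb _ _).trans (by linarith [hYB ω])
  have i1 : Integrable (fun ω => ∫ ω', Φ ω (Y ω') ∂μ) μ := by
    have : Integrable (fun x : Ω × Ω => Φ x.1 (Y x.2)) (μ.prod μ) :=
      integrable_of_abs_le (B := B' + B)
        (hΦ'.comp (measurable_fst.prodMk (hY.comp measurable_snd)))
        fun x => (hb _ _).trans (by linarith [hYB x.2])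
    exact this.integral_prod_left
  obtain ⟨i2, e2⟩ := @integral_eq_integral_condDistrib Ω mΩ μ _ Ω m id Y
    (measurable_id'' hm) hY (fun x => Φ x.1 x.2) hΦ i0
  have e3 : ∀ ω, ∫ ω', Φ ω (Y ω') ∂μ = ∫ y, Φ ω y ∂(μ.map Y) := fun ω => by
    rw [integral_map hY.aemeasurable (hΦl ω).continuous.aestronglyMeasurable]
  simp only [id] at e2 i2
  rw [e2, ← integral_sub i2 i1]
  refine (enorm_integral_le_lintegral_enorm _).trans (lintegral_mono fun ω => ?_)
  rw [e3 ω]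
  exact le_iSup (fun f : {f : ℝ → ℝ // LipschitzWith 1 f} =>
    ‖(∫ x, f.1 x ∂(condLaw m μ Y ω)) - ∫ x, f.1 x ∂(μ.map Y)‖ₑ) ⟨Φ ω, hΦl ω⟩

lemma past_le_of_measurable {X : ℤ → Ω → ℝ} (hX : ∀ j, Measurable (X j)) (p : ℤ) :
    past X p ≤ mΩ := iSup_le fun j => (hX j.1).comap_le

lemma measurable_past (X : ℤ → Ω → ℝ) {j p : ℤ} (h : j ≤ p) : Measurable[past X p] (X j) :=
  Measurable.of_comap_le
    (le_iSup (fun j : {j : ℤ // j ≤ p} => MeasurableSpace.comap (X j.1) Real.measurableSpace)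
      ⟨j, h⟩)

/-- The coefficient of a Lipschitz function of a block of consecutive variables. -/
lemma tauReal_le_mul_tauCoeff (X : ℤ → Ω → ℝ) {p j : ℤ} {l d : ℕ} (hl : 1 ≤ l)
    (hj : p + d ≤ j) {f : (Fin l → ℝ) → ℝ} (hf : IsOneLipschitz f) :
    tauReal (past X p) μ (fun ω => f fun r => X (j + (r : ℕ)) ω) ≤ l * tauCoeff μ X d := by
  have h1 : tauReal (past X p) μ (fun ω => f fun r => X (j + (r : ℕ)) ω) ≤
      tauVec (past X p) μ (fun ω (r : Fin l) => X (j + (r : ℕ)) ω) :=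
    le_iSup (fun f : {f : (Fin l → ℝ) → ℝ // IsOneLipschitz f} =>
      tauReal (past X p) μ (fun ω => f.1 fun r => X (j + (r : ℕ)) ω)) ⟨f, hf⟩
  have h2 : tauVec (past X p) μ (fun ω (r : Fin l) => X (j + (r : ℕ)) ω) ≤ tauBlock μ X l d :=
    le_iSup₂ (f := fun (p : ℤ) (j : {j : Fin l → ℤ // StrictMono j ∧ ∀ r, p + (d : ℤ) ≤ j r}) =>
      tauVec (past X p) μ (fun ω r => X (j.1 r) ω)) p
      ⟨fun r => j + (r : ℕ), fun r s hrs => by simpa using hrs, fun r => by dsimp only; omega⟩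
  have h3 : ((l : ℝ≥0∞))⁻¹ * tauBlock μ X l d ≤ tauCoeff μ X d := by
    refine le_trans ?_ (le_iSup (fun k : ℕ => tauUpTo μ X k d) l)
    exact le_iSup₂ (f := fun (i : ℕ) (_ : i ∈ Finset.Icc 1 l) =>
      ((i : ℝ≥0∞))⁻¹ * tauBlock μ X i d) l (Finset.mem_Icc.2 ⟨hl, le_rfl⟩)
  have hl0 : (l : ℝ≥0∞) ≠ 0 := by
    have : l ≠ 0 := by omega
    exact_mod_cast this
  refine (h1.trans h2).trans ?_
  calc tauBlock μ X l d = l * ((l : ℝ≥0∞)⁻¹ * tauBlock μ X l d) := by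
        rw [← mul_assoc, ENNReal.mul_inv_cancel hl0 (ENNReal.natCast_ne_top l), one_mul]
    _ ≤ _ := by gcongr

end

/-! ### Truncation -/

section
variable {Ω : Type*} {mΩ : MeasurableSpace Ω}

/-- The variables `X 1, X 2, …`, truncated at level `T` and centered. They are indexed from `0`, so
that the first `b` of them depend on `X j` with `j ≤ b`. -/
noncomputable def truncated (μ : Measure Ω) (X : ℤ → Ω → ℝ) (T : ℝ) (i : ℕ) (ω : Ω) : ℝ :=
  max (-T) (min T (X (i + 1) ω)) - ∫ ω', max (-T) (min T (X (i + 1) ω')) ∂μ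

/-- The powers `|X i| ^ g` which have exponential moments, for the truncated variables. -/
noncomputable def truncatedPow (X : ℤ → Ω → ℝ) (T g : ℝ) (i : ℕ) (ω : Ω) : ℝ :=
  |max (-T) (min T (X (i + 1) ω))| ^ g

variable {μ : Measure Ω} [IsProbabilityMeasure μ]

/-- Truncated and centered block sums are Lipschitz functions of the corresponding block of the
original sequence, so the `τ` coefficients of `X` decouple them. -/
lemma isAdmissible_truncated (P : Params) {X : ℤ → Ω → ℝ} (hX : ∀ j, Measurable (X j))
    (hXi : ∀ j, Integrable (X j) μ)
    (htau : ∀ d : ℕ, 1 ≤ d →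
      tauCoeff μ X d ≤ ENNReal.ofReal (Real.exp (-(P.c * (d : ℝ) ^ P.γ₁))))
    (hm : ∀ j : ℤ, 0 < j → ∫ ω, |X j ω| ∂μ ≤ P.m)
    (hC : ∀ j : ℤ, 0 < j → Integrable (fun ω => Real.exp (|X j ω| ^ P.γ₂ / 2)) μ ∧
      ∫ ω, Real.exp (|X j ω| ^ P.γ₂ / 2) ∂μ ≤ P.C)
    {T : ℝ} (hT : 0 ≤ T) :
    IsAdmissible P μ (T ^ P.γ₂) (fun b => past X b) (truncated μ X T)
      (truncatedPow X T P.γ₂) := by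
  have hg := P.γ₂_pos
  have hmc : ∀ j, Measurable fun ω => max (-T) (min T (X j ω)) := fun j =>
    (measurable_clip T).comp (hX j)
  have hic : ∀ j, Integrable (fun ω => max (-T) (min T (X j ω))) μ := fun j =>
    integrable_of_abs_le (hmc j) fun ω => abs_clip_le hT _
  have hmean : ∀ i : ℕ, |∫ ω', max (-T) (min T (X (i + 1) ω')) ∂μ| ≤ P.m := fun i =>
    (abs_integral_le_integral_abs).trans ((integral_mono (hic _).abs (hXi _).abs
      fun ω => abs_clip_le_abs hT _).trans (hm _ (by omega)))
  have hbd : ∀ i ω, |truncated μ X T i ω| ≤ T + P.m := fun i ω =>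
    (abs_sub _ _).trans (add_le_add (abs_clip_le hT _) (hmean i))
  have hmt : ∀ i, Measurable (truncated μ X T i) := fun i => (hmc _).sub_const _
  constructor
  · exact fun b => past_le_of_measurable hX _
  · intro b i hib
    exact (((measurable_clip T).comp (measurable_past X (by omega)) :
      Measurable[past X b] fun ω => max (-T) (min T (X (i + 1) ω)))).sub_const _
  · exact fun i => by
      have := hmc (i + 1)
      unfold truncatedPow
      fun_prop
  · exact fun i ω => Real.rpow_nonneg (abs_nonneg _) _
  · exact fun i ω => Real.rpow_le_rpow (abs_nonneg _) (abs_clip_le hT _) hg.le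
  · intro i ω
    rw [truncatedPow, ← Real.rpow_mul (abs_nonneg _), mul_one_div_cancel hg.ne', Real.rpow_one]
    exact (abs_sub _ _).trans (by linarith [hmean i])
  · intro i
    obtain ⟨h1, h2⟩ := hC (i + 1) (by omega)
    refine le_trans (integral_mono_of_nonneg (ae_of_all _ fun ω => (Real.exp_pos _).le) h1
      (ae_of_all _ fun ω => ?_)) h2
    refine Real.exp_le_exp.2 ?_
    have := Real.rpow_le_rpow (abs_nonneg _) (abs_clip_le_abs hT (X (i + 1) ω)) hg.le
    rw [truncatedPow]
    linarith
  · intro i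
    unfold truncated
    rw [integral_sub (hic _) (integrable_const _)]
    simp
  · rintro b a A d Φ hd hba hΦ hΦl ⟨B, hΦB⟩
    rcases Nat.eq_zero_or_pos A with rfl | hA
    · simp
    set f : (Fin A → ℝ) → ℝ := fun x => ∑ r : Fin A, (max (-T) (min T (x r)) -
      ∫ ω', max (-T) (min T (X ((a + (r : ℕ) : ℕ) + 1) ω')) ∂μ) with hf
    have hfl : IsOneLipschitz f := by
      intro x y
      rw [hf, ← Finset.sum_sub_distrib]
      refine (Finset.abs_sum_le_sum_abs _ _).trans (Finset.sum_le_sum fun r _ => ?_)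
      rw [sub_sub_sub_cancel_right]
      have : LipschitzWith 1 fun z : ℝ => max (-T) (min T z) :=
        (LipschitzWith.id.const_min T).const_max (-T)
      simpa [Real.dist_eq] using this.dist_le_mul (x r) (y r)
    have hfe : blockSum (truncated μ X T) a A =
        fun ω => f fun r => X ((a + 1 : ℤ) + (r : ℕ)) ω := by
      ext ω
      rw [hf, blockSum, Finset.sum_range]
      refine Finset.sum_congr rfl fun r _ => ?_
      have e : (((a + (r : ℕ) : ℕ) : ℤ) + 1) = (a + 1 : ℤ) + (r : ℕ) := by push_cast; ring
      simp only [truncated, e]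
    have hblm : Measurable (blockSum (truncated μ X T) a A) :=
      Finset.measurable_fun_sum _ fun i _ => hmt _
    have hblB : ∀ ω, |blockSum (truncated μ X T) a A ω| ≤ ∑ _i ∈ Finset.range A, (T + P.m) :=
      fun ω => (Finset.abs_sum_le_sum_abs _ _).trans (Finset.sum_le_sum fun i _ => hbd _ _)
    have h1 := enorm_integral_sub_le_tauReal (μ := μ) (past_le_of_measurable hX b) hblm hblB hΦ
      hΦl hΦB
    have h2 : tauReal (past X b) μ (blockSum (truncated μ X T) a A) ≤ A * tauCoeff μ X d := by
      rw [hfe]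
      exact tauReal_le_mul_tauCoeff X hA (by omega) hfl
    have h3 : ‖∫ ω, Φ ω (blockSum (truncated μ X T) a A ω) ∂μ -
        ∫ ω, ∫ ω', Φ ω (blockSum (truncated μ X T) a A ω') ∂μ ∂μ‖ₑ ≤
        ENNReal.ofReal (A * Real.exp (-(P.c * (d : ℝ) ^ P.γ₁))) := by
      rw [ENNReal.ofReal_mul (Nat.cast_nonneg A), ENNReal.ofReal_natCast]
      exact (h1.trans h2).trans (by gcongr; exact htau d hd)
    rw [Real.enorm_eq_ofReal_abs, ENNReal.ofReal_le_ofReal_iff (by positivity)] at h3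
    exact h3

lemma partialSum_eq (X : ℤ → Ω → ℝ) (n : ℕ) (ω : Ω) :
    partialSum X n ω = ∑ i ∈ Finset.range n, X (i + 1) ω := by
  unfold partialSum
  induction n with
  | zero => simp
  | succ n ih =>
    rw [Finset.sum_Icc_succ_top (by omega), ih, Finset.sum_range_succ]
    push_cast
    rfl

/-- Outside of the event that some variable exceeds the truncation level, the partial sum differs
from the sum of the truncated variables by a constant. -/
lemma measureReal_partialSum_sub_le {X : ℤ → Ω → ℝ} {T δ : ℝ} {g : ℝ} (n : ℕ)
    (htail : ∀ j : ℤ, 0 < j → μ {ω | T < |X j ω|} ≤ ENNReal.ofReal (Real.exp (1 - T ^ g)))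
    (hδ : ∑ i ∈ Finset.range n, |∫ ω', max (-T) (min T (X (i + 1) ω')) ∂μ| < δ) :
    μ.real {ω | δ ≤ |partialSum X n ω - blockSum (truncated μ X T) 0 n ω|} ≤
      n * Real.exp (1 - T ^ g) := by
  have hsub : {ω | δ ≤ |partialSum X n ω - blockSum (truncated μ X T) 0 n ω|} ⊆
      ⋃ i ∈ Finset.range n, {ω | T < |X ((i : ℤ) + 1) ω|} := by
    intro ω hω
    by_contra hcon
    simp only [Set.mem_iUnion, not_exists, Set.mem_ofPred_eq, not_lt] at hcon hω
    have e : partialSum X n ω - blockSum (truncated μ X T) 0 n ω =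
        ∑ i ∈ Finset.range n, ∫ ω', max (-T) (min T (X (i + 1) ω')) ∂μ := by
      rw [partialSum_eq, blockSum, ← Finset.sum_sub_distrib]
      refine Finset.sum_congr rfl fun i hi => ?_
      rw [truncated, zero_add, clip_eq_self (hcon i hi), sub_sub_cancel]
    rw [e] at hω
    exact absurd (hω.trans (Finset.abs_sum_le_sum_abs _ _)) (not_le.2 hδ)
  calc _ ≤ μ.real (⋃ i ∈ Finset.range n, {ω | T < |X ((i : ℤ) + 1) ω|}) := measureReal_mono hsub (measure_ne_top _ _)
    _ ≤ ∑ i ∈ Finset.range n, μ.real {ω | T < |X ((i : ℤ) + 1) ω|} :=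
        measureReal_biUnion_finset_le _ _
    _ ≤ ∑ i ∈ Finset.range n, Real.exp (1 - T ^ g) := by
        refine Finset.sum_le_sum fun i _ => ?_
        exact ENNReal.toReal_le_of_le_ofReal (Real.exp_pos _).le (htail _ (by omega))
    _ = _ := by simp

end

/-! ### The effect of truncation on the variance -/

section
variable {Ω : Type*} {mΩ : MeasurableSpace Ω} {μ : Measure Ω} [IsProbabilityMeasure μ]

/-- A summand of small variance has little influence on the variance of a sum, by the weighted
arithmetic-geometric mean inequality for the covariance. -/
lemma abs_variance_add_sub_le {A D : Ω → ℝ} (hA : MemLp A 2 μ) (hD : MemLp D 2 μ) {s : ℝ}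
    (hs : 0 < s) :
    |Var[fun ω => A ω + D ω; μ] - Var[A; μ]| ≤ s * Var[A; μ] + (1 + 1 / s) * Var[D; μ] := by
  have e := variance_fun_add hA hD
  have e1 := variance_fun_add (hA.const_mul s) hD
  have e2 := variance_fun_sub (hA.const_mul s) hD
  rw [variance_const_mul, covariance_const_mul_left] at e1 e2
  have h1 := variance_nonneg (fun ω => s * A ω + D ω) μ
  have h2 := variance_nonneg (fun ω => s * A ω - D ω) μ
  have h3 : (1 + 1 / s) * Var[D; μ] = Var[D; μ] + Var[D; μ] / s := by ring
  have h4 : s * (Var[D; μ] / s) = Var[D; μ] := by field_simp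
  have h5 := variance_nonneg D μ
  rw [e, h3, abs_le]
  constructor
  · have : 0 ≤ s * (s * Var[A; μ] + 2 * cov[A, D; μ] + Var[D; μ] / s) := by
      rw [mul_add, h4]; linarith
    linarith [nonneg_of_mul_nonneg_right this hs]
  · have : 0 ≤ s * (s * Var[A; μ] - 2 * cov[A, D; μ] + Var[D; μ] / s) := by
      rw [mul_add, h4]; linarith
    linarith [nonneg_of_mul_nonneg_right this hs]

/-- The variance of the part of the partial sum which is removed by truncation. -/
lemma variance_partialSum_sub_le {X : ℤ → Ω → ℝ} (hX : ∀ j, Measurable (X j)) {T ε : ℝ}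
    (hT : 0 ≤ T) (n : ℕ)
    (hL : ∀ j : ℤ, 0 < j → MemLp (X j) 2 μ)
    (hε : ∀ j : ℤ, 0 < j → ∫ ω, (X j ω - max (-T) (min T (X j ω))) ^ 2 ∂μ ≤ ε) :
    MemLp (fun ω => partialSum X n ω - blockSum (truncated μ X T) 0 n ω) 2 μ ∧
    Var[fun ω => partialSum X n ω - blockSum (truncated μ X T) 0 n ω; μ] ≤ n * (n * ε) := by
  set D : ℕ → Ω → ℝ := fun i ω => X (i + 1) ω - max (-T) (min T (X (i + 1) ω)) with hD
  have mD : ∀ i, Measurable (D i) := fun i => by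
    have := hX (i + 1)
    fun_prop
  have LD : ∀ i, MemLp (D i) 2 μ := fun i =>
    (hL (i + 1) (by omega)).mono (mD i).aestronglyMeasurable
      (ae_of_all _ fun ω => abs_sub_clip_le hT _)
  set C : ℝ := ∑ i ∈ Finset.range n, ∫ ω', max (-T) (min T (X (i + 1) ω')) ∂μ with hC
  have e : (fun ω => partialSum X n ω - blockSum (truncated μ X T) 0 n ω) =
      fun ω => (∑ i ∈ Finset.range n, D i ω) + C := by
    ext ω
    rw [partialSum_eq, blockSum, ← Finset.sum_sub_distrib, hC, ← Finset.sum_add_distrib]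
    refine Finset.sum_congr rfl fun i _ => ?_
    simp only [truncated, zero_add, hD]
    ring
  have LS : MemLp (fun ω => ∑ i ∈ Finset.range n, D i ω) 2 μ := memLp_finsetSum _ fun i _ => LD i
  rw [e]
  refine ⟨LS.add (memLp_const C), ?_⟩
  rw [variance_add_const LS.1]
  have i2 : ∀ i, Integrable (fun ω => D i ω ^ 2) μ := fun i => (LD i).integrable_sq
  calc Var[fun ω => ∑ i ∈ Finset.range n, D i ω; μ]
      ≤ ∫ ω, (∑ i ∈ Finset.range n, D i ω) ^ 2 ∂μ := variance_le_expectation_sq LS.1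
    _ ≤ ∫ ω, n * ∑ i ∈ Finset.range n, D i ω ^ 2 ∂μ := by
        refine integral_mono LS.integrable_sq
          ((integrable_finsetSum _ fun i _ => i2 i).const_mul _) fun ω => ?_
        simpa using sq_sum_le_card_mul_sum_sq (s := Finset.range n) (f := fun i => D i ω)
    _ = n * ∑ i ∈ Finset.range n, ∫ ω, D i ω ^ 2 ∂μ := by
        rw [integral_const_mul, integral_finsetSum _ fun i _ => i2 i]
    _ ≤ n * ∑ _i ∈ Finset.range n, ε := by
        gcongr with i
        exact hε _ (by omega)
    _ = _ := by simp

end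

/-! ### The choice of the scales -/

/-- The exponential orders `w` of the decoupling errors and `w'` of the truncation errors: `w` is
large compared to `1 / a n` and to `log n`, and `w'` is large compared to `w`, but small enough for
the expansion of log-Laplace transforms on blocks. Both interpolate between `1 / a n + log n` and
`R n = (n / a n) ^ (γ / 2)`: for `w' = R` the last sequence equals `1 / (a n * R n)`, which tends to
zero by the assumption on the speed. -/
lemma exists_scales {γ : ℝ} (hγ0 : 0 < γ) (hγ1 : γ < 1) {a : ℕ → ℝ} (ha_pos : ∀ n, 1 ≤ n → 0 < a n)
    (ha_zero : Tendsto a atTop (𝓝 0))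
    (ha_speed : Tendsto (fun n : ℕ => a n * (n : ℝ) ^ (γ / (2 - γ))) atTop atTop) :
    ∃ w w' : ℕ → ℝ, Tendsto w atTop atTop ∧ (∀ᶠ n in atTop, 0 < w' n) ∧
      Tendsto (fun n => 1 / a n / w n) atTop (𝓝 0) ∧
      Tendsto (fun n : ℕ => Real.log n / w n) atTop (𝓝 0) ∧
      Tendsto (fun n => w n / w' n) atTop (𝓝 0) ∧
      Tendsto (fun n : ℕ => Real.sqrt (1 / a n / n) * w' n ^ (1 / γ - 1)) atTop (𝓝 0) := by
  set v : ℕ → ℝ := fun n => 1 / a n with hv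
  have hg2 : 0 < 2 - γ := by linarith
  have hvt : Tendsto v atTop atTop := by
    have : Tendsto a atTop (𝓝[>] 0) := tendsto_nhdsWithin_iff.2
      ⟨ha_zero, (eventually_ge_atTop 1).mono fun n hn => ha_pos n hn⟩
    simpa [hv, Function.comp_def] using tendsto_inv_nhdsGT_zero.comp this
  set u : ℕ → ℝ := fun n => a n * (n : ℝ) ^ (γ / (2 - γ)) with hu
  set R : ℕ → ℝ := fun n => (v n * n) ^ (γ / 2) with hR
  have hbase : ∀ᶠ n : ℕ in atTop, 1 ≤ n ∧ 0 < a n ∧ 1 ≤ v n ∧ 0 < R n := by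
    filter_upwards [eventually_ge_atTop 1, hvt.eventually_ge_atTop 1] with n h1 h2
    have : (0 : ℝ) < n := by exact_mod_cast h1
    exact ⟨h1, ha_pos n h1, h2, Real.rpow_pos_of_pos (by positivity) _⟩
  have hvR : Tendsto (fun n => v n / R n) atTop (𝓝 0) := by
    have h1 : Tendsto (fun n => u n ^ (-(1 - γ / 2))) atTop (𝓝 0) :=
      (tendsto_rpow_neg_atTop (by linarith)).comp ha_speed
    refine h1.congr' ?_
    filter_upwards [hbase] with n ⟨h1, h2, h3, h4⟩
    have hn : (0 : ℝ) < n := by exact_mod_cast h1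
    have hv0 : 0 < v n := by linarith
    have hun : u n = (v n)⁻¹ * (n : ℝ) ^ (γ / (2 - γ)) := by simp [hu, hv]
    rw [hun, eq_div_iff h4.ne']
    simp only [hR]
    rw [Real.mul_rpow (by positivity) (by positivity),
      Real.mul_rpow (by positivity) (by positivity), ← Real.rpow_mul hn.le, Real.inv_rpow hv0.le,
      ← Real.rpow_neg hv0.le, neg_neg,
      show γ / (2 - γ) * -(1 - γ / 2) = -(γ / 2) by field_simp]
    calc v n ^ (1 - γ / 2) * (n : ℝ) ^ (-(γ / 2)) * (v n ^ (γ / 2) * (n : ℝ) ^ (γ / 2))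
        = (v n ^ (1 - γ / 2) * v n ^ (γ / 2)) * ((n : ℝ) ^ (-(γ / 2)) * (n : ℝ) ^ (γ / 2)) := by
          ring
      _ = v n := by
          rw [← Real.rpow_add hv0, ← Real.rpow_add hn]
          simp
  have hlR : Tendsto (fun n : ℕ => Real.log n / R n) atTop (𝓝 0) := by
    have h1 : Tendsto (fun n : ℕ => Real.log n / (n : ℝ) ^ (γ / 2)) atTop (𝓝 0) :=
      ((isLittleO_log_rpow_atTop (by positivity : 0 < γ / 2)).tendsto_div_nhds_zero).comp
        tendsto_natCast_atTop_atTop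
    refine squeeze_zero' ?_ ?_ h1
    · filter_upwards [hbase] with n ⟨h1, h2, h3, h4⟩
      have : (1 : ℝ) ≤ n := by exact_mod_cast h1
      have := Real.log_nonneg this
      positivity
    · filter_upwards [hbase] with n ⟨h1, h2, h3, h4⟩
      have hn : (1 : ℝ) ≤ n := by exact_mod_cast h1
      have := Real.log_nonneg hn
      have : (n : ℝ) ≤ v n * n := le_mul_of_one_le_left (by linarith) h3
      simp only [hR]
      gcongr
  set ρ : ℕ → ℝ := fun n => (v n + Real.log n) / R n with hρ
  have hρ0 : Tendsto ρ atTop (𝓝 0) := by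
    have := hvR.add hlR
    rw [add_zero] at this
    exact this.congr fun n => (add_div _ _ _).symm
  have hρpos : ∀ᶠ n in atTop, 0 < ρ n := by
    filter_upwards [hbase] with n ⟨h1, h2, h3, h4⟩
    have hn : (1 : ℝ) ≤ n := by exact_mod_cast h1
    have := Real.log_nonneg hn
    have hv0 : 0 < v n := by linarith
    positivity
  have hρ3 : Tendsto (fun n => ρ n ^ (1 / 3 : ℝ)) atTop (𝓝 0) := by
    have := hρ0.rpow_const (p := 1 / 3) (Or.inr (by norm_num))
    rwa [Real.zero_rpow (by norm_num)] at this
  have hmw : ∀ᶠ n in atTop, (v n + Real.log n) / (R n * ρ n ^ (2 / 3 : ℝ)) = ρ n ^ (1 / 3 : ℝ) := by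
    filter_upwards [hbase, hρpos] with n ⟨h1, h2, h3, h4⟩ h5
    rw [← div_div, div_eq_iff (by positivity), ← Real.rpow_add h5]
    norm_num
    rfl
  have hle : ∀ᶠ n : ℕ in atTop, 0 ≤ Real.log n ∧ 0 ≤ v n ∧ 0 < R n * ρ n ^ (2 / 3 : ℝ) := by
    filter_upwards [hbase, hρpos] with n ⟨h1, h2, h3, h4⟩ h5
    have hn : (1 : ℝ) ≤ n := by exact_mod_cast h1
    exact ⟨Real.log_nonneg hn, by linarith, by positivity⟩
  have hvw : Tendsto (fun n => v n / (R n * ρ n ^ (2 / 3 : ℝ))) atTop (𝓝 0) := by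
    refine squeeze_zero' ?_ ?_ hρ3
    · filter_upwards [hle] with n ⟨h1, h2, h3⟩
      positivity
    · filter_upwards [hle, hmw] with n ⟨h1, h2, h3⟩ h4
      rw [← h4]
      gcongr
      linarith
  refine ⟨fun n => R n * ρ n ^ (2 / 3 : ℝ), fun n => R n * ρ n ^ (1 / 3 : ℝ), ?_, ?_, hvw, ?_, ?_, ?_⟩
  · refine tendsto_atTop_mono' _ ?_ hvt
    filter_upwards [hle, hvw.eventually_le_const zero_lt_one] with n ⟨h1, h2, h3⟩ h4
    rwa [div_le_one h3] at h4
  · filter_upwards [hbase, hρpos] with n ⟨h1, h2, h3, h4⟩ h5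
    positivity
  · refine squeeze_zero' ?_ ?_ hρ3
    · filter_upwards [hle] with n ⟨h1, h2, h3⟩
      positivity
    · filter_upwards [hle, hmw] with n ⟨h1, h2, h3⟩ h4
      rw [← h4]
      gcongr
      linarith
  · refine hρ3.congr' ?_
    filter_upwards [hbase, hρpos] with n ⟨h1, h2, h3, h4⟩ h5
    rw [mul_div_mul_left _ _ h4.ne', eq_div_iff (by positivity), ← Real.rpow_add h5]
    norm_num
  · have hg : 0 ≤ 1 / γ - 1 := by
      rw [sub_nonneg, le_div_iff₀ hγ0]; linarith
    refine squeeze_zero' ?_ ?_ hvR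
    · filter_upwards [hbase, hρpos] with n ⟨h1, h2, h3, h4⟩ h5
      positivity
    · filter_upwards [hbase, hρpos, hρ0.eventually_le_const zero_lt_one] with n ⟨h1, h2, h3, h4⟩ h5 h6
      have hn : (0 : ℝ) < n := by exact_mod_cast h1
      have hv0 : 0 < v n := by linarith
      have e1 : R n ^ (1 / γ) = Real.sqrt (v n * n) := by
        rw [hR, ← Real.rpow_mul (by positivity), Real.sqrt_eq_rpow]
        congr 1
        field_simp
      have e2 : R n ^ (1 / γ - 1) = Real.sqrt (v n * n) / R n := by
        rw [Real.rpow_sub h4, Real.rpow_one, e1]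
      calc Real.sqrt (v n / n) * (R n * ρ n ^ (1 / 3 : ℝ)) ^ (1 / γ - 1)
          ≤ Real.sqrt (v n / n) * (R n * 1) ^ (1 / γ - 1) := by
            gcongr
            exact Real.rpow_le_one h5.le h6 (by norm_num)
        _ = Real.sqrt (v n / n) * Real.sqrt (v n * n) / R n := by
            rw [mul_one, e2, mul_div_assoc]
        _ = v n / R n := by
            rw [← Real.sqrt_mul (by positivity), show v n / n * (v n * n) = v n * v n by field_simp,
              Real.sqrt_mul_self hv0.le]

/-! ### Arrays of separated blocks -/

section
variable {Ω : Type*} {mΩ : MeasurableSpace Ω} {μ : Measure Ω} [IsProbabilityMeasure μ]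

lemma mgf_map_const_mul {ν : Measure ℝ} (s u : ℝ) :
    mgf id (ν.map fun x => s * x) u = mgf id ν (u * s) := by
  rw [mgf, integral_map (by fun_prop) (by fun_prop), mgf]
  simp [mul_assoc]

/-- Rescaled sums of separated blocks have a Laplace model, with a limit determined by the sum of the
variances of the blocks. -/
lemma hasLaplaceModel_blocks (P : Params) {w' : ℕ → ℝ} {F : ℕ → ℕ → MeasurableSpace Ω}
    {Z W : ℕ → ℕ → Ω → ℝ} (hadm : ∀ᶠ n in atTop, IsAdmissible P μ (w' n) (F n) (Z n) (W n))
    {b l : ℕ → ℕ → ℕ} {d : ℕ → ℕ} {s v : ℕ → ℝ} {V C : ℝ} (hv : ∀ᶠ n in atTop, 0 ≤ v n)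
    (hs : ∀ᶠ n in atTop, 0 < s n ∧ s n ≤ 1) (hd : ∀ᶠ n in atTop, 1 ≤ d n)
    (hsep : ∀ᶠ n in atTop, ∀ i, b n i + l n i + d n ≤ b n (i + 1))
    (hl : ∀ n, ∑ i ∈ Finset.range n, (l n i : ℝ) ≤ n)
    (herr : ∀ K : ℝ, ∀ᶠ n : ℕ in atTop,
      n * Real.exp (-(P.c * (d n : ℝ) ^ P.γ₁)) ≤ Real.exp (-(K * v n)))
    (hC : ∀ᶠ n : ℕ in atTop, v n * s n ^ 2 * n ≤ C)
    (hz : ∀ t ε : ℝ, 0 < ε → ∀ᶠ n in atTop, ∀ i, P.zeta (w' n) (l n i) (t * v n * s n) ≤ ε)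
    (hV : ∀ η : ℝ, 0 < η → ∀ᶠ n in atTop,
      |v n * s n ^ 2 * ∑ i ∈ Finset.range n, Var[blockSum (Z n) (b n i) (l n i); μ] - V| ≤ η) :
    HasLaplaceModel μ
      (fun n ω => s n * ∑ i ∈ Finset.range n, blockSum (Z n) (b n i) (l n i) ω) v
      (fun t => V * (t ^ 2 / 2)) := by
  have hex : ∀ n, ∃ ν : Measure ℝ, (IsAdmissible P μ (w' n) (F n) (Z n) (W n) ∧ 1 ≤ d n ∧
      ∀ i, b n i + l n i + d n ≤ b n (i + 1)) →
      IsProbabilityMeasure ν ∧ (∃ B, ∀ᵐ x ∂ν, |x| ≤ B) ∧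
      (∀ t, mgf id ν t = ∏ i ∈ Finset.range n, mgf (blockSum (Z n) (b n i) (l n i)) μ t) ∧
      ∀ φ : ℝ → ℝ, LipschitzWith 1 φ →
        |∫ ω, φ (∑ i ∈ Finset.range n, blockSum (Z n) (b n i) (l n i) ω) ∂μ - ∫ x, φ x ∂ν| ≤
          (∑ i ∈ Finset.range n, (l n i : ℝ)) * Real.exp (-(P.c * (d n : ℝ) ^ P.γ₁)) := by
    intro n
    by_cases h : IsAdmissible P μ (w' n) (F n) (Z n) (W n) ∧ 1 ≤ d n ∧
      ∀ i, b n i + l n i + d n ≤ b n (i + 1)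
    · obtain ⟨ν, hν⟩ := h.1.exists_decoupled_law h.2.1 h.2.2 n
      exact ⟨ν, fun _ => hν⟩
    · exact ⟨0, fun h' => absurd h' h⟩
  choose ν hν using hex
  refine ⟨fun n => (ν n).map fun x => s n * x,
    fun n => n * Real.exp (-(P.c * (d n : ℝ) ^ P.γ₁)), ?_, herr, ?_⟩
  · filter_upwards [hadm, hs, hd, hsep] with n h1 h2 h3 h4
    obtain ⟨i1, ⟨B, hB⟩, -, hφ⟩ := hν n ⟨h1, h3, h4⟩
    have hm : Measurable fun x : ℝ => s n * x := by fun_prop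
    refine ⟨Measure.isProbabilityMeasure_map hm.aemeasurable, ⟨s n * B, ?_⟩, fun φ hφl => ?_⟩
    · rw [ae_map_iff hm.aemeasurable (measurableSet_le (by fun_prop) (by fun_prop))]
      filter_upwards [hB] with x hx
      rw [abs_mul, abs_of_pos h2.1]
      exact mul_le_mul_of_nonneg_left hx h2.1.le
    · rw [integral_map hm.aemeasurable hφl.continuous.aestronglyMeasurable]
      refine (hφ (fun x => φ (s n * x)) ?_).trans (by gcongr; exact hl n)
      refine LipschitzWith.of_dist_le_mul fun x y => ?_
      refine (hφl.dist_le_mul _ _).trans ?_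
      rw [NNReal.coe_one, one_mul, one_mul, Real.dist_eq, Real.dist_eq, ← mul_sub, abs_mul,
        abs_of_pos h2.1]
      exact mul_le_of_le_one_left (abs_nonneg _) h2.2
  · intro t η hη
    set C' : ℝ := max C 0 with hC'
    obtain ⟨ε, hε, hcgf⟩ := exists_abs_cgf_sub_le P (η := η / 2 / (t ^ 2 * C' + 1)) (by positivity)
    filter_upwards [hadm, hs, hd, hsep, hC, hz t ε hε, hV (η / (t ^ 2 + 1)) (by positivity), hv]
      with n h1 h2 h3 h4 h5 h6 h7 h8
    obtain ⟨-, -, hmgf, -⟩ := hν n ⟨h1, h3, h4⟩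
    rw [mgf_map_const_mul, hmgf, Real.log_prod fun i _ =>
      (zero_lt_one.trans_le (h1.one_le_mgf _ _ _)).ne']
    set τ := t * v n * s n with hτ
    set S := ∑ i ∈ Finset.range n, Var[blockSum (Z n) (b n i) (l n i); μ] with hS
    have e1 : |∑ i ∈ Finset.range n, Real.log (mgf (blockSum (Z n) (b n i) (l n i)) μ τ) -
        τ ^ 2 * S / 2| ≤ η / 2 * v n := by
      rw [hS, Finset.mul_sum, Finset.sum_div, ← Finset.sum_sub_distrib]
      calc _ ≤ ∑ i ∈ Finset.range n, |Real.log (mgf (blockSum (Z n) (b n i) (l n i)) μ τ) -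
            τ ^ 2 * Var[blockSum (Z n) (b n i) (l n i); μ] / 2| := Finset.abs_sum_le_sum_abs _ _
        _ ≤ ∑ i ∈ Finset.range n, η / 2 / (t ^ 2 * C' + 1) * τ ^ 2 * (l n i : ℝ) :=
            Finset.sum_le_sum fun i _ => hcgf h1 (b n i) (l n i) τ (h6 i)
        _ = η / 2 / (t ^ 2 * C' + 1) * τ ^ 2 * ∑ i ∈ Finset.range n, (l n i : ℝ) := by
            rw [Finset.mul_sum]
        _ ≤ η / 2 / (t ^ 2 * C' + 1) * τ ^ 2 * n := by gcongr; exact hl n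
        _ = η / 2 / (t ^ 2 * C' + 1) * (t ^ 2 * (v n * s n ^ 2 * n)) * v n := by rw [hτ]; ring
        _ ≤ η / 2 / (t ^ 2 * C' + 1) * (t ^ 2 * C' + 1) * v n := by
            gcongr
            have : t ^ 2 * (v n * s n ^ 2 * n) ≤ t ^ 2 * C' := by
              gcongr
              exact h5.trans (le_max_left _ _)
            linarith
        _ = η / 2 * v n := by rw [div_mul_cancel₀ _ (by positivity)]
    have e2 : |τ ^ 2 * S / 2 - V * (t ^ 2 / 2) * v n| ≤ η / 2 * v n := by
      have : τ ^ 2 * S / 2 - V * (t ^ 2 / 2) * v n =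
          t ^ 2 / 2 * v n * (v n * s n ^ 2 * S - V) := by rw [hτ]; ring
      rw [this, abs_mul, abs_of_nonneg (by positivity)]
      calc _ ≤ t ^ 2 / 2 * v n * (η / (t ^ 2 + 1)) := by gcongr
        _ = η / 2 * v n * (t ^ 2 / (t ^ 2 + 1)) := by ring
        _ ≤ η / 2 * v n * 1 := by
            gcongr
            rw [div_le_one (by positivity)]
            linarith
        _ = _ := mul_one _
    have := abs_sub_le (∑ i ∈ Finset.range n, Real.log (mgf (blockSum (Z n) (b n i) (l n i)) μ τ))
      (τ ^ 2 * S / 2) (V * (t ^ 2 / 2) * v n)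
    linarith

end

/-! ### Block lengths and the variance of the partial sums -/

/-- The lengths `p` of the blocks and `q` of the gaps: the gaps are long enough for a decoupling error
`exp (-w)`, and the blocks are longer than the gaps, but short enough for the expansion of the
log-Laplace transform at `t` of order `x`. -/
lemma exists_block_lengths (P : Params) {w w' x : ℕ → ℝ} (hw : Tendsto w atTop atTop)
    (hw' : ∀ᶠ n in atTop, 0 < w' n) (hww : Tendsto (fun n => w n / w' n) atTop (𝓝 0))
    (hx : ∀ n, 0 ≤ x n) (hxw : Tendsto (fun n => x n * w' n ^ (1 / P.γ - 1)) atTop (𝓝 0)) :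
    ∃ p q : ℕ → ℕ, (∀ᶠ n in atTop, 1 ≤ q n ∧ q n ≤ p n ∧ w n ≤ P.c * (q n : ℝ) ^ P.γ₁) ∧
      Tendsto q atTop atTop ∧ Tendsto (fun n => (q n : ℝ) / p n) atTop (𝓝 0) ∧
      ∀ C ε : ℝ, 0 ≤ C → 0 < ε → ∀ᶠ n in atTop, ∀ (A : ℕ) (t : ℝ), A ≤ p n → |t| ≤ C * x n →
        P.zeta (w' n) A t ≤ ε := by
  have hc := P.c_pos
  have hg1 := P.γ₁_pos
  have hg2 := P.γ₂_pos
  have hκ := P.κ_pos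
  have hceil : ∀ y : ℝ, 1 ≤ y → (⌈y⌉₊ : ℝ) ≤ 2 * y := fun y hy => by
    linarith [(Nat.ceil_lt_add_one (by linarith : 0 ≤ y)).le]
  have hle : ∀ᶠ n in atTop, w n ≤ w' n := by
    filter_upwards [hw', hww.eventually_le_const zero_lt_one] with n h1 h2
    rwa [div_le_one h1] at h2
  have hw't : Tendsto w' atTop atTop := tendsto_atTop_mono' _ hle hw
  have hwc : Tendsto (fun n => (w n / P.c) ^ (1 / P.γ₁)) atTop atTop :=
    (tendsto_rpow_atTop (by positivity)).comp (hw.atTop_div_const hc)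
  have hqt : Tendsto (fun n => ⌈(w n / P.c) ^ (1 / P.γ₁)⌉₊) atTop atTop :=
    tendsto_nat_ceil_atTop.comp hwc
  have hqp : Tendsto (fun n => ((⌈(w n / P.c) ^ (1 / P.γ₁)⌉₊ : ℕ) : ℝ) /
      ((⌈w' n ^ (1 / P.γ₁)⌉₊ : ℕ) : ℝ)) atTop (𝓝 0) := by
    have h1 : Tendsto (fun n => 2 * (1 / P.c * (w n / w' n)) ^ (1 / P.γ₁)) atTop (𝓝 0) := by
      have := ((hww.const_mul (1 / P.c)).rpow_const (p := 1 / P.γ₁)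
        (Or.inr (by positivity))).const_mul 2
      rwa [mul_zero, Real.zero_rpow (by positivity), mul_zero] at this
    refine squeeze_zero' (.of_forall fun n => by positivity) ?_ h1
    filter_upwards [hwc.eventually_ge_atTop 1, hw', hw.eventually_ge_atTop 0] with n h2 h3 h4
    have h5 : 0 < w' n ^ (1 / P.γ₁) := by positivity
    calc _ ≤ 2 * (w n / P.c) ^ (1 / P.γ₁) / w' n ^ (1 / P.γ₁) := by
          gcongr
          · exact hceil _ h2
          · exact Nat.le_ceil _
      _ = 2 * (1 / P.c * (w n / w' n)) ^ (1 / P.γ₁) := by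
          rw [mul_div_assoc, ← Real.div_rpow (by positivity) h3.le]
          congr 2
          field_simp
  refine ⟨fun n => ⌈w' n ^ (1 / P.γ₁)⌉₊, fun n => ⌈(w n / P.c) ^ (1 / P.γ₁)⌉₊, ?_, hqt, hqp, ?_⟩
  · filter_upwards [hqt.eventually_ge_atTop 1, hqp.eventually_le_const zero_lt_one, hw',
      hw.eventually_ge_atTop 0] with n h1 h2 h3 h4
    refine ⟨h1, ?_, ?_⟩
    · have : (0 : ℝ) < ((⌈w' n ^ (1 / P.γ₁)⌉₊ : ℕ) : ℝ) := by
        have : 0 < w' n ^ (1 / P.γ₁) := by positivity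
        exact_mod_cast Nat.ceil_pos.2 this
      rw [div_le_one this] at h2
      exact_mod_cast h2
    · calc w n = P.c * ((w n / P.c) ^ (1 / P.γ₁)) ^ P.γ₁ := by
            rw [← Real.rpow_mul (by positivity), one_div_mul_cancel hg1.ne', Real.rpow_one]
            field_simp
        _ ≤ _ := by
            gcongr
            exact Nat.le_ceil _
  · intro C ε hC hε
    have h1 : Tendsto (fun n => C * (2 ^ P.κ + 2) * (x n * w' n ^ (1 / P.γ - 1))) atTop (𝓝 0) := by
      simpa using hxw.const_mul (C * (2 ^ P.κ + 2))
    filter_upwards [h1.eventually_le_const hε, hw't.eventually_ge_atTop 1] with n h2 h3 A t hA ht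
    have h0 : 0 < w' n := by linarith
    have hA' : (A : ℝ) ≤ 2 * w' n ^ (1 / P.γ₁) :=
      le_trans (by exact_mod_cast hA) (hceil _ (Real.one_le_rpow h3 (by positivity)))
    have e1 : (A : ℝ) ^ P.κ ≤ 2 ^ P.κ * w' n ^ (1 / P.γ - 1) := by
      calc (A : ℝ) ^ P.κ ≤ (2 * w' n ^ (1 / P.γ₁)) ^ P.κ := by gcongr
        _ = 2 ^ P.κ * w' n ^ (1 / P.γ - 1) := by
          rw [Real.mul_rpow (by norm_num) (by positivity), ← Real.rpow_mul h0.le, P.κ_eq]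
          congr 2
          field_simp
    have e2 : (A : ℝ) * w' n ^ (1 / P.γ₂ - 1) ≤ 2 * w' n ^ (1 / P.γ - 1) := by
      calc (A : ℝ) * w' n ^ (1 / P.γ₂ - 1) ≤ 2 * w' n ^ (1 / P.γ₁) * w' n ^ (1 / P.γ₂ - 1) := by
            gcongr
        _ = _ := by
          rw [mul_assoc, ← Real.rpow_add h0, P.rel]
          congr 2
          ring
    calc P.zeta (w' n) A t = |t| * ((A : ℝ) ^ P.κ + A * w' n ^ (1 / P.γ₂ - 1)) := rfl
      _ ≤ C * x n * (2 ^ P.κ * w' n ^ (1 / P.γ - 1) + 2 * w' n ^ (1 / P.γ - 1)) := by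
          have := hx n
          gcongr
      _ = C * (2 ^ P.κ + 2) * (x n * w' n ^ (1 / P.γ - 1)) := by ring
      _ ≤ ε := h2

lemma eventually_mul_exp_neg_le {v w : ℕ → ℝ} (hw : Tendsto w atTop atTop)
    (hvw : Tendsto (fun n => v n / w n) atTop (𝓝 0))
    (hlw : Tendsto (fun n : ℕ => Real.log n / w n) atTop (𝓝 0)) (K : ℝ) :
    ∀ᶠ n : ℕ in atTop, n * Real.exp (-w n) ≤ Real.exp (-(K * v n)) := by
  have h1 : Tendsto (fun n => K * (v n / w n)) atTop (𝓝 0) := by simpa using hvw.const_mul K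
  filter_upwards [h1.eventually_le_const (show (0 : ℝ) < 1 / 2 by norm_num),
    hlw.eventually_le_const (show (0 : ℝ) < 1 / 2 by norm_num), hw.eventually_gt_atTop 0,
    eventually_ge_atTop 1] with n h1 h2 h3 h4
  have hn : (0 : ℝ) < n := by exact_mod_cast h4
  rw [← mul_div_assoc, div_le_iff₀ h3] at h1
  rw [div_le_iff₀ h3] at h2
  rw [← Real.exp_log hn, ← Real.exp_add]
  exact Real.exp_le_exp.2 (by linarith)

section
variable {Ω : Type*} {mΩ : MeasurableSpace Ω} {μ : Measure Ω} [IsProbabilityMeasure μ]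

/-- The variance of the partial sum is asymptotically the sum of the variances of the blocks of
truncated variables. -/
lemma eventually_abs_variance_partialSum_sub_le (P : Params) {X : ℤ → Ω → ℝ}
    (hX : ∀ j, Measurable (X j)) (hL : ∀ j : ℤ, 0 < j → MemLp (X j) 2 μ) {K : ℝ} {T w' : ℕ → ℝ}
    {F : ℕ → ℕ → MeasurableSpace Ω} {W : ℕ → ℕ → Ω → ℝ} (hT : ∀ᶠ n in atTop, 0 ≤ T n)
    (hadm : ∀ᶠ n in atTop, IsAdmissible P μ (w' n) (F n) (truncated μ X (T n)) (W n))
    (hK : ∀ᶠ n in atTop, ∀ j : ℤ, 0 < j →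
      ∫ ω, (X j ω - max (-T n) (min (T n) (X j ω))) ^ 2 ∂μ ≤ K * Real.exp (-(w' n / 4)))
    (hw' : Tendsto (fun n : ℕ => n * Real.exp (-(w' n / 4))) atTop (𝓝 0))
    {p q : ℕ → ℕ} (hpq : ∀ᶠ n in atTop, 1 ≤ q n ∧ q n ≤ p n) (hq : Tendsto q atTop atTop)
    (hqp : Tendsto (fun n => (q n : ℝ) / p n) atTop (𝓝 0)) {η : ℝ} (hη : 0 < η) :
    ∀ᶠ n : ℕ in atTop, |Var[partialSum X n; μ] - ∑ i ∈ Finset.range n,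
      Var[blockSum (truncated μ X (T n)) (i * (p n + q n)) (bigLength n (p n) (q n) i); μ]| ≤
      η * n := by
  obtain ⟨K₁, hK₁, hdec⟩ := exists_abs_variance_sub_sum_le P
  obtain ⟨K₂, hK₂, hvar⟩ := exists_variance_le P
  set s : ℝ := η / 3 / K₂ with hs
  have hs0 : 0 < s := by positivity
  have hsK : s * K₂ = η / 3 := by rw [hs]; field_simp
  have l1 : Tendsto (fun n => K₁ * (1 / (q n : ℝ) ^ 2 + q n / p n)) atTop (𝓝 0) := by
    have h1 : Tendsto (fun n => 1 / (q n : ℝ) ^ 2) atTop (𝓝 0) := by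
      have := (tendsto_inv_atTop_zero.comp
        ((tendsto_pow_atTop two_ne_zero).comp (tendsto_natCast_atTop_atTop.comp hq) :
          Tendsto (fun n => ((q n : ℝ)) ^ 2) atTop atTop))
      simpa [Function.comp_def] using this
    simpa using (h1.add hqp).const_mul K₁
  have l2 : Tendsto (fun n : ℕ => (1 + 1 / s) * K * (n * Real.exp (-(w' n / 4)))) atTop (𝓝 0) := by
    simpa using hw'.const_mul ((1 + 1 / s) * K)
  filter_upwards [hT, hadm, hK, hpq, l1.eventually_le_const (show 0 < η / 3 by positivity),
    l2.eventually_le_const (show 0 < η / 3 by positivity)] with n h1 h2 h3 h4 h5 h6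
  obtain ⟨hD, hDv⟩ := variance_partialSum_sub_le hX h1 n hL h3
  have hS := h2.memLp_blockSum 0 n 2
  have k1 := abs_variance_add_sub_le hS hD hs0
  have e : (fun ω => blockSum (truncated μ X (T n)) 0 n ω +
      (partialSum X n ω - blockSum (truncated μ X (T n)) 0 n ω)) = partialSum X n := by
    ext ω; ring
  rw [e] at k1
  have k2 := hdec h2 (n := n) (h4.1.trans h4.2) h4.1
  have k3 := (hvar h2).1 0 n
  have k4 : s * Var[blockSum (truncated μ X (T n)) 0 n; μ] ≤ η / 3 * n := by
    calc _ ≤ s * (K₂ * n) := by gcongr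
      _ = _ := by rw [← mul_assoc, hsK]
  have k5 : (1 + 1 / s) *
      Var[fun ω => partialSum X n ω - blockSum (truncated μ X (T n)) 0 n ω; μ] ≤ η / 3 * n := by
    calc _ ≤ (1 + 1 / s) * (n * (n * (K * Real.exp (-(w' n / 4))))) := by gcongr
      _ = (1 + 1 / s) * K * (n * Real.exp (-(w' n / 4))) * n := by ring
      _ ≤ _ := by gcongr
  have k6 : K₁ * (1 / (q n : ℝ) ^ 2 + q n / p n) * n ≤ η / 3 * n := by gcongr
  rw [abs_le] at k1 k2 ⊢
  constructor <;> linarith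

end

end ModerateDeviations

open ModerateDeviations

theorem theorem2 {Ω : Type*} {mΩ : MeasurableSpace Ω} (μ : Measure Ω) [IsProbabilityMeasure μ]
    (X : ℤ → Ω → ℝ)
    (hX_meas : ∀ j, Measurable (X j))
    (hX_int : ∀ j, Integrable (X j) μ)
    (hX_centered : ∀ j, ∫ ω, X j ω ∂μ = 0)
    (c γ₁ γ₂ γ : ℝ) (hc : 0 < c) (hγ₁ : 0 < γ₁) (hγ₂ : 0 < γ₂)
    (h_tau : ∀ x : ℝ, 1 ≤ x →
      ModerateDeviations.tauCoeff μ X ⌊x⌋₊ ≤ ENNReal.ofReal (Real.exp (-c * x ^ γ₁)))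
    (h_tail : ∀ t : ℝ, 0 < t →
      ⨆ k : {k : ℤ // 0 < k}, μ {ω | t < |X k.1 ω|} ≤ ENNReal.ofReal (Real.exp (1 - t ^ γ₂)))
    (hγ : 1 / γ = 1 / γ₁ + 1 / γ₂) (hγ_lt : γ < 1)
    (h_var : 0 < liminf (fun n : ℕ =>
      ((Var[ModerateDeviations.partialSum X n; μ] / (n : ℝ) : ℝ) : EReal)) atTop)
    (a : ℕ → ℝ) (ha_pos : ∀ n, 1 ≤ n → 0 < a n)
    (ha_zero : Tendsto a atTop (𝓝 0))
    (ha_speed : Tendsto (fun n : ℕ => a n * (n : ℝ) ^ (γ / (2 - γ))) atTop atTop) :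
    ModerateDeviations.IsGoodRateFunction (fun t : ℝ => ENNReal.ofReal (t ^ 2 / 2)) ∧
    ModerateDeviations.SatisfiesMDP μ
      (fun n ω => ModerateDeviations.partialSum X n ω /
        Real.sqrt (Var[ModerateDeviations.partialSum X n; μ]))
      a (fun t : ℝ => ENNReal.ofReal (t ^ 2 / 2)) := by
  obtain ⟨K₁, hK₁, hmom₁⟩ := exists_moment_le (g := γ₂) one_pos hγ₂
  obtain ⟨K₂, hK₂, hmom₂⟩ := exists_moment_le (g := γ₂) (r := 2) two_pos hγ₂
  set P : Params :=
    { c := c, γ₁ := γ₁, γ₂ := γ₂, γ := γ, m := K₁, C := 1 + Real.exp 1, c_pos := hc, γ₁_pos := hγ₁,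
      γ₂_pos := hγ₂, rel := hγ, γ_lt := hγ_lt, m_nonneg := by linarith,
      one_le_C := by linarith [Real.exp_pos 1] } with hP
  have hγ0 : 0 < γ := P.γ_pos
  have htail : ∀ j : ℤ, 0 < j → ∀ t : ℝ, 0 < t →
      μ {ω | t < |X j ω|} ≤ ENNReal.ofReal (Real.exp (1 - t ^ γ₂)) := fun j hj t ht =>
    (le_iSup (fun k : {k : ℤ // 0 < k} => μ {ω | t < |X k.1 ω|}) ⟨j, hj⟩).trans (h_tail t ht)
  have htau : ∀ d : ℕ, 1 ≤ d →
      tauCoeff μ X d ≤ ENNReal.ofReal (Real.exp (-(P.c * (d : ℝ) ^ P.γ₁))) := fun d hd => by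
    simpa using h_tau d (by exact_mod_cast hd)
  have hL : ∀ j : ℤ, 0 < j → MemLp (X j) 2 μ := fun j hj => by
    rw [memLp_two_iff_integrable_sq (hX_meas j).aestronglyMeasurable]
    simpa using (hmom₂ (hX_meas j) (htail j hj)).1
  obtain ⟨w, w', hw, hw'0, hvw, hlw, hww, hxw⟩ := exists_scales hγ0 hγ_lt ha_pos ha_zero ha_speed
  obtain ⟨p, q, hpq, hq, hqp, hzeta⟩ := exists_block_lengths P hw hw'0 hww
    (fun n => Real.sqrt_nonneg (1 / a n / n)) hxw
  set v : ℕ → ℝ := fun n => 1 / a n with hv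
  have ha : ∀ᶠ n in atTop, 0 < a n := (eventually_ge_atTop 1).mono fun n hn => ha_pos n hn
  have hvt : Tendsto v atTop atTop := by
    have : Tendsto a atTop (𝓝[>] 0) := tendsto_nhdsWithin_iff.2 ⟨ha_zero, ha⟩
    simpa [hv, Function.comp_def] using tendsto_inv_nhdsGT_zero.comp this
  have hv0 : ∀ᶠ n in atTop, 0 ≤ v n := hvt.eventually_ge_atTop 0
  -- The truncation level `T` satisfies `T ^ γ₂ = w'`.
  set T : ℕ → ℝ := fun n => w' n ^ (1 / γ₂) with hT
  have hT0 : ∀ᶠ n in atTop, 0 ≤ T n ∧ T n ^ γ₂ = w' n := by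
    filter_upwards [hw'0] with n hn
    refine ⟨by positivity, ?_⟩
    rw [hT, ← Real.rpow_mul hn.le, one_div_mul_cancel hγ₂.ne', Real.rpow_one]
  have hadm : ∀ᶠ n in atTop, IsAdmissible P μ (w' n) (fun b => past X b) (truncated μ X (T n))
      (truncatedPow X (T n) γ₂) := by
    filter_upwards [hT0] with n hn
    rw [← hn.2]
    refine isAdmissible_truncated P hX_meas hX_int htau (fun j hj => ?_) (fun j hj => ?_) hn.1
    · simpa using (hmom₁ (hX_meas j) (htail j hj)).2.1
    · exact integrable_exp_tail (hX_meas j) hγ₂ (htail j hj)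
  have hww4 : ∀ᶠ n in atTop, w n ≤ w' n / 4 := by
    filter_upwards [hw'0, hww.eventually_le_const (show (0 : ℝ) < 1 / 4 by norm_num)] with n h1 h2
    rw [div_le_iff₀ h1] at h2
    linarith
  have hexp := eventually_mul_exp_neg_le hw hvw hlw
  have hexp4 : ∀ K : ℝ, ∀ᶠ n : ℕ in atTop,
      n * Real.exp (-(w' n / 4)) ≤ Real.exp (-(K * v n)) := fun K => by
    filter_upwards [hexp K, hww4] with n h1 h2
    refine le_trans ?_ h1
    gcongr
  have hexp0 : Tendsto (fun n : ℕ => n * Real.exp (-(w' n / 4))) atTop (𝓝 0) := by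
    refine squeeze_zero' (.of_forall fun n => by positivity) ?_
      (Real.tendsto_exp_neg_atTop_nhds_zero.comp hvt)
    filter_upwards [hexp4 1] with n hn
    simpa using hn
  -- The variance grows linearly.
  obtain ⟨c₁, hc₁, hlow⟩ : ∃ c₁ : ℝ, 0 < c₁ ∧ ∀ᶠ n : ℕ in atTop, 1 ≤ n ∧
      c₁ * n ≤ Var[partialSum X n; μ] := by
    obtain ⟨c₁, h1, h2⟩ := EReal.lt_iff_exists_real_btwn.1 h_var
    refine ⟨c₁, by exact_mod_cast h1, ?_⟩
    filter_upwards [eventually_lt_of_lt_liminf h2, eventually_ge_atTop 1] with n hn hn1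
    have hn' : (0 : ℝ) < n := by exact_mod_cast hn1
    rw [EReal.coe_lt_coe_iff, lt_div_iff₀ hn'] at hn
    exact ⟨hn1, hn.le⟩
  have hVsum : ∀ η : ℝ, 0 < η → ∀ᶠ n : ℕ in atTop, |Var[partialSum X n; μ] -
      ∑ i ∈ Finset.range n, Var[blockSum (truncated μ X (T n)) (i * (p n + q n))
        (bigLength n (p n) (q n) i); μ]| ≤ η * n := fun η hη =>
    eventually_abs_variance_partialSum_sub_le P hX_meas hL (K := K₂) (hT0.mono fun n h => h.1) hadm
      (by
        filter_upwards [hT0] with n hn j hj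
        have := (hmom₂ (hX_meas j) (htail j hj)).2.2 (T n) hn.1
        rw [hn.2] at this
        simpa using this) hexp0 (hpq.mono fun n h => ⟨h.1, h.2.1⟩) hq hqp hη
  set s : ℕ → ℝ := fun n => Real.sqrt (a n) / Real.sqrt (Var[partialSum X n; μ]) with hs
  have hvs : ∀ᶠ n : ℕ in atTop, 0 < (n : ℝ) ∧ 0 < Var[partialSum X n; μ] ∧ 0 < s n ∧
      v n * s n ^ 2 = 1 / Var[partialSum X n; μ] ∧ v n * s n ^ 2 * n ≤ 1 / c₁ := by
    filter_upwards [ha, hlow] with n h1 ⟨h2, h3⟩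
    have hn : (0 : ℝ) < n := by exact_mod_cast h2
    have hV : 0 < Var[partialSum X n; μ] := lt_of_lt_of_le (by positivity) h3
    have e : v n * s n ^ 2 = 1 / Var[partialSum X n; μ] := by
      simp only [hv, hs]
      rw [div_pow, Real.sq_sqrt h1.le, Real.sq_sqrt hV.le]
      field_simp
    refine ⟨hn, hV, by positivity, e, ?_⟩
    rw [e, one_div_mul_eq_div, div_le_div_iff₀ hV hc₁]
    linarith
  have hs1 : ∀ᶠ n : ℕ in atTop, 0 < s n ∧ s n ≤ 1 := by
    filter_upwards [hvs, hvt.eventually_ge_atTop (max (1 / c₁) 1), eventually_ge_atTop 1]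
      with n ⟨h1, h2, h3, h4, h5⟩ h6 h7
    refine ⟨h3, ?_⟩
    have hn : (1 : ℝ) ≤ n := by exact_mod_cast h7
    have h8 : 1 / c₁ ≤ v n := (le_max_left _ _).trans h6
    have h9 : 1 ≤ v n := (le_max_right _ _).trans h6
    have h10 : v n * s n ^ 2 ≤ v n * 1 := by
      have : v n * s n ^ 2 * 1 ≤ v n * s n ^ 2 * n := by gcongr
      linarith
    exact (sq_le_one_iff₀ h3.le).1 (le_of_mul_le_mul_left h10 (by linarith))
  have hz : ∀ t ε : ℝ, 0 < ε → ∀ᶠ n in atTop, ∀ A : ℕ, A ≤ p n →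
      P.zeta (w' n) A (t * v n * s n) ≤ ε := by
    intro t ε hε
    filter_upwards [hzeta (|t| * Real.sqrt (1 / c₁)) ε (by positivity) hε, hvs, hv0]
      with n h1 ⟨h2, h3, h4, h5, h6⟩ h7 A hA
    refine h1 A _ hA ?_
    rw [mul_assoc, mul_assoc, abs_mul, abs_of_nonneg (by positivity : 0 ≤ v n * s n)]
    refine mul_le_mul_of_nonneg_left ?_ (abs_nonneg t)
    rw [← Real.sqrt_mul (by positivity)]
    refine Real.le_sqrt_of_sq_le ?_
    calc (v n * s n) ^ 2 = v n * s n ^ 2 * n * (v n / n) := by field_simp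
      _ ≤ 1 / c₁ * (v n / n) := by gcongr
  -- The sum over the big blocks carries the variance.
  have hY : HasLaplaceModel μ
      (fun n ω => s n * bigSum (truncated μ X (T n)) n (p n) (q n) ω) v fun t => t ^ 2 / 2 := by
    have := hasLaplaceModel_blocks P hadm (b := fun n i => i * (p n + q n))
      (l := fun n => bigLength n (p n) (q n)) (d := q) (s := s) (v := v) (V := 1) (C := 1 / c₁) hv0 hs1
      (hpq.mono fun n h => h.1) (.of_forall fun n => bigLength_separated n (p n) (q n))
      (fun n => sum_bigLength_le _ _ _ _) (fun K => ?_) (hvs.mono fun n h => h.2.2.2.2)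
      (fun t ε hε => (hz t ε hε).mono fun n h i => h _ (min_le_left _ _)) (fun η hη => ?_)
    · simp only [one_mul] at this
      exact this
    · filter_upwards [hexp K, hpq] with n h1 ⟨h2, h3, h4⟩
      refine le_trans ?_ h1
      gcongr
    · filter_upwards [hVsum (η * c₁) (by positivity), hvs, hlow]
        with n h1 ⟨h2, h3, h4, h5, h6⟩ ⟨h7, h8⟩
      rw [h5, one_div_mul_eq_div, div_sub_one h3.ne', abs_div, abs_of_pos h3, div_le_iff₀ h3,
        abs_sub_comm]
      calc _ ≤ η * c₁ * n := h1
        _ = η * (c₁ * n) := by ring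
        _ ≤ _ := by gcongr
  -- The gaps are separated by the big blocks, and their total variance is negligible.
  have hG : HasLaplaceModel μ
      (fun n ω => s n * gapSum (truncated μ X (T n)) n (p n) (q n) ω) v fun _ => 0 := by
    obtain ⟨K₃, hK₃, hvar⟩ := exists_variance_le P
    have := hasLaplaceModel_blocks P hadm (b := fun n i => i * (p n + q n) + p n)
      (l := fun n => gapLength n (p n) (q n)) (d := p) (s := s) (v := v) (V := 0) (C := 1 / c₁) hv0 hs1
      (hpq.mono fun n h => h.1.trans h.2.1)
      (.of_forall fun n => gapLength_separated n (p n) (q n))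
      (fun n => ?_) (fun K => ?_) (hvs.mono fun n h => h.2.2.2.2)
      (fun t ε hε => ?_) (fun η hη => ?_)
    · simp only [zero_mul] at this
      exact this
    · have h1 := sum_bigLength_add_gapLength n (p n) (q n) n
      rw [Finset.sum_add_distrib] at h1
      have h2 : ∑ i ∈ Finset.range n, gapLength n (p n) (q n) i ≤ n := by
        have := min_le_left n (n * (p n + q n))
        omega
      exact_mod_cast h2
    · filter_upwards [hexp K, hpq] with n h1 ⟨h2, h3, h4⟩
      refine le_trans ?_ h1
      have : P.c * (q n : ℝ) ^ P.γ₁ ≤ P.c * (p n : ℝ) ^ P.γ₁ := by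
        have := P.c_pos
        have := P.γ₁_pos
        gcongr
      gcongr
      linarith
    · filter_upwards [hz t ε hε, hpq] with n h1 ⟨h2, h3, h4⟩ i
      exact h1 _ ((min_le_left _ _).trans h3)
    · have l1 : Tendsto (fun n => 1 / c₁ * K₃ * ((q n : ℝ) / p n)) atTop (𝓝 0) := by
        simpa using hqp.const_mul (1 / c₁ * K₃)
      filter_upwards [l1.eventually_le_const hη, hvs, hpq, hadm, hv0]
        with n h1 ⟨h2, h3, h4, h5, h6⟩ ⟨h7, h8, h9⟩ h10 h11
      have hp : (0 : ℝ) < p n := by exact_mod_cast h7.trans h8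
      have hgap : ∑ i ∈ Finset.range n, (gapLength n (p n) (q n) i : ℝ) ≤ q n / p n * n := by
        have := sum_gapLength_le n (p n) (q n) n
        rw [div_mul_eq_mul_div, le_div_iff₀ hp]
        linarith
      rw [sub_zero, abs_of_nonneg (mul_nonneg (by positivity)
        (Finset.sum_nonneg fun i _ => variance_nonneg _ _))]
      calc _ ≤ v n * s n ^ 2 * ∑ i ∈ Finset.range n, K₃ * (gapLength n (p n) (q n) i : ℝ) := by
            gcongr with i
            exact (hvar h10).1 _ _
        _ = v n * s n ^ 2 * (K₃ * ∑ i ∈ Finset.range n, (gapLength n (p n) (q n) i : ℝ)) := by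
            rw [← Finset.mul_sum]
        _ ≤ v n * s n ^ 2 * (K₃ * (q n / p n * n)) := by gcongr
        _ = v n * s n ^ 2 * n * K₃ * (q n / p n) := by ring
        _ ≤ 1 / c₁ * K₃ * (q n / p n) := by gcongr
        _ ≤ η := h1
  -- The error of truncation and centering is superexponentially small.
  have hR : ∀ δ K : ℝ, 0 < δ → ∀ᶠ n in atTop,
      μ.real {ω | δ ≤ |Real.sqrt (a n) * (partialSum X n ω / Real.sqrt (Var[partialSum X n; μ])) -
        (s n * bigSum (truncated μ X (T n)) n (p n) (q n) ω +
          s n * gapSum (truncated μ X (T n)) n (p n) (q n) ω)|} ≤ Real.exp (-(K * v n)) := by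
    intro δ K hδ
    have l1 : Tendsto (fun n : ℕ => K₁ * (n * Real.exp (-(w' n / 4)))) atTop (𝓝 0) := by
      simpa using hexp0.const_mul K₁
    filter_upwards [l1.eventually_lt_const hδ, hexp4 K, hs1, hpq, hT0, hww4,
      hw.eventually_ge_atTop 1] with n h1 h2 h3 h4 h5 h6 h7
    have hTpos : 0 < T n := by
      refine h5.1.lt_of_ne fun h0 => ?_
      have := h5.2
      rw [← h0, Real.zero_rpow hγ₂.ne'] at this
      linarith
    have hsub : {ω | δ ≤ |Real.sqrt (a n) *
        (partialSum X n ω / Real.sqrt (Var[partialSum X n; μ])) -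
        (s n * bigSum (truncated μ X (T n)) n (p n) (q n) ω +
          s n * gapSum (truncated μ X (T n)) n (p n) (q n) ω)|} ⊆
        {ω | δ ≤ |partialSum X n ω - blockSum (truncated μ X (T n)) 0 n ω|} := by
      intro ω hω
      refine le_trans (show δ ≤ _ from hω) ?_
      rw [← mul_add, bigSum_add_gapSum _ n (h4.1.trans h4.2.1)]
      have e : Real.sqrt (a n) * (partialSum X n ω / Real.sqrt (Var[partialSum X n; μ])) =
          s n * partialSum X n ω := by
        simp only [hs]; ring
      rw [e, ← mul_sub, abs_mul, abs_of_pos h3.1]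
      exact mul_le_of_le_one_left (abs_nonneg _) h3.2
    have hmean : ∀ j : ℤ, 0 < j → |∫ ω, max (-T n) (min (T n) (X j ω)) ∂μ| ≤
        K₁ * Real.exp (-(w' n / 4)) := fun j hj => by
      have hcl : Integrable (fun ω => max (-T n) (min (T n) (X j ω))) μ :=
        integrable_of_abs_le ((measurable_clip _).comp (hX_meas j)) fun ω => abs_clip_le h5.1 _
      have e1 : ∫ ω, (X j ω - max (-T n) (min (T n) (X j ω))) ∂μ =
          -∫ ω, max (-T n) (min (T n) (X j ω)) ∂μ := by
        rw [integral_sub (hX_int j) hcl, hX_centered j, zero_sub]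
      have e2 := (hmom₁ (hX_meas j) (htail j hj)).2.2 (T n) h5.1
      rw [h5.2] at e2
      simp only [Real.rpow_one] at e2
      rw [← abs_neg, ← e1]
      exact abs_integral_le_integral_abs.trans e2
    have hsum : ∑ i ∈ Finset.range n, |∫ ω', max (-T n) (min (T n) (X (i + 1) ω')) ∂μ| < δ := by
      refine lt_of_le_of_lt (Finset.sum_le_sum fun i _ => hmean (i + 1) (by omega)) ?_
      rw [Finset.sum_const, Finset.card_range, nsmul_eq_mul]
      linarith
    calc _ ≤ μ.real {ω | δ ≤ |partialSum X n ω - blockSum (truncated μ X (T n)) 0 n ω|} :=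
          measureReal_mono hsub
      _ ≤ n * Real.exp (1 - T n ^ γ₂) :=
          measureReal_partialSum_sub_le n (fun j hj => htail j hj _ hTpos) hsum
      _ ≤ n * Real.exp (-(w' n / 4)) := by
          rw [h5.2]
          gcongr
          linarith
      _ ≤ _ := h2
  have hbm : ∀ n (b l : ℕ → ℕ), Measurable fun ω => s n * ∑ i ∈ Finset.range n,
      blockSum (truncated μ X (T n)) (b i) (l i) ω := by
    intro n b l
    have : ∀ i, Measurable (truncated μ X (T n) i) := fun i =>
      ((measurable_clip _).comp (hX_meas _)).sub_const _
    unfold blockSum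
    fun_prop
  exact ⟨isGoodRateFunction_sq, satisfiesMDP_of_bounds ha_zero ha
    (fun r θ hr hθ => eventually_measureReal_abs_le hvt (fun n => hbm n _ _) (fun n => hbm n _ _)
      hY hG hR hr hθ)
    (fun t₀ ε θ hε hθ => eventually_le_measureReal_abs_sub hvt (fun n => hbm n _ _)
      (fun n => hbm n _ _) hY hG hR hε hθ)⟩
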